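/- **Setting.** Let $m\ge 0$, $T>0$, $\mu\in\mathbb R$, $p^0=\sqrt{m^2+|p|^2}$ for $p=(p^1,p^2,p^3)\in\mathbb R^3$, $v^1=p^1/p^0$, $f^{\rm eq}_p=e^{(\mu-p^0)/T}$, and let $\mathcal H=L^2\big(\mathbb R^3, f^{\rm eq}_p\,\tfrac{d^3p}{(2\pi)^3}\big)$ (complex-valued), with inner product $(\phi,\psi)=\int \tfrac{d^3p}{(2\pi)^3} f^{\rm eq}_p\phi_p^*\psi_p$. Put $\mathcal K=\mathrm{span}\{1,p^0,p^1,p^2,p^3\}\subset\mathcal H$ and $\mathcal H_{\text{non-hy}}=\mathcal K^\perp$. Let $R(\theta)$ be the rotation of $\mathbb R^3$ by the angle $\theta$ about the $p^1$ axis, $R(\theta)p=(p^1,\ p^2\cos\theta-p^3\sin\theta,\ p^2\sin\theta+p^3\cos\theta)$. We say that $\phi\in\mathcal H$ has spin $\sigma\in\mathbb Z$ if $\phi_{R(\theta)p}=e^{i\sigma\theta}\phi_p$ for every $\theta\in\mathbb R$ and almost every $p$. Let $I_0$ be a densely defined, possibly unbounded linear operator on $\mathcal H$ (the linearised collision operator,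 divided by $-p^0$) such that 1. $I_0\phi=0$ if and only if $\phi\in\mathcal K$; 2. $(\phi,I_0\psi)^*=(\psi,I_0\phi)$ and $(\phi,I_0\phi)\ge 0$ for all $\phi,\psi$ in the domain of $I_0$; 3. (isotropy of the theory) for every $\theta$, if $\phi$ is in the domain of $I_0$, then so is $\phi\circ R(\theta)$, and $I_0(\phi\circ R(\theta))=(I_0\phi)\circ R(\theta)$. Let $I$ be the Friedrichs extension of $I_0$. Assume that the non-hydrodynamic sector has a finite gap $\omega_g=-i/\tau_g$ at zero wavenumber, that is, $0<\tau_g<\infty$ and the spectrum of $I$ on $\mathcal H_{\text{non-hy}}$ has infimum $1/\tau_g$. For $k,\omega\in\mathbb C$, a *mode* with wavenumber $k$ and frequency $\omega$ is a $\phi$ in the domain of $I$ with $(I+ikv^1)\phi=i\omega\phi$. A *hydrodynamic dispersion relation* is a function $\omega:\mathbb C\to\mathbb C$ that is continuous near $0$, with $\omega(0)=0$, such that for every $k$ in a neighbourhood of $0$ there is a nonzero mode with wavenumber $k$ and frequency $\omega(k)$. It is a *hydrodynamic dispersion relation of spin $\sigma$* if these modes can be chosen of spin $\sigma$; those of spin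 $+1$ and $-1$ are the *shear waves* (of positive and negative circular polarization). **Theorem 1.** (a) Every hydrodynamic dispersion relation $\omega(k)$ is analytic at $k=0$, and its Taylor series at $0$ has a positive radius of convergence. (b) There are five hydrodynamic dispersion relations $\omega_1,\dots,\omega_5$, of spins $0,0,0,1,-1$, and numbers $\delta,\varepsilon>0$ such that for all $|k|<\delta$ there are linearly independent modes $\phi_1,\dots,\phi_5$ with wavenumber $k$ and frequencies $\omega_1(k),\dots,\omega_5(k)$, where $\phi_1,\dots,\phi_5$ have spins $0,0,0,1,-1$ respectively, and every mode with wavenumber $k$ and a frequency of modulus less than $\varepsilon$ lies in the span of $\phi_1,\dots,\phi_5$. (c) For each $\sigma\in\{1,-1\}$ there is a shear-wave dispersion relation $\omega$ of spin $\sigma$ that is analytic on the disc $|k|<1/(2\tau_g)$ and has, for every $k$ in this disc, a nonzero mode of spin $\sigma$ with wavenumber $k$ and frequency $\omega(k)$. For every shear-wave dispersion relation, the radius of convergence of its Taylor series at $0$ satisfies $$R_{\rm shear}\ \ge\ \frac{1}{2\tau_g}.$$ -/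

import Mathlib

open MeasureTheory Filter Topology

noncomputable section

namespace KineticTheory

/-- Spatial momenta `(p¹, p², p³) ∈ ℝ³`; the component `pʲ` is `p (j - 1)`. -/
abbrev Momentum : Type := EuclideanSpace ℝ (Fin 3)

/-- The energy `p⁰ = √(m² + |p|²)` of a particle of mass `m`. -/
def energy (m : ℝ) (p : Momentum) : ℝ := Real.sqrt (m ^ 2 + ‖p‖ ^ 2)

/-- The velocity `v¹ = p¹ / p⁰` in direction 1. -/
def velocity (m : ℝ) (p : Momentum) : ℝ := p 0 / energy m p

/-- The equilibrium distribution `exp ((μ - p⁰) / T)`. -/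
def equilibrium (m T μ : ℝ) (p : Momentum) : ℝ := Real.exp ((μ - energy m p) / T)

/-- The measure `f^eq d³p / (2π)³` on momentum space. -/
def eqMeasure (m T μ : ℝ) : Measure Momentum :=
  volume.withDensity fun p => ENNReal.ofReal (equilibrium m T μ p / (2 * Real.pi) ^ 3)

/-- The Hilbert space `L²(ℝ³, f^eq d³p / (2π)³)` of complex perturbations `φ`,
with inner product `(φ, ψ) = ∫ f^eq φ* ψ d³p / (2π)³`. -/
abbrev StateSpace (m T μ : ℝ) : Type := Lp ℂ 2 (eqMeasure m T μ)

/-- `span {1, p⁰, p¹, p², p³}`. -/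
def hydro (m T μ : ℝ) : Submodule ℂ (StateSpace m T μ) :=
  Submodule.span ℂ {φ | φ =ᵐ[eqMeasure m T μ] (fun _ => (1 : ℂ)) ∨
    φ =ᵐ[eqMeasure m T μ] (fun p => ((energy m p : ℝ) : ℂ)) ∨
    ∃ j : Fin 3, φ =ᵐ[eqMeasure m T μ] (fun p => ((p j : ℝ) : ℂ))}

/-- The non-hydrodynamic sector `{1, p⁰, p¹, p², p³}^⊥`. -/
def nonHydro (m T μ : ℝ) : Submodule ℂ (StateSpace m T μ) := (hydro m T μ)ᗮ

/-- The rotation by the angle `θ` around the first axis. -/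
def rotation (θ : ℝ) (p : Momentum) : Momentum :=
  !₂[p 0, Real.cos θ * p 1 - Real.sin θ * p 2, Real.sin θ * p 1 + Real.cos θ * p 2]

/-- `φ` has angular momentum `σ` about the first axis:
`φ (R(θ) p) = exp (i σ θ) φ (p)` for all angles `θ`. -/
def HasSpin {m T μ : ℝ} (σ : ℤ) (φ : StateSpace m T μ) : Prop :=
  ∀ θ : ℝ, (fun p => φ (rotation θ p)) =ᵐ[eqMeasure m T μ]
    fun p => Complex.exp (Complex.I * (σ : ℂ) * (θ : ℂ)) * φ p

/-- `I` is a linearised collision operator (`I = - L / p⁰`) consistent with thermodynamics and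
with the isotropy of the theory. It may be unbounded and is given on a dense domain. -/
structure IsCollisionOperator {m T μ : ℝ} (I : StateSpace m T μ →ₗ.[ℂ] StateSpace m T μ) :
    Prop where
  dense : Dense (I.domain : Set (StateSpace m T μ))
  /-- `I φ = 0` if and only if `φ ∈ span {1, p^ν}`. -/
  kernel : ∀ φ : StateSpace m T μ, (∃ h : φ ∈ I.domain, I ⟨φ, h⟩ = 0) ↔ φ ∈ hydro m T μ
  /-- `(φ, I ψ)* = (ψ, I φ)`. -/
  symmetric : ∀ φ ψ : I.domain,
    star (inner ℂ (φ : StateSpace m T μ) (I ψ)) = inner ℂ (ψ : StateSpace m T μ) (I φ)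
  /-- `(φ, I φ) ≥ 0`. -/
  nonneg : ∀ φ : I.domain, 0 ≤ (inner ℂ (φ : StateSpace m T μ) (I φ)).re
  /-- The collision operator has the same form in every frame rotated around the first axis. -/
  covariant : ∀ (θ : ℝ) (φ : I.domain), ∃ ψ : I.domain,
    ((ψ : StateSpace m T μ) =ᵐ[eqMeasure m T μ]
      fun p => (φ : StateSpace m T μ) (rotation θ p)) ∧
    (I ψ =ᵐ[eqMeasure m T μ] fun p => I φ (rotation θ p))

section Operators

/-- The closed-form domain of a nonnegative operator `A`: limits of sequences in `A.domain` that
are Cauchy for the quadratic form `(u, A u)`. -/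
def formDomain {H : Type*} [NormedAddCommGroup H] [InnerProductSpace ℂ H] (A : H →ₗ.[ℂ] H)
    (hA : ∀ x : A.domain, 0 ≤ (inner ℂ (x : H) (A x)).re) : Submodule ℂ H where
  carrier := {x | ∃ u : ℕ → A.domain, Tendsto (fun n => (u n : H)) atTop (𝓝 x) ∧
    Tendsto (fun i : ℕ × ℕ =>
      (inner ℂ ((u i.1 - u i.2 : A.domain) : H) (A (u i.1 - u i.2))).re) atTop (𝓝 0)}
  zero_mem' := ⟨fun _ => 0, by simp, by simp⟩
  add_mem' := by
    rintro x y ⟨u, hu, hu'⟩ ⟨v, hv, hv'⟩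
    refine ⟨fun n => u n + v n, by simpa using hu.add hv, ?_⟩
    have hlim := (hu'.const_mul 2).add (hv'.const_mul 2)
    simp only [mul_zero, add_zero] at hlim
    refine squeeze_zero (fun i => hA _) (fun i => ?_) hlim
    have key : ∀ a b : A.domain, (inner ℂ ((a + b : A.domain) : H) (A (a + b))).re ≤
        2 * (inner ℂ (a : H) (A a)).re + 2 * (inner ℂ (b : H) (A b)).re := by
      intro a b
      have h := hA (a - b)
      simp only [LinearPMap.map_sub, LinearPMap.map_add, Submodule.coe_sub, Submodule.coe_add,
        inner_sub_left, inner_sub_right, inner_add_left, inner_add_right, Complex.sub_re,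
        Complex.add_re] at h ⊢
      linarith
    have e : u i.1 + v i.1 - (u i.2 + v i.2) = (u i.1 - u i.2) + (v i.1 - v i.2) := by abel
    rw [e]
    exact key _ _
  smul_mem' := by
    rintro c x ⟨u, hu, hu'⟩
    refine ⟨fun n => c • u n, by simpa using hu.const_smul c, ?_⟩
    have key : ∀ a : A.domain, (inner ℂ ((c • a : A.domain) : H) (A (c • a))).re =
        ‖c‖ ^ 2 * (inner ℂ (a : H) (A a)).re := by
      intro a
      rw [LinearPMap.map_smul, Submodule.coe_smul, inner_smul_left, inner_smul_right, ← mul_assoc,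
        Complex.conj_mul', ← Complex.ofReal_pow, Complex.re_ofReal_mul]
    simp only [← smul_sub, key]
    simpa using hu'.const_mul (‖c‖ ^ 2)

/-- The Friedrichs extension of a densely defined, symmetric, nonnegative operator `A`: the
restriction of the adjoint of `A` to the form domain of `A`. -/
def friedrichs {H : Type*} [NormedAddCommGroup H] [InnerProductSpace ℂ H] [CompleteSpace H]
    (A : H →ₗ.[ℂ] H) (hA : ∀ x : A.domain, 0 ≤ (inner ℂ (x : H) (A x)).re) : H →ₗ.[ℂ] H :=
  A.adjoint.domRestrict (formDomain A hA)

/-- The spectrum of the part of `A` in an invariant subspace `K`: those `z` for which `A - z` does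
not map `A.domain ∩ K` onto `K` with a bounded inverse. -/
def spectrumOn {H : Type*} [NormedAddCommGroup H] [InnerProductSpace ℂ H] (A : H →ₗ.[ℂ] H)
    (K : Submodule ℂ H) : Set ℂ :=
  {z | ¬ ∃ C : ℝ, (∀ x : A.domain, (x : H) ∈ K → ‖(x : H)‖ ≤ C * ‖A x - z • (x : H)‖) ∧
    ∀ y ∈ K, ∃ x : A.domain, (x : H) ∈ K ∧ A x - z • (x : H) = y}

/-- The radius of convergence of the Taylor series of `f` at the origin. -/
def taylorRadius (f : ℂ → ℂ) : ENNReal :=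
  (FormalMultilinearSeries.ofScalars ℂ
    fun n : ℕ => iteratedDeriv n f 0 / (n.factorial : ℂ)).radius

end Operators

/-- `φ` solves `(I + i k v¹) φ = i ω φ`, the equation of motion
`(-i ω p⁰ + i k p¹) φ = L φ` for perturbations proportional to `exp (i (k x₁ - ω t))`. -/
def IsMode {m T μ : ℝ} (I : StateSpace m T μ →ₗ.[ℂ] StateSpace m T μ) (k ω : ℂ)
    (φ : StateSpace m T μ) : Prop :=
  ∃ h : φ ∈ I.domain, ∀ᵐ p ∂(eqMeasure m T μ),
    I ⟨φ, h⟩ p + Complex.I * k * ((velocity m p : ℝ) : ℂ) * φ p = Complex.I * ω * φ p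

/-- `ω(k)` is a hydrodynamic dispersion relation: it is continuous for `k` near `0`, gapless
(`ω(0) = 0`), and for each `k` near `0` there is a nonzero mode with frequency `ω(k)`. -/
def IsHydroDispersion {m T μ : ℝ} (I : StateSpace m T μ →ₗ.[ℂ] StateSpace m T μ) (ω : ℂ → ℂ) :
    Prop :=
  ω 0 = 0 ∧ ∀ᶠ k in 𝓝 (0 : ℂ), ContinuousAt ω k ∧ ∃ φ : StateSpace m T μ, φ ≠ 0 ∧
    IsMode I k (ω k) φ

/-- The same with modes of angular momentum `σ` about the direction of propagation. For `σ = 1`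
and `σ = -1` these are the shear waves with positive and negative circular polarization. -/
def IsSpinDispersion {m T μ : ℝ} (I : StateSpace m T μ →ₗ.[ℂ] StateSpace m T μ) (σ : ℤ)
    (ω : ℂ → ℂ) : Prop :=
  ω 0 = 0 ∧ ∀ᶠ k in 𝓝 (0 : ℂ), ContinuousAt ω k ∧ ∃ φ : StateSpace m T μ, φ ≠ 0 ∧
    HasSpin σ φ ∧ IsMode I k (ω k) φ

/-- The non-hydrodynamic sector has the finite gap `ω_g = -i / τ` at `k = 0`: the spectrum of `I`
in the non-hydrodynamic sector has the infimum `1 / τ > 0`. -/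
def HasGap {m T μ : ℝ} (I : StateSpace m T μ →ₗ.[ℂ] StateSpace m T μ) (τ : ℝ) : Prop :=
  0 < τ ∧ IsGLB {x : ℝ | (x : ℂ) ∈ spectrumOn I (nonHydro m T μ)} (1 / τ)

end KineticTheory

end

/-!
The kinetic equation `(I + i k v¹) φ = z φ` with `z = i ω` is treated as a perturbation, in the
wavenumber `k`, of the self-adjoint operator `I`, whose kernel is spanned by the five conserved
quantities and which is bounded below by `1 / τ` on the orthogonal complement of that kernel.

The unbounded operator `I` is replaced by its reduced resolvent `S`
(`exists_reducedResolvent`), a bounded operator with `S² ≤ τ S`. If `P` projects onto the kernel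
and `x = P φ + I φ`, then `φ = (P + S) x`, and the equation of motion becomes `modeOp k z x = 0` for
a pencil `modeOp` of bounded operators that is polynomial in `k` and `z`. The domain of the
Friedrichs extension disappears from the problem (`exists_isModeProblem_of_symmetric`). Rotational
invariance of the collision operator passes to the Friedrichs extension and to `S`
(`friedrichs_covariant`, `comm_reducedResolvent`), so the pencil respects the spin sectors.

Near `k = 0`, substitute `ω = k l`. The block of the pencil on the kernel is then divisible by `k`,
and the quotient (`slowOp`) reduces at `k = 0` to the compression of `v¹` to the kernel. By parity
under `p ↦ -p` this compression has an orthonormal eigenbasis of spins `0, 0, 0, 1, -1` in which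
vectors of equal eigenvalue have different spins (`exists_hydro_basis`): two sound waves with
opposite velocities, and three modes with velocity zero and spins `0`, `1` and `-1`. The analytic
implicit function theorem within each spin sector therefore gives five analytic branches, and an
estimate with the gap shows that they span all modes of small frequency (`exists_hydro_branches`). A
continuous dispersion relation selects from five analytic functions. Two of them either coincide
near `0` or differ in a punctured disc, and a punctured disc is connected, so that the selection is
constant (`exists_eventuallyEq_of_selection`).

For the shear waves the sector of spin `±1` meets the kernel in a line. With `J = P - (1 - P)`, the
numerical range bound `|⟨J φ, v¹ φ⟩| ≤ ‖φ‖²` makes `1 / (2 τ) - (I + i k v¹)` strictly accretive for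
the indefinite form `⟨J φ, φ⟩` when `|k| < 1 / (2 τ)` (`IsModeProblem.lyapunov`). A span of
generalized eigenvectors with `|z| < 1 / (2 τ)` is positive for this form, whereas the form is
negative off the kernel. Hence such a span has dimension at most one: the eigenvalue in the sector
is unique and simple, so it continues analytically along the disc. It cannot escape through
`|z| = 1 / (2 τ)`, because `|z| ≤ |k|` (`IsModeProblem.norm_le_of_modeOp`). This gives an analytic
function on the whole disc (`IsModeProblem.exists_analytic_eigenvalue`), with which every shear-wave
dispersion relation agrees near `0`.
-/

noncomputable section

namespace KineticTheory

/-! ### Complex analysis -/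

open scoped ContDiff in
/-- Analytic implicit function theorem for one complex unknown and one complex parameter. -/
theorem exists_analyticAt_implicit {g : ℂ × ℂ → ℂ} {k₀ z₀ : ℂ} {g' : ℂ × ℂ →L[ℂ] ℂ}
    (hg : ContDiffAt ℂ ω g (k₀, z₀)) (hg' : HasFDerivAt g g' (k₀, z₀))
    (h0 : g (k₀, z₀) = 0) (hd : g' (0, 1) ≠ 0) :
    ∃ η : ℂ → ℂ, AnalyticAt ℂ η k₀ ∧ η k₀ = z₀ ∧ ∀ᶠ k in 𝓝 k₀, g (k, η k) = 0 := by
  have hinv : (fderiv ℂ g (k₀, z₀) ∘L .inr ℂ ℂ ℂ).IsInvertible := by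
    rw [hg'.fderiv]
    refine ⟨ContinuousLinearEquiv.unitsEquivAut ℂ (Units.mk0 _ hd), ?_⟩
    ext
    simp
  have pn : (ω : WithTop ℕ∞) ≠ 0 := by simp
  refine ⟨hg.implicitFunction pn hinv, ?_, hg.implicitFunction_apply_self pn hinv, ?_⟩
  · exact (hg.contDiffAt_implicitFunction pn hinv).analyticAt
  · simpa only [h0] using hg.eventually_apply_implicitFunction pn hinv

/-- A punctured disc is the image of a half-plane under the exponential function. -/
theorem isPreconnected_punctured_ball (r : ℝ) :
    IsPreconnected (Metric.ball (0 : ℂ) r \ {0}) := by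
  rcases le_or_gt r 0 with hr | hr
  · rw [Metric.ball_eq_empty.2 hr]; simpa using isPreconnected_empty
  have himg : Metric.ball (0 : ℂ) r \ {0} = Complex.exp '' {z | z.re < Real.log r} := by
    ext z
    simp only [Set.mem_sdiff, mem_ball_zero_iff, Set.mem_singleton_iff, Set.mem_image,
      Set.mem_ofPred_eq]
    constructor
    · rintro ⟨hz, hz0⟩
      refine ⟨Complex.log z, ?_, Complex.exp_log hz0⟩
      rw [Complex.log_re]
      exact Real.log_lt_log (norm_pos_iff.2 hz0) hz
    · rintro ⟨w, hw, rfl⟩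
      refine ⟨?_, Complex.exp_ne_zero w⟩
      rw [Complex.norm_exp]
      exact (Real.lt_log_iff_exp_lt hr).1 hw
  rw [himg]
  exact (convex_halfSpace_re_lt (Real.log r)).isPreconnected.image _
    Complex.continuous_exp.continuousOn

/-- A continuous selection from finitely many analytic functions is, near the base point, one of
them: two of them that differ somewhere agree nowhere in a small punctured disc, and the punctured
disc is connected. -/
theorem exists_eventuallyEq_of_selection {ι : Type*} [Finite ι] {f : ι → ℂ → ℂ}
    (hf : ∀ i, AnalyticAt ℂ (f i) 0) (hf0 : ∀ i, f i 0 = 0) {w : ℂ → ℂ} (hw0 : w 0 = 0)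
    (hw : ∀ᶠ k in 𝓝 (0 : ℂ), ContinuousAt w k ∧ ∃ i, w k = f i k) :
    ∃ i, w =ᶠ[𝓝 0] f i := by
  have hdich : ∀ᶠ k in 𝓝 (0 : ℂ), ∀ i j, (f i =ᶠ[𝓝 0] f j → f i k = f j k) ∧
      (¬ f i =ᶠ[𝓝 0] f j → k ≠ 0 → f i k ≠ f j k) := by
    refine eventually_all.2 fun i => eventually_all.2 fun j => ?_
    by_cases hij : f i =ᶠ[𝓝 0] f j
    · filter_upwards [hij] with k hk
      exact ⟨fun _ => hk, fun h => absurd hij h⟩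
    · have h := ((hf i).eventually_eq_or_eventually_ne (hf j)).resolve_left hij
      filter_upwards [eventually_nhdsWithin_iff.1 h] with k hk
      exact ⟨fun h => absurd h hij, fun _ hk0 => hk hk0⟩
  have hcont : ∀ᶠ k in 𝓝 (0 : ℂ), ∀ i, ContinuousAt (f i) k :=
    eventually_all.2 fun i => (hf i).eventually_continuousAt
  obtain ⟨r, hr, hball⟩ := Metric.eventually_nhds_iff_ball.1 (hw.and (hdich.and hcont))
  set B : Set ℂ := Metric.ball (0 : ℂ) r \ {0} with hB
  have hBopen : IsOpen B := Metric.isOpen_ball.sdiff isClosed_singleton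
  obtain ⟨k₁, hk₁⟩ : B.Nonempty := by
    refine ⟨((r / 2 : ℝ) : ℂ), ?_, ?_⟩
    · simp [abs_of_pos hr]; linarith
    · simp; exact hr.ne'
  obtain ⟨⟨-, i, hi⟩, -⟩ := hball k₁ hk₁.1
  refine ⟨i, ?_⟩
  -- the set where `w = f i` is open and closed in the punctured disc
  have hsub : B ⊆ {k ∈ B | w k = f i k} := by
    refine (isPreconnected_punctured_ball r).subset_of_closure_inter_subset ?_ ⟨k₁, hk₁, hk₁, hi⟩ ?_
    · rw [isOpen_iff_mem_nhds]
      rintro k ⟨hk, hwk⟩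
      have hne : ∀ᶠ k' in 𝓝 k, ∀ j, f j k ≠ f i k → w k' ≠ f j k' := by
        refine eventually_all.2 fun j => ?_
        by_cases hj : f j k = f i k
        · simp [hj]
        · have h1 : ContinuousAt (fun k' => w k' - f j k') k :=
            (hball k hk.1).1.1.sub ((hball k hk.1).2.2 j)
          have h2 : w k - f j k ≠ 0 := by
            rw [hwk]; exact sub_ne_zero.2 (Ne.symm hj)
          filter_upwards [h1.eventually_ne h2] with k' hk' _
          exact sub_ne_zero.1 hk'
      filter_upwards [hne, hBopen.mem_nhds hk] with k' h1 h2
      refine ⟨h2, ?_⟩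
      obtain ⟨j, hj⟩ := (hball k' h2.1).1.2
      have hji : f j k = f i k := by
        by_contra hcon
        exact h1 j hcon hj
      have hgerm : f j =ᶠ[𝓝 0] f i := by
        by_contra hcon
        exact ((hball k hk.1).2.1 j i).2 hcon hk.2 hji
      rw [hj, ((hball k' h2.1).2.1 j i).1 hgerm]
    · rintro k ⟨hkcl, hk⟩
      refine ⟨hk, ?_⟩
      by_contra hcon
      have h1 : ContinuousAt (fun k' => w k' - f i k') k :=
        (hball k hk.1).1.1.sub ((hball k hk.1).2.2 i)
      have h2 := h1.eventually_ne (sub_ne_zero.2 hcon)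
      obtain ⟨k', hk', hk''⟩ := mem_closure_iff_nhds.1 hkcl _ h2
      exact hk' (sub_eq_zero.2 hk''.2)
  filter_upwards [Metric.ball_mem_nhds (0 : ℂ) hr] with k hk
  by_cases hk0 : k = 0
  · rw [hk0, hw0, hf0]
  · exact (hsub ⟨hk, hk0⟩).2

theorem taylorRadius_pos {f : ℂ → ℂ} (hf : AnalyticAt ℂ f 0) : 0 < taylorRadius f :=
  hf.hasFPowerSeriesAt.radius_pos

theorem le_taylorRadius {f g : ℂ → ℂ} {r : ℝ} (hr : 0 < r)
    (hg : AnalyticOnNhd ℂ g (Metric.ball 0 r)) (hfg : f =ᶠ[𝓝 0] g) :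
    ENNReal.ofReal r ≤ taylorRadius f := by
  have hgan : AnalyticAt ℂ g 0 := hg 0 (Metric.mem_ball_self hr)
  have hps := (hgan.congr hfg.symm).hasFPowerSeriesAt
  refine le_of_forall_lt fun b hb => ?_
  obtain ⟨c, hbc, hcr⟩ := ENNReal.lt_iff_exists_nnreal_btwn.1 hb
  have hcr' : (c : ℝ) < r := by
    rw [← ENNReal.ofReal_coe_nnreal] at hcr
    exact (ENNReal.ofReal_lt_ofReal_iff hr).1 hcr
  have hc0 : 0 < c := by
    rw [pos_iff_ne_zero]; rintro rfl; simp at hbc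
  have hd : DifferentiableOn ℂ g (Metric.closedBall 0 c) := fun z hz =>
    (hg z (Metric.closedBall_subset_ball hcr' hz)).differentiableAt.differentiableWithinAt
  have hps2 := hd.hasFPowerSeriesOnBall hc0
  have heq := (hps.congr hfg).eq_formalMultilinearSeries hps2.hasFPowerSeriesAt
  refine lt_of_lt_of_le hbc ?_
  rw [taylorRadius, heq]
  exact hps2.r_le

section Pencil

open scoped InnerProductSpace

variable {H : Type*} [NormedAddCommGroup H] [InnerProductSpace ℂ H] {ι : Type*} [Fintype ι]

/-- The operator `∑ i, μ i |e i⟩⟨e i|`. -/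
def diagOp (e : ι → H) (μ : ι → ℂ) : H →L[ℂ] H :=
  ∑ i, μ i • (innerSL ℂ (e i)).smulRight (e i)

theorem diagOp_apply (e : ι → H) (μ : ι → ℂ) (x : H) :
    diagOp e μ x = ∑ i, (μ i * ⟪e i, x⟫_ℂ) • e i := by
  simp [diagOp, smul_smul]

/-- The orthogonal projection `∑ i, |e i⟩⟨e i|` onto the span of an orthonormal family. -/
def spanProj (e : ι → H) : H →L[ℂ] H := diagOp e 1

theorem spanProj_apply (e : ι → H) (x : H) : spanProj e x = ∑ i, ⟪e i, x⟫_ℂ • e i := by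
  simp [spanProj, diagOp_apply]

/-- `x` transforms under the symmetries `U θ` with the character `exp (i σ θ)`. -/
def IsSpin (U : ℝ → H →ₗᵢ[ℂ] H) (σ : ℤ) (x : H) : Prop :=
  ∀ θ : ℝ, U θ x = Complex.exp (Complex.I * (σ : ℂ) * (θ : ℂ)) • x

/-- The structure of the mode problem `(I + i k V) φ = z φ` for a self-adjoint operator `I` whose
kernel has the orthonormal basis `e` and which is bounded below by `1 / τ` on the orthogonal
complement of its kernel. The unbounded operator `I` is represented by its reduced resolvent `S`,
which vanishes on the kernel and inverts `I` on the complement. -/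
structure IsModeProblem (U : ℝ → H →ₗᵢ[ℂ] H) (V S : H →L[ℂ] H) (e : ι → H) (spin : ι → ℤ)
    (τ : ℝ) : Prop where
  tau_pos : 0 < τ
  orthonormal : Orthonormal ℂ e
  spin_e : ∀ i, IsSpin U (spin i) (e i)
  comm_V : ∀ θ x, U θ (V x) = V (U θ x)
  comm_S : ∀ θ x, U θ (S x) = S (U θ x)
  norm_V : ∀ x, ‖V x‖ ≤ ‖x‖
  S_e : ∀ i, S (e i) = 0
  inner_S : ∀ i x, ⟪e i, S x⟫_ℂ = 0
  S_bound : ∀ x, ‖S x‖ ^ 2 ≤ τ * (⟪S x, x⟫_ℂ).re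

/-- The bounded pencil that encodes the mode problem: for `x = Pφ + Iφ`, where `P` is the
projection onto the kernel of `I`, one has `φ = (P + S) x` and
`(I + i k V - z) φ = (1 - P) x + (i k V - z) (P + S) x`. -/
def modeOp (V S : H →L[ℂ] H) (e : ι → H) (k z : ℂ) : H →L[ℂ] H :=
  (1 - spanProj e) + ((Complex.I * k) • V - z • 1) * (spanProj e + S)

theorem modeOp_apply (V S : H →L[ℂ] H) (e : ι → H) (k z : ℂ) (x : H) :
    modeOp V S e k z x = x - spanProj e x + ((Complex.I * k) • V (spanProj e x + S x)
      - z • (spanProj e x + S x)) := by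
  simp [modeOp]

/-! ### Spin sectors -/

theorem IsSpin.add {U : ℝ → H →ₗᵢ[ℂ] H} {σ : ℤ} {x y : H} (hx : IsSpin U σ x)
    (hy : IsSpin U σ y) : IsSpin U σ (x + y) := fun θ => by
  rw [map_add, hx θ, hy θ, smul_add]

theorem IsSpin.smul {U : ℝ → H →ₗᵢ[ℂ] H} {σ : ℤ} {x : H} (c : ℂ) (hx : IsSpin U σ x) :
    IsSpin U σ (c • x) := fun θ => by
  rw [map_smul, hx θ, smul_comm]

theorem IsSpin.sub {U : ℝ → H →ₗᵢ[ℂ] H} {σ : ℤ} {x y : H} (hx : IsSpin U σ x)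
    (hy : IsSpin U σ y) : IsSpin U σ (x - y) := fun θ => by
  rw [map_sub, hx θ, hy θ, smul_sub]

theorem IsSpin.map {U : ℝ → H →ₗᵢ[ℂ] H} {σ : ℤ} {x : H} {A : H →L[ℂ] H} (hx : IsSpin U σ x)
    (hA : ∀ θ x, U θ (A x) = A (U θ x)) : IsSpin U σ (A x) := fun θ => by
  rw [hA, hx θ, map_smul]

/-- An injective operator that commutes with the symmetries preserves spins backwards. -/
theorem IsSpin.of_map {U : ℝ → H →ₗᵢ[ℂ] H} {σ : ℤ} {x : H} {A : H →L[ℂ] H}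
    (hx : IsSpin U σ (A x)) (hinj : Function.Injective A)
    (hA : ∀ θ x, U θ (A x) = A (U θ x)) : IsSpin U σ x := fun θ => hinj <| by
  rw [← hA, hx θ, map_smul]

/-- Vectors of different spins are orthogonal. -/
theorem IsSpin.inner_eq_zero {U : ℝ → H →ₗᵢ[ℂ] H} {σ σ' : ℤ} {x y : H} (hx : IsSpin U σ x)
    (hy : IsSpin U σ' y) (h : σ ≠ σ') : ⟪x, y⟫_ℂ = 0 := by
  have hne : ((σ' : ℂ) - σ) ≠ 0 := by
    rw [sub_ne_zero]; exact_mod_cast h.symm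
  -- at this angle the two characters have opposite signs
  set θ : ℝ := Real.pi / ((σ' : ℝ) - σ) with hθ
  have hexp : starRingEnd ℂ (Complex.exp (Complex.I * (σ : ℂ) * (θ : ℂ))) *
      Complex.exp (Complex.I * (σ' : ℂ) * (θ : ℂ)) = -1 := by
    rw [← Complex.exp_conj, ← Complex.exp_add, ← Complex.exp_pi_mul_I]
    congr 1
    simp only [map_mul, Complex.conj_I, Complex.conj_ofReal, map_intCast, hθ]
    push_cast
    field_simp
    ring
  have h1 := (U θ).inner_map_map x y
  rw [hx θ, hy θ, inner_smul_left, inner_smul_right, ← mul_assoc, hexp] at h1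
  linear_combination -(1 / 2 : ℂ) * h1

namespace IsModeProblem

variable {U : ℝ → H →ₗᵢ[ℂ] H} {V S : H →L[ℂ] H} {e : ι → H} {spin : ι → ℤ} {τ : ℝ}

/-! ### The projection onto the kernel -/

theorem inner_spanProj (h : IsModeProblem U V S e spin τ) (i : ι) (x : H) :
    ⟪e i, spanProj e x⟫_ℂ = ⟪e i, x⟫_ℂ := by
  rw [spanProj_apply, h.orthonormal.inner_right_fintype]

theorem spanProj_e (h : IsModeProblem U V S e spin τ) (i : ι) : spanProj e (e i) = e i := by
  classical
  simp [spanProj_apply, orthonormal_iff_ite.1 h.orthonormal]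

theorem spanProj_eq_zero (h : IsModeProblem U V S e spin τ) {x : H} :
    spanProj e x = 0 ↔ ∀ i, ⟪e i, x⟫_ℂ = 0 := by
  refine ⟨fun hx i => ?_, fun hx => by simp [spanProj_apply, hx]⟩
  rw [← h.inner_spanProj, hx, inner_zero_right]

theorem diagOp_mul (h : IsModeProblem U V S e spin τ) (μ ν : ι → ℂ) :
    diagOp e μ * diagOp e ν = diagOp e (μ * ν) := by
  ext x
  rw [mul_apply_eq_comp, diagOp_apply, diagOp_apply e (μ * ν)]
  refine Finset.sum_congr rfl fun i _ => ?_
  rw [diagOp_apply, h.orthonormal.inner_right_fintype]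
  simp [mul_assoc]

theorem spanProj_mul_self (h : IsModeProblem U V S e spin τ) :
    spanProj e * spanProj e = spanProj e := by
  rw [spanProj, h.diagOp_mul, one_mul]

theorem spanProj_spanProj (h : IsModeProblem U V S e spin τ) (x : H) :
    spanProj e (spanProj e x) = spanProj e x := by
  rw [← mul_apply_eq_comp, h.spanProj_mul_self]

theorem spanProj_mul_S (h : IsModeProblem U V S e spin τ) : spanProj e * S = 0 := by
  ext x
  simp [spanProj_apply, h.inner_S]

theorem spanProj_S (h : IsModeProblem U V S e spin τ) (x : H) : spanProj e (S x) = 0 := by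
  simp [spanProj_apply, h.inner_S]

theorem S_mul_diagOp (h : IsModeProblem U V S e spin τ) (μ : ι → ℂ) : S * diagOp e μ = 0 := by
  ext x
  simp [diagOp_apply, h.S_e]

theorem S_spanProj (h : IsModeProblem U V S e spin τ) (x : H) : S (spanProj e x) = 0 := by
  simp [spanProj_apply, h.S_e]

theorem inner_spanProj_eq_zero (x : H) {y : H} (hy : ∀ i, ⟪e i, y⟫_ℂ = 0) :
    ⟪spanProj e x, y⟫_ℂ = 0 := by
  rw [spanProj_apply, sum_inner]
  simp [inner_smul_left, hy]

theorem inner_e_sub (h : IsModeProblem U V S e spin τ) (x : H) (i : ι) :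
    ⟪e i, x - spanProj e x⟫_ℂ = 0 := by
  rw [inner_sub_right, h.inner_spanProj, sub_self]

theorem norm_sub_spanProj_le (h : IsModeProblem U V S e spin τ) (x : H) :
    ‖x - spanProj e x‖ ≤ ‖x‖ := by
  have h1 : ⟪spanProj e x, x - spanProj e x⟫_ℂ = 0 :=
    inner_spanProj_eq_zero x (h.inner_e_sub x)
  have h2 := norm_add_sq_eq_norm_sq_add_norm_sq_of_inner_eq_zero _ _ h1
  rw [add_sub_cancel] at h2
  nlinarith [norm_nonneg x, norm_nonneg (x - spanProj e x), norm_nonneg (spanProj e x)]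

theorem norm_spanProj_le (h : IsModeProblem U V S e spin τ) (x : H) :
    ‖spanProj e x‖ ≤ ‖x‖ := by
  have h1 : ⟪spanProj e x, x - spanProj e x⟫_ℂ = 0 :=
    inner_spanProj_eq_zero x (h.inner_e_sub x)
  have h2 := norm_add_sq_eq_norm_sq_add_norm_sq_of_inner_eq_zero _ _ h1
  rw [add_sub_cancel] at h2
  nlinarith [norm_nonneg x, norm_nonneg (x - spanProj e x), norm_nonneg (spanProj e x)]

omit [Fintype ι] in
theorem norm_S_le (h : IsModeProblem U V S e spin τ) (x : H) : ‖S x‖ ≤ τ * ‖x‖ := by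
  rcases eq_or_ne (S x) 0 with h0 | h0
  · rw [h0, norm_zero]; exact mul_nonneg h.tau_pos.le (norm_nonneg x)
  have h1 := h.S_bound x
  have h2 : (⟪S x, x⟫_ℂ).re ≤ ‖S x‖ * ‖x‖ := re_inner_le_norm (𝕜 := ℂ) _ _
  have h3 : 0 < ‖S x‖ := norm_pos_iff.2 h0
  have h4 : τ * (⟪S x, x⟫_ℂ).re ≤ τ * (‖S x‖ * ‖x‖) := mul_le_mul_of_nonneg_left h2 h.tau_pos.le
  nlinarith

theorem comm_diagOp (h : IsModeProblem U V S e spin τ) (μ : ι → ℂ) (θ : ℝ) (x : H) :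
    U θ (diagOp e μ x) = diagOp e μ (U θ x) := by
  rw [diagOp_apply, diagOp_apply, map_sum]
  refine Finset.sum_congr rfl fun i _ => ?_
  set ξ := Complex.exp (Complex.I * (spin i : ℂ) * (θ : ℂ)) with hξ
  have hξ1 : starRingEnd ℂ ξ * ξ = 1 := by
    rw [Complex.conj_mul', hξ, Complex.norm_exp]
    simp
  have h1 : ⟪e i, x⟫_ℂ = starRingEnd ℂ ξ * ⟪e i, U θ x⟫_ℂ := by
    rw [← (U θ).inner_map_map (e i) x, h.spin_e i θ, inner_smul_left]
  rw [map_smul, h.spin_e i θ, smul_smul, h1]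
  congr 1
  linear_combination (μ i * ⟪e i, U θ x⟫_ℂ) * hξ1

theorem comm_spanProj (h : IsModeProblem U V S e spin τ) (θ : ℝ) (x : H) :
    U θ (spanProj e x) = spanProj e (U θ x) := h.comm_diagOp 1 θ x

theorem comm_modeOp (h : IsModeProblem U V S e spin τ) (k z : ℂ) (θ : ℝ) (x : H) :
    U θ (modeOp V S e k z x) = modeOp V S e k z (U θ x) := by
  simp only [modeOp_apply, map_add, map_sub, map_smul, h.comm_V, h.comm_S, h.comm_spanProj]

/-- In a spin sector that meets the kernel in a line, the projection onto the kernel has rank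
one. -/
theorem diagOp_of_isSpin (h : IsModeProblem U V S e spin τ) {μ : ι → ℂ} {j : ι}
    (hj : ∀ i, μ i ≠ 0 → spin i = spin j → i = j) {x : H} (hx : IsSpin U (spin j) x) :
    diagOp e μ x = (μ j * ⟪e j, x⟫_ℂ) • e j := by
  rw [diagOp_apply]
  refine Finset.sum_eq_single j (fun i _ hij => ?_) (fun hj => absurd (Finset.mem_univ j) hj)
  by_cases hμ : μ i = 0
  · simp [hμ]
  · rw [(h.spin_e i).inner_eq_zero hx fun hs => hij (hj i hμ hs)]
    simp

/-! ### The Lyapunov form -/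

theorem eq_zero_of_modeOp (h : IsModeProblem U V S e spin τ) {k z : ℂ} {x : H}
    (hx : modeOp V S e k z x = 0) (h0 : spanProj e x + S x = 0) : x = 0 := by
  have h1 : spanProj e x = 0 := by
    have := congrArg (spanProj e) h0
    rwa [map_add, h.spanProj_spanProj, h.spanProj_S, add_zero, map_zero] at this
  rw [modeOp_apply, h0, h1] at hx
  simpa using hx

theorem norm_sq_mode (h : IsModeProblem U V S e spin τ) (x : H) :
    ‖spanProj e x + S x‖ ^ 2 = ‖spanProj e x‖ ^ 2 + ‖S x‖ ^ 2 := by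
  have h1 : ⟪spanProj e x, S x⟫_ℂ = 0 := inner_spanProj_eq_zero x fun i => h.inner_S i x
  simpa [sq] using norm_add_sq_eq_norm_sq_add_norm_sq_of_inner_eq_zero _ _ h1

theorem norm_sq_mode_sub (h : IsModeProblem U V S e spin τ) (x : H) :
    ‖spanProj e x - S x‖ ^ 2 = ‖spanProj e x‖ ^ 2 + ‖S x‖ ^ 2 := by
  have h1 : ⟪spanProj e x, -S x⟫_ℂ = 0 := by
    rw [inner_neg_right, inner_spanProj_eq_zero x fun i => h.inner_S i x, neg_zero]
  simpa [sq, ← sub_eq_add_neg] using norm_add_sq_eq_norm_sq_add_norm_sq_of_inner_eq_zero _ _ h1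

/-- With `J = P - (1 - P)`, the operator `1 / (2 τ) - (I + i k V)` is strictly accretive for the
indefinite form `⟨J φ, φ⟩` as long as `|k| < 1 / (2 τ)`. -/
theorem lyapunov (h : IsModeProblem U V S e spin τ) (k : ℂ) (x : H) :
    (1 / (2 * τ) - ‖k‖) * ‖spanProj e x + S x‖ ^ 2 ≤
      (⟪spanProj e x - S x, ((1 / (2 * τ) : ℝ) : ℂ) • (spanProj e x + S x) -
        (x - spanProj e x + (Complex.I * k) • V (spanProj e x + S x))⟫_ℂ).re := by
  set a := spanProj e x with ha
  set s := S x with hs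
  set r := 1 / (2 * τ) with hr
  have hτ := h.tau_pos
  have has : ⟪a, s⟫_ℂ = 0 := inner_spanProj_eq_zero x fun i => h.inner_S i x
  have hsa : ⟪s, a⟫_ℂ = 0 := inner_eq_zero_symm.1 has
  have hac : ⟪a, x - a⟫_ℂ = 0 := inner_spanProj_eq_zero x (h.inner_e_sub x)
  have hsx : ⟪s, x - a⟫_ℂ = ⟪s, x⟫_ℂ := by rw [inner_sub_right, hsa, sub_zero]
  have hsb : 2 * r * ‖s‖ ^ 2 ≤ (⟪s, x⟫_ℂ).re := by
    have := h.S_bound x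
    have e1 : 2 * r = τ⁻¹ := by rw [hr]; field_simp
    rw [e1, inv_mul_le_iff₀ hτ]
    exact this
  have hV : -(‖k‖ * ‖a + s‖ ^ 2) ≤ -(⟪a - s, (Complex.I * k) • V (a + s)⟫_ℂ).re := by
    have h1 : (⟪a - s, (Complex.I * k) • V (a + s)⟫_ℂ).re ≤
        ‖a - s‖ * ‖(Complex.I * k) • V (a + s)‖ := re_inner_le_norm (𝕜 := ℂ) _ _
    have h2 : ‖a - s‖ = ‖a + s‖ := by
      have := (h.norm_sq_mode_sub x).trans (h.norm_sq_mode x).symm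
      exact (sq_eq_sq₀ (norm_nonneg _) (norm_nonneg _)).1 this
    have h3 : ‖(Complex.I * k) • V (a + s)‖ ≤ ‖k‖ * ‖a + s‖ := by
      rw [norm_smul, norm_mul, Complex.norm_I, one_mul]
      exact mul_le_mul_of_nonneg_left (h.norm_V _) (norm_nonneg _)
    rw [h2] at h1
    nlinarith [norm_nonneg (a + s)]
  have hexp : (⟪a - s, (r : ℂ) • (a + s) - (x - a + (Complex.I * k) • V (a + s))⟫_ℂ).re =
      r * ‖a‖ ^ 2 - r * ‖s‖ ^ 2 + (⟪s, x⟫_ℂ).re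
        - (⟪a - s, (Complex.I * k) • V (a + s)⟫_ℂ).re := by
    rw [inner_sub_right, inner_add_right, inner_smul_right, inner_add_right]
    simp only [inner_sub_left, has, hsa, hac, hsx, inner_self_eq_norm_sq_to_K]
    simp [← Complex.ofReal_pow, Complex.sub_re]
    ring
  rw [hexp, h.norm_sq_mode]
  rw [h.norm_sq_mode] at hV
  nlinarith

/-- Below `1 / (2 τ)` the operator `I + i k V` has no two-dimensional invariant subspace that
meets the orthogonal complement of the kernel of `I`: the form `⟨J φ, φ⟩` would be positive on the
former and is negative on the latter. -/
theorem eq_zero_of_chain (h : IsModeProblem U V S e spin τ) {k z₁ z₂ α : ℂ} {x₁ x₂ : H}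
    (hk : ‖k‖ < 1 / (2 * τ)) (hz₁ : ‖z₁‖ < 1 / (2 * τ)) (hz₂ : ‖z₂‖ < 1 / (2 * τ))
    (hx₁ : modeOp V S e k z₁ x₁ = 0) (h₁ : x₁ ≠ 0)
    (hx₂ : modeOp V S e k z₂ x₂ = α • (spanProj e x₁ + S x₁)) (hP : spanProj e x₂ = 0) :
    S x₂ = 0 := by
  set r := 1 / (2 * τ) with hr
  set φ₁ := spanProj e x₁ + S x₁ with hφ₁
  set ψ₁ := spanProj e x₁ - S x₁ with hψ₁
  have hre : ∀ z : ℂ, ‖z‖ < r → 0 < r - z.re := fun z hz => by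
    linarith [Complex.re_le_norm z]
  have hφ₁0 : φ₁ ≠ 0 := fun h0 => h₁ (h.eq_zero_of_modeOp hx₁ h0)
  have hsymm : ∀ x y : H, ⟪spanProj e x - S x, spanProj e y + S y⟫_ℂ =
      ⟪spanProj e x, spanProj e y⟫_ℂ - ⟪S x, S y⟫_ℂ := fun x y => by
    have e1 : ⟪spanProj e x, S y⟫_ℂ = 0 := inner_spanProj_eq_zero x fun i => h.inner_S i y
    have e2 : ⟪S x, spanProj e y⟫_ℂ = 0 := inner_eq_zero_symm.1 <|
      inner_spanProj_eq_zero y fun i => h.inner_S i x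
    simp only [inner_sub_left, inner_add_right, e1, e2]
    ring
  have hconj : ∀ x y : H, ⟪spanProj e x - S x, spanProj e y + S y⟫_ℂ =
      starRingEnd ℂ ⟪spanProj e y - S y, spanProj e x + S x⟫_ℂ := fun x y => by
    rw [hsymm, hsymm, map_sub, inner_conj_symm, inner_conj_symm]
  have hself : ∀ x : H, ⟪spanProj e x - S x, spanProj e x + S x⟫_ℂ =
      ((‖spanProj e x‖ ^ 2 - ‖S x‖ ^ 2 : ℝ) : ℂ) := fun x => by
    rw [hsymm, inner_self_eq_norm_sq_to_K, inner_self_eq_norm_sq_to_K]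
    push_cast; rfl
  -- the first eigenvector is a positive vector of the form
  set p : ℝ := ‖spanProj e x₁‖ ^ 2 - ‖S x₁‖ ^ 2 with hp
  have hact₁ : x₁ - spanProj e x₁ + (Complex.I * k) • V φ₁ = z₁ • φ₁ := by
    rw [modeOp_apply] at hx₁
    rw [← sub_eq_zero, ← hx₁]
    module
  have hp0 : 0 < p := by
    have h1 := h.lyapunov k x₁
    rw [← hφ₁, hact₁, ← sub_smul, inner_smul_right, hself, ← hp, Complex.re_mul_ofReal] at h1
    have h2 : 0 < (r - ‖k‖) * ‖φ₁‖ ^ 2 := by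
      have := norm_pos_iff.2 hφ₁0
      have : 0 < r - ‖k‖ := by linarith
      positivity
    have h3 : 0 < (r - z₁.re) * p := by
      refine lt_of_lt_of_le h2 (le_of_le_of_eq h1 ?_)
      rw [Complex.sub_re, Complex.ofReal_re]
    exact (mul_pos_iff_of_pos_left (hre z₁ hz₁)).1 h3
  have hpC : (p : ℂ) ≠ 0 := by exact_mod_cast hp0.ne'
  -- subtract the component along the first eigenvector
  set γ : ℂ := -(⟪ψ₁, S x₂⟫_ℂ / p) with hγ
  set y := x₂ + γ • x₁ with hy
  have hφy : spanProj e y + S y = S x₂ + γ • φ₁ := by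
    rw [hy, map_add, map_add, hP, map_smul, map_smul, hφ₁, smul_add]; abel
  have horth : ⟪ψ₁, spanProj e y + S y⟫_ℂ = 0 := by
    rw [hφy, inner_add_right, inner_smul_right, hψ₁, hφ₁, hself, ← hp, ← hψ₁, hγ]
    field_simp
    ring
  have horth' : ⟪spanProj e y - S y, φ₁⟫_ℂ = 0 := by
    rw [hφ₁, hconj, ← hψ₁, horth, map_zero]
  have hact₂ : x₂ + (Complex.I * k) • V (S x₂) = z₂ • S x₂ + α • φ₁ := by
    rw [modeOp_apply, hP] at hx₂
    simp only [sub_zero, zero_add] at hx₂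
    rw [← sub_eq_zero, ← hx₂]
    module
  have hact : y - spanProj e y + (Complex.I * k) • V (spanProj e y + S y) =
      z₂ • (spanProj e y + S y) + (α + γ * (z₁ - z₂)) • φ₁ := by
    have e1 : y - spanProj e y = x₂ + γ • (x₁ - spanProj e x₁) := by
      rw [hy, map_add, hP, map_smul, smul_sub]; abel
    rw [hφy, e1, map_add, map_smul]
    have e2 : x₂ + γ • (x₁ - spanProj e x₁) + (Complex.I * k) • (V (S x₂) + γ • V φ₁) =
        (x₂ + (Complex.I * k) • V (S x₂)) +
          γ • (x₁ - spanProj e x₁ + (Complex.I * k) • V φ₁) := by module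
    rw [e2, hact₁, hact₂]
    module
  have hq : 0 ≤ ‖spanProj e y‖ ^ 2 - ‖S y‖ ^ 2 := by
    have h1 := h.lyapunov k y
    rw [hact, ← sub_sub, ← sub_smul, inner_sub_right, inner_smul_right, inner_smul_right, horth',
      mul_zero, sub_zero, hself, Complex.re_mul_ofReal] at h1
    have h2 : 0 ≤ (r - z₂.re) * (‖spanProj e y‖ ^ 2 - ‖S y‖ ^ 2) := by
      refine le_trans ?_ (le_of_le_of_eq h1 (by rw [Complex.sub_re, Complex.ofReal_re]))
      have : 0 < r - ‖k‖ := by linarith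
      positivity
    exact nonneg_of_mul_nonneg_right h2 (hre z₂ hz₂)
  -- the form at `x₂ = y - γ x₁`
  have hPx : spanProj e y = γ • spanProj e x₁ := by rw [hy, map_add, hP, map_smul, zero_add]
  have hSx : S y = S x₂ + γ • S x₁ := by rw [hy, map_add, map_smul]
  have hfinal : -‖S x₂‖ ^ 2 = (‖spanProj e y‖ ^ 2 - ‖S y‖ ^ 2) + ‖γ‖ ^ 2 * p := by
    have h0 := hself x₂
    rw [hP, norm_zero, zero_sub, zero_add, zero_pow two_ne_zero] at h0
    have hx2S : S x₂ = (spanProj e y + S y) - γ • φ₁ := by rw [hφy]; abel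
    have hx2J : -S x₂ = (spanProj e y - S y) - γ • ψ₁ := by
      rw [hPx, hSx, hψ₁, smul_sub]; abel
    have h1 : ((0 - ‖S x₂‖ ^ 2 : ℝ) : ℂ) =
        ((‖spanProj e y‖ ^ 2 - ‖S y‖ ^ 2 : ℝ) : ℂ) + ((‖γ‖ ^ 2 * p : ℝ) : ℂ) := by
      rw [← h0]
      conv_lhs => rw [hx2J, hx2S]
      rw [inner_sub_left, inner_sub_right, inner_sub_right, inner_smul_right, horth', hself,
        inner_smul_left, horth, inner_smul_left, inner_smul_right, hψ₁, hφ₁, hself, ← hp,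
        ← mul_assoc, Complex.conj_mul']
      push_cast; ring
    have : (0 - ‖S x₂‖ ^ 2 : ℝ) = (‖spanProj e y‖ ^ 2 - ‖S y‖ ^ 2) + ‖γ‖ ^ 2 * p := by
      exact_mod_cast h1
    linarith
  have : ‖S x₂‖ ^ 2 ≤ 0 := by nlinarith [sq_nonneg ‖γ‖]
  exact norm_eq_zero.1 (by nlinarith [norm_nonneg (S x₂)])

/-- Eigenvalues below `1 / (2 τ)` do not exceed the size of the perturbation. -/
theorem norm_le_of_modeOp (h : IsModeProblem U V S e spin τ) {k z : ℂ} {x : H}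
    (hz : ‖z‖ < 1 / (2 * τ)) (hx : modeOp V S e k z x = 0) (h0 : x ≠ 0) : ‖z‖ ≤ ‖k‖ := by
  set φ := spanProj e x + S x with hφ
  have hτ := h.tau_pos
  have hφ0 : φ ≠ 0 := fun hc => h0 (h.eq_zero_of_modeOp hx hc)
  set c := x - spanProj e x with hc
  have hact : (-z) • spanProj e x + (c - z • S x) = -((Complex.I * k) • V φ) := by
    rw [modeOp_apply, ← hc, ← hφ] at hx
    have : (-z) • spanProj e x + (c - z • S x) = c - z • φ := by rw [hφ]; module
    rw [this]
    rw [← sub_eq_zero, ← hx]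
    module
  have h1 : ‖(-z) • spanProj e x + (c - z • S x)‖ ^ 2 =
      ‖z‖ ^ 2 * ‖spanProj e x‖ ^ 2 + ‖c - z • S x‖ ^ 2 := by
    have : ⟪(-z) • spanProj e x, c - z • S x⟫_ℂ = 0 := by
      rw [inner_smul_left, inner_spanProj_eq_zero x fun i => ?_, mul_zero]
      rw [inner_sub_right, inner_smul_right, h.inner_S, h.inner_e_sub, mul_zero, sub_zero]
    have h2 := norm_add_sq_eq_norm_sq_add_norm_sq_of_inner_eq_zero _ _ this
    rw [sq, h2, norm_smul, norm_neg]; ring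
  have h2 : ‖z‖ * ‖S x‖ ≤ ‖c - z • S x‖ := by
    have e1 : S x = S c := by rw [hc, map_sub, h.S_spanProj, sub_zero]
    have e2 : ‖S x‖ ≤ τ * ‖c‖ := by rw [e1]; exact h.norm_S_le c
    have e3 : ‖c‖ - ‖z‖ * ‖S x‖ ≤ ‖c - z • S x‖ := by
      have := norm_sub_norm_le c (z • S x)
      rwa [norm_smul] at this
    have e4 : 2 * ‖z‖ * τ < 1 := by
      rw [lt_div_iff₀ (by positivity)] at hz; linarith
    have e5 : 2 * ‖z‖ * ‖S x‖ ≤ ‖c‖ := by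
      have := mul_le_mul_of_nonneg_left e2 (by positivity : 0 ≤ 2 * ‖z‖)
      nlinarith [norm_nonneg c]
    linarith
  have h3 : ‖(Complex.I * k) • V φ‖ ≤ ‖k‖ * ‖φ‖ := by
    rw [norm_smul, norm_mul, Complex.norm_I, one_mul]
    exact mul_le_mul_of_nonneg_left (h.norm_V _) (norm_nonneg _)
  have h4 : ‖z‖ ^ 2 * ‖φ‖ ^ 2 ≤ ‖k‖ ^ 2 * ‖φ‖ ^ 2 := by
    rw [hact, norm_neg] at h1
    have e1 := pow_le_pow_left₀ (norm_nonneg _) h3 2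
    have e2 := pow_le_pow_left₀ (by positivity) h2 2
    rw [mul_pow] at e1 e2
    rw [hφ, h.norm_sq_mode, ← hφ] at *
    nlinarith
  have h5 : 0 < ‖φ‖ ^ 2 := by have := norm_pos_iff.2 hφ0; positivity
  exact (pow_le_pow_iff_left₀ (norm_nonneg _) (norm_nonneg _) two_ne_zero).1
    (le_of_mul_le_mul_right h4 h5)

end IsModeProblem
end Pencil

section Branches

open scoped InnerProductSpace ContDiff

variable {H : Type*} [NormedAddCommGroup H] [InnerProductSpace ℂ H] [CompleteSpace H]

/-! ### Branches of a nonlinear eigenvalue problem -/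

theorem contDiffAt_inverse_apply {N : ℂ × ℂ → H →L[ℂ] H} (hN : ContDiff ℂ ω N) {p₀ : ℂ × ℂ}
    (hu : IsUnit (N p₀)) (e : H) :
    ContDiffAt ℂ ω (fun p => Ring.inverse (N p) e) p₀ := by
  obtain ⟨u, hu⟩ := hu
  have h1 : ContDiffAt ℂ ω (Ring.inverse : (H →L[ℂ] H) → (H →L[ℂ] H)) (N p₀) := by
    rw [← hu]; exact contDiffAt_ringInverse ℂ u
  exact (h1.comp p₀ hN.contDiffAt).clm_apply contDiffAt_const

/-- A root of the scalar equation `⟨e, T(p) N(p)⁻¹ e⟩ = 0` that is nondegenerate in the second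
variable continues to an analytic branch of roots. The vector `u = N⁻¹ (∂N) x₀` is minus the
derivative of `N⁻¹ e` in the second variable. -/
theorem exists_analytic_branch {T N : ℂ × ℂ → H →L[ℂ] H} (hT : ContDiff ℂ ω T)
    (hN : ContDiff ℂ ω N) {k₀ z₀ : ℂ} (hu : IsUnit (N (k₀, z₀))) {e x₀ u : H}
    (hx₀ : N (k₀, z₀) x₀ = e) (h0 : ⟪e, T (k₀, z₀) x₀⟫_ℂ = 0) {T' N' : H →L[ℂ] H}
    (hT' : HasDerivAt (fun z => T (k₀, z)) T' z₀) (hN' : HasDerivAt (fun z => N (k₀, z)) N' z₀)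
    (hNu : N (k₀, z₀) u = N' x₀) (hnd : ⟪e, T' x₀ - T (k₀, z₀) u⟫_ℂ ≠ 0) :
    ∃ η : ℂ → ℂ, ∃ x : ℂ → H, AnalyticAt ℂ η k₀ ∧ η k₀ = z₀ ∧ ContinuousAt x k₀ ∧ x k₀ = x₀ ∧
      ∀ᶠ k in 𝓝 k₀, IsUnit (N (k, η k)) ∧ N (k, η k) (x k) = e ∧
        ⟪e, T (k, η k) (x k)⟫_ℂ = 0 := by
  set X : ℂ × ℂ → H := fun p => Ring.inverse (N p) e with hX
  have hXc : ContDiffAt ℂ ω X (k₀, z₀) := contDiffAt_inverse_apply hN hu e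
  have hNX : ∀ p, IsUnit (N p) → N p (X p) = e := fun p hp => by
    rw [hX, ← mul_apply_eq_comp, Ring.mul_inverse_cancel _ hp, one_apply_eq_self]
  have hinj : Function.Injective (N (k₀, z₀)) :=
    (ContinuousLinearMap.isUnit_iff_bijective.1 hu).1
  have hXx₀ : X (k₀, z₀) = x₀ := hinj (by rw [hNX _ hu, hx₀])
  have hunit : ∀ᶠ p in 𝓝 (k₀, z₀), IsUnit (N p) :=
    hN.continuous.continuousAt.eventually (Units.isOpen.mem_nhds hu)
  set g : ℂ × ℂ → ℂ := fun p => ⟪e, T p (X p)⟫_ℂ with hg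
  have hgc : ContDiffAt ℂ ω g (k₀, z₀) :=
    (innerSL ℂ e).contDiff.contDiffAt.comp _ (hT.contDiffAt.clm_apply hXc)
  have hpath : HasDerivAt (fun z : ℂ => (k₀, z)) ((0 : ℂ), (1 : ℂ)) z₀ :=
    (hasDerivAt_const z₀ k₀).prodMk (hasDerivAt_id z₀)
  have hw : (ω : WithTop ℕ∞) ≠ 0 := by simp
  -- the derivative of `X` along the second variable
  have hXd : HasDerivAt (fun z => X (k₀, z)) (-u) z₀ := by
    have h1 : HasDerivAt (fun z => X (k₀, z)) (fderiv ℂ X (k₀, z₀) (0, 1)) z₀ :=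
      (hXc.differentiableAt hw).hasFDerivAt.comp_hasDerivAt z₀ hpath
    have h2 := hN'.clm_apply h1
    have h3 : (fun z => N (k₀, z) (X (k₀, z))) =ᶠ[𝓝 z₀] fun _ => e := by
      have : ContinuousAt (fun z : ℂ => (k₀, z)) z₀ := by fun_prop
      filter_upwards [this.eventually hunit] with z hz using hNX _ hz
    have h4 := h2.unique ((hasDerivAt_const z₀ e).congr_of_eventuallyEq h3)
    have h5 : fderiv ℂ X (k₀, z₀) (0, 1) = -u := hinj <| by
      rw [map_neg, hNu]
      rw [hXx₀] at h4
      exact eq_neg_of_add_eq_zero_right h4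
    rwa [h5] at h1
  have hgd : fderiv ℂ g (k₀, z₀) (0, 1) = ⟪e, T' x₀ - T (k₀, z₀) u⟫_ℂ := by
    have h1 : HasDerivAt (fun z => g (k₀, z)) (fderiv ℂ g (k₀, z₀) (0, 1)) z₀ :=
      (hgc.differentiableAt hw).hasFDerivAt.comp_hasDerivAt z₀ hpath
    have h2 : HasDerivAt (fun z => g (k₀, z))
        (innerSL ℂ e (T' (X (k₀, z₀)) + T (k₀, z₀) (-u))) z₀ :=
      (innerSL ℂ e).hasFDerivAt.comp_hasDerivAt z₀ (hT'.clm_apply hXd)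
    rw [h1.unique h2, hXx₀, map_neg, ← sub_eq_add_neg]
    rfl
  obtain ⟨η, hη, hη0, hηg⟩ := exists_analyticAt_implicit hgc
    (hgc.differentiableAt hw).hasFDerivAt (by rw [hg]; simpa [hXx₀] using h0) (by rwa [hgd])
  have hcurve : ContinuousAt (fun k => (k, η k)) k₀ := continuousAt_id.prodMk hη.continuousAt
  refine ⟨η, fun k => X (k, η k), hη, hη0, ?_, by simp [hη0, hXx₀], ?_⟩
  · refine ContinuousAt.comp (f := fun k => (k, η k)) (g := X) ?_ hcurve
    simpa [hη0] using hXc.continuousAt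
  · have := hcurve.eventually (by simpa [hη0] using hunit)
    filter_upwards [hηg, this] with k hk hk'
    exact ⟨hk', hNX _ hk', hk⟩

variable {ι : Type*} [Fintype ι]

theorem contDiff_modeOp (V S : H →L[ℂ] H) (e : ι → H) :
    ContDiff ℂ ω (fun p : ℂ × ℂ => modeOp V S e p.1 p.2) := by
  unfold modeOp
  fun_prop

/-- The pencil with its block on the kernel replaced by the identity. -/
def schurOp (V S : H →L[ℂ] H) (e : ι → H) (p : ℂ × ℂ) : H →L[ℂ] H :=
  spanProj e + (1 - spanProj e) * modeOp V S e p.1 p.2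

omit [CompleteSpace H] in
theorem schurOp_apply (V S : H →L[ℂ] H) (e : ι → H) (p : ℂ × ℂ) (x : H) :
    schurOp V S e p x = spanProj e x +
      (modeOp V S e p.1 p.2 x - spanProj e (modeOp V S e p.1 p.2 x)) := by
  simp [schurOp]

theorem contDiff_schurOp (V S : H →L[ℂ] H) (e : ι → H) : ContDiff ℂ ω (schurOp V S e) :=
  contDiff_const.add (contDiff_const.mul (contDiff_modeOp V S e))

theorem injective_of_isUnit {A : H →L[ℂ] H} (hA : IsUnit A) : Function.Injective A :=
  (ContinuousLinearMap.isUnit_iff_bijective.1 hA).1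

theorem hasDerivAt_modeOp (V S : H →L[ℂ] H) (e : ι → H) (k z : ℂ) :
    HasDerivAt (fun z => modeOp V S e k z) (-(spanProj e + S)) z := by
  unfold modeOp
  have h1 : HasDerivAt (fun z : ℂ => z • (1 : H →L[ℂ] H)) ((1 : ℂ) • (1 : H →L[ℂ] H)) z :=
    (hasDerivAt_id z).smul_const 1
  have h2 := ((h1.const_sub ((Complex.I * k) • V)).mul_const (spanProj e + S)).const_add
    (1 - spanProj e)
  simpa using h2

namespace IsModeProblem

variable {U : ℝ → H →ₗᵢ[ℂ] H} {V S : H →L[ℂ] H} {e : ι → H} {spin : ι → ℤ} {τ : ℝ}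

/-! ### The isolated eigenvalue of a spin sector -/

omit [CompleteSpace H] in
theorem comm_schurOp (h : IsModeProblem U V S e spin τ) (p : ℂ × ℂ) (θ : ℝ) (x : H) :
    U θ (schurOp V S e p x) = schurOp V S e p (U θ x) := by
  rw [schurOp_apply, schurOp_apply, map_add, map_sub, h.comm_spanProj, h.comm_spanProj,
    h.comm_modeOp]

omit [CompleteSpace H] in
theorem spanProj_of_isSpin (h : IsModeProblem U V S e spin τ) {j : ι}
    (hj : ∀ i, spin i = spin j → i = j) {x : H} (hx : IsSpin U (spin j) x) :
    spanProj e x = ⟪e j, x⟫_ℂ • e j := by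
  simpa [spanProj] using h.diagOp_of_isSpin (μ := 1) (j := j) (fun i _ => hj i) hx

/-- The pencil is invertible off the kernel where the perturbation is small compared to the
gap. -/
theorem isUnit_schurOp (h : IsModeProblem U V S e spin τ) {k z : ℂ}
    (hk : ‖k‖ < 1 / (2 * τ)) (hz : ‖z‖ < 1 / (2 * τ)) : IsUnit (schurOp V S e (k, z)) := by
  change IsUnit (spanProj e + (1 - spanProj e) * modeOp V S e k z)
  have hτ := h.tau_pos
  set P := spanProj e with hP
  have hPP : P * P = P := h.spanProj_mul_self
  have hPS : P * S = 0 := h.spanProj_mul_S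
  have hSP : S * P = 0 := h.S_mul_diagOp 1
  set W : H →L[ℂ] H := (1 - P) * ((Complex.I * k) • V - z • 1) * S with hW
  set Y : H →L[ℂ] H := (1 - P) * ((Complex.I * k) • V) * P with hY
  have hPQ : P * (1 - P) = 0 := by rw [mul_sub, hPP, mul_one, sub_self]
  have hQP : (1 - P) * P = 0 := by rw [sub_mul, hPP, one_mul, sub_self]
  have hQQ : (1 - P) * (1 - P) = 1 - P := by rw [mul_sub, hQP, mul_one, sub_zero]
  have hYY : Y * Y = 0 := by
    rw [hY, mul_assoc, ← mul_assoc P, ← mul_assoc P, hPQ, zero_mul, zero_mul, mul_zero]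
  have hYW : Y * W = 0 := by
    rw [hY, hW, mul_assoc, ← mul_assoc P, ← mul_assoc P, hPQ, zero_mul, zero_mul, mul_zero]
  have hfac : P + (1 - P) * modeOp V S e k z = (1 + Y) * (1 - -W) := by
    have h1 : (1 + Y) * (1 - -W) = 1 + Y + W := by
      rw [sub_neg_eq_add, mul_add, mul_one, add_mul, one_mul, hYW, add_zero]
    have hzQ : (1 - P) * (z • (1 : H →L[ℂ] H)) * P = 0 := by
      rw [mul_smul_comm, mul_one, smul_mul_assoc, hQP, smul_zero]
    have h2 : (1 - P) * modeOp V S e k z = (1 - P) + Y + W := by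
      rw [modeOp, ← hP, mul_add, hQQ, ← mul_assoc, mul_add, ← hW, mul_sub, sub_mul, hzQ, ← hY,
        sub_zero]
      abel
    rw [h1, h2]
    abel
  rw [hfac]
  refine IsUnit.mul ?_ ?_
  · exact IsNilpotent.isUnit_one_add ⟨2, by rw [sq, hYY]⟩
  · refine isUnit_one_sub_of_norm_lt_one ?_
    rw [norm_neg]
    have hle : ‖W‖ ≤ (‖k‖ + ‖z‖) * τ := by
      refine ContinuousLinearMap.opNorm_le_bound _ (by positivity) fun x => ?_
      have e1 : W x = ((Complex.I * k) • V (S x) - z • S x) -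
          P ((Complex.I * k) • V (S x) - z • S x) := by
        simp [hW]
      have e2 : ‖(Complex.I * k) • V (S x) - z • S x‖ ≤ (‖k‖ + ‖z‖) * ‖S x‖ := by
        refine (norm_sub_le _ _).trans ?_
        rw [norm_smul, norm_smul, norm_mul, Complex.norm_I, one_mul, add_mul]
        gcongr
        exact h.norm_V _
      rw [e1]
      refine (h.norm_sub_spanProj_le _).trans (e2.trans ?_)
      rw [mul_assoc]
      gcongr
      exact h.norm_S_le x
    refine hle.trans_lt ?_
    rw [lt_div_iff₀ (by positivity)] at hk hz
    nlinarith

omit [CompleteSpace H] in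
/-- In a spin sector that meets the kernel in the line through `e j`, a solution of the equation
projected off the kernel solves the full equation as soon as its `e j` component vanishes. -/
theorem modeOp_eq_of_isSpin (h : IsModeProblem U V S e spin τ) {j : ι}
    (hj : ∀ i, spin i = spin j → i = j) {k z : ℂ} {x y : H} (hx : IsSpin U (spin j) x)
    (hN : schurOp V S e (k, z) x = y) :
    spanProj e x = spanProj e y ∧
      modeOp V S e k z x = (y - spanProj e y) + ⟪e j, modeOp V S e k z x⟫_ℂ • e j := by
  have h1 : spanProj e (modeOp V S e k z x) = ⟪e j, modeOp V S e k z x⟫_ℂ • e j :=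
    h.spanProj_of_isSpin hj (hx.map (A := modeOp V S e k z) (h.comm_modeOp k z))
  rw [schurOp_apply] at hN
  have h2 : spanProj e x = spanProj e y := by
    rw [← hN, map_add, map_sub, h.spanProj_spanProj, h.spanProj_spanProj, sub_self, add_zero]
  refine ⟨h2, ?_⟩
  rw [← h1, ← h2, ← hN]
  abel

/-- Local analytic continuation of the eigenvalue. Its simplicity comes from
`IsModeProblem.eq_zero_of_chain`. -/
theorem exists_local_branch (h : IsModeProblem U V S e spin τ) {j : ι}
    (hj : ∀ i, spin i = spin j → i = j) {k₀ z₀ : ℂ} (hk : ‖k₀‖ < 1 / (2 * τ))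
    (hz : ‖z₀‖ < 1 / (2 * τ)) {x₀ : H} (hx : x₀ ≠ 0) (hs : IsSpin U (spin j) x₀)
    (hm : modeOp V S e k₀ z₀ x₀ = 0) :
    ∃ η : ℂ → ℂ, AnalyticAt ℂ η k₀ ∧ η k₀ = z₀ ∧ ∀ᶠ k in 𝓝 k₀,
      ∃ x, x ≠ 0 ∧ IsSpin U (spin j) x ∧ modeOp V S e k (η k) x = 0 := by
  set T : ℂ × ℂ → H →L[ℂ] H := fun p => modeOp V S e p.1 p.2 with hT
  have hTc : ContDiff ℂ ω T := contDiff_modeOp V S e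
  have hu : IsUnit (schurOp V S e (k₀, z₀)) := h.isUnit_schurOp hk hz
  -- the eigenvector has a nonzero component along `e j`
  have hc : ⟪e j, x₀⟫_ℂ ≠ 0 := by
    intro hc
    have h1 : spanProj e x₀ = 0 := by rw [h.spanProj_of_isSpin hj hs, hc, zero_smul]
    have : schurOp V S e (k₀, z₀) x₀ = 0 := by rw [schurOp_apply, hm, h1]; simp
    exact hx (injective_of_isUnit hu (by rw [this, map_zero]))
  set c := ⟪e j, x₀⟫_ℂ with hcdef
  set y₀ := c⁻¹ • x₀ with hy₀
  have hmy : modeOp V S e k₀ z₀ y₀ = 0 := by rw [hy₀, map_smul, hm, smul_zero]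
  have hsy : IsSpin U (spin j) y₀ := hs.smul _
  have hPy : spanProj e y₀ = e j := by
    rw [h.spanProj_of_isSpin hj hsy, hy₀, inner_smul_right, ← hcdef, inv_mul_cancel₀ hc, one_smul]
  have hNy : schurOp V S e (k₀, z₀) y₀ = e j := by rw [schurOp_apply, hmy, hPy]; simp
  have hy₀0 : y₀ ≠ 0 := smul_ne_zero (inv_ne_zero hc) hx
  have hT' : HasDerivAt (fun z => T (k₀, z)) (-(spanProj e + S)) z₀ := hasDerivAt_modeOp V S e k₀ z₀
  have hN' : HasDerivAt (fun z => schurOp V S e (k₀, z)) ((1 - spanProj e) * -(spanProj e + S)) z₀ :=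
    (hT'.const_mul (1 - spanProj e)).const_add _
  have hN'y : ((1 - spanProj e) * -(spanProj e + S)) y₀ = -S y₀ := by
    simp [h.spanProj_spanProj, h.spanProj_S]
  obtain ⟨u, hu'⟩ := (ContinuousLinearMap.isUnit_iff_bijective.1 hu).2 (-S y₀)
  have hsu : IsSpin U (spin j) u := by
    refine IsSpin.of_map (A := schurOp V S e (k₀, z₀)) ?_ (injective_of_isUnit hu)
      (h.comm_schurOp _)
    rw [hu', ← neg_one_smul ℂ]
    exact (hsy.map h.comm_S).smul _
  obtain ⟨hPu, hTu⟩ := h.modeOp_eq_of_isSpin hj hsu hu'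
  have hPSy : spanProj e (-S y₀) = 0 := by rw [map_neg, h.spanProj_S, neg_zero]
  rw [hPSy] at hPu
  rw [hPSy, sub_zero] at hTu
  have hSu : ⟪e j, modeOp V S e k₀ z₀ u⟫_ℂ ≠ -1 := by
    intro hcon
    rw [hcon] at hTu
    have h1 : S u = 0 := h.eq_zero_of_chain (z₁ := z₀) (z₂ := z₀) (α := -1) hk hz hz hmy hy₀0
      (by rw [hTu, hPy]; module) hPu
    have h2 : u = 0 := by
      have h3 := hTu
      rw [modeOp_apply, hPu, h1] at h3
      have h4 := congrArg (fun v => ⟪e j, v⟫_ℂ) h3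
      have h5 : ⟪e j, u⟫_ℂ = 0 := h.spanProj_eq_zero.1 hPu j
      simp [h.inner_S, h5, h.orthonormal.1 j] at h4
    rw [h2, map_zero, inner_zero_right] at hcon
    norm_num at hcon
  obtain ⟨η, x, hη, hη0, -, -, hev⟩ := exists_analytic_branch hTc (contDiff_schurOp V S e) hu hNy
    (by simp only [hT, hmy, inner_zero_right]) hT' hN' (u := u) (by rw [hu', hN'y]) (by
      have e1 : (-(spanProj e + S)) y₀ = -(e j + S y₀) := by simp [hPy]
      rw [e1, inner_sub_right, inner_neg_right, inner_add_right, h.inner_S,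
        inner_self_eq_norm_sq_to_K, h.orthonormal.1 j]
      intro hcon
      apply hSu
      have : (T (k₀, z₀)) u = modeOp V S e k₀ z₀ u := rfl
      rw [this] at hcon
      simp only [RCLike.ofReal_one, one_pow, add_zero] at hcon
      linear_combination -hcon)
  refine ⟨η, hη, hη0, ?_⟩
  filter_upwards [hev] with k ⟨hk1, hk2, hk3⟩
  have hsx : IsSpin U (spin j) (x k) := by
    refine IsSpin.of_map (A := schurOp V S e (k, η k)) ?_ (injective_of_isUnit hk1)
      (h.comm_schurOp _)
    rw [hk2]
    exact h.spin_e j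
  refine ⟨x k, ?_, hsx, ?_⟩
  · intro h0
    rw [h0, map_zero] at hk2
    exact h.orthonormal.ne_zero j hk2.symm
  · obtain ⟨-, h2⟩ := h.modeOp_eq_of_isSpin hj hsx hk2
    have hk3' : ⟪e j, modeOp V S e k (η k) (x k)⟫_ℂ = 0 := hk3
    rw [h2, hk3', h.spanProj_e]
    simp

omit [CompleteSpace H] in
/-- Below `1 / (2 τ)` there is at most one eigenvalue in the spin sector. -/
theorem eigenvalue_unique (h : IsModeProblem U V S e spin τ) {j : ι}
    (hj : ∀ i, spin i = spin j → i = j) {k z₁ z₂ : ℂ} (hk : ‖k‖ < 1 / (2 * τ))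
    (hz₁ : ‖z₁‖ < 1 / (2 * τ)) (hz₂ : ‖z₂‖ < 1 / (2 * τ)) {x₁ x₂ : H} (hx₁ : x₁ ≠ 0)
    (hx₂ : x₂ ≠ 0) (hs₁ : IsSpin U (spin j) x₁) (hs₂ : IsSpin U (spin j) x₂)
    (hm₁ : modeOp V S e k z₁ x₁ = 0) (hm₂ : modeOp V S e k z₂ x₂ = 0) : z₁ = z₂ := by
  -- the eigenvector has a nonzero component along `e j`
  have hc : ⟪e j, x₁⟫_ℂ ≠ 0 := by
    intro hc
    have hP : spanProj e x₁ = 0 := by rw [h.spanProj_of_isSpin hj hs₁, hc, zero_smul]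
    have hS := h.eq_zero_of_chain (α := 0) hk hz₁ hz₁ hm₁ hx₁ (by rw [hm₁, zero_smul]) hP
    exact hx₁ (h.eq_zero_of_modeOp hm₁ (by rw [hP, hS, add_zero]))
  set γ := ⟪e j, x₂⟫_ℂ / ⟪e j, x₁⟫_ℂ with hγ
  have hP : spanProj e (x₂ - γ • x₁) = 0 := by
    rw [h.spanProj_of_isSpin hj (hs₂.sub (hs₁.smul γ)), inner_sub_right, inner_smul_right, hγ,
      div_mul_cancel₀ _ hc, sub_self, zero_smul]
  have hm : modeOp V S e k z₂ (x₂ - γ • x₁) = (γ * (z₂ - z₁)) • (spanProj e x₁ + S x₁) := by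
    have h1 : modeOp V S e k z₂ x₁ = modeOp V S e k z₁ x₁ +
        (z₁ - z₂) • (spanProj e x₁ + S x₁) := by
      rw [modeOp_apply, modeOp_apply]; module
    rw [map_sub, hm₂, map_smul, h1, hm₁]
    module
  have hS := h.eq_zero_of_chain hk hz₁ hz₂ hm₁ hx₁ hm hP
  have hΦ : spanProj e x₂ + S x₂ = γ • (spanProj e x₁ + S x₁) := by
    have e1 : spanProj e x₂ = γ • spanProj e x₁ := by
      rw [map_sub, map_smul, sub_eq_zero] at hP; exact hP
    have e2 : S x₂ = γ • S x₁ := by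
      rw [map_sub, map_smul, sub_eq_zero] at hS; exact hS
    rw [e1, e2, smul_add]
  set φ₁ := spanProj e x₁ + S x₁ with hφ₁
  have hγ0 : γ ≠ 0 := by
    intro h0
    rw [h0, zero_smul] at hΦ
    exact hx₂ (h.eq_zero_of_modeOp hm₂ hΦ)
  have hφ₁0 : φ₁ ≠ 0 := fun h0 => hx₁ (h.eq_zero_of_modeOp hm₁ h0)
  have hx : x₂ - γ • x₁ - spanProj e (x₂ - γ • x₁) + (0 : H) =
      modeOp V S e k z₂ (x₂ - γ • x₁) := by
    rw [modeOp_apply, hP, hS]; simp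
  -- pair with `e j` to read off the eigenvalue
  have hpair : ⟪e j, modeOp V S e k z₂ (x₂ - γ • x₁)⟫_ℂ = 0 := by
    rw [← hx, add_zero, h.inner_e_sub]
  rw [hm, inner_smul_right, hφ₁, inner_add_right, h.inner_S, h.inner_spanProj, add_zero] at hpair
  rcases mul_eq_zero.1 hpair with h1 | h1
  · exact (sub_eq_zero.1 ((mul_eq_zero.1 h1).resolve_left hγ0)).symm
  · exact absurd h1 hc

theorem exists_eigenvalue (h : IsModeProblem U V S e spin τ) {j : ι}
    (hj : ∀ i, spin i = spin j → i = j) {k : ℂ} (hk : ‖k‖ < 1 / (2 * τ)) :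
    ∃ z : ℂ, ‖z‖ < 1 / (2 * τ) ∧
      ∃ x, x ≠ 0 ∧ IsSpin U (spin j) x ∧ modeOp V S e k z x = 0 := by
  have hτ := h.tau_pos
  have hr : 0 < 1 / (2 * τ) := by positivity
  set r := 1 / (2 * τ) with hrdef
  set Z : Set ℂ := {k | k ∈ Metric.ball (0 : ℂ) r ∧ ∃ z : ℂ, ‖z‖ < r ∧
    ∃ x, x ≠ 0 ∧ IsSpin U (spin j) x ∧ modeOp V S e k z x = 0} with hZ
  suffices hsub : Metric.ball (0 : ℂ) r ⊆ Z from (hsub (by simpa using hk)).2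
  refine (convex_ball (0 : ℂ) r).isPreconnected.subset_of_closure_inter_subset ?_
    ⟨0, Metric.mem_ball_self hr, Metric.mem_ball_self hr, 0, by simpa using hr, e j,
      h.orthonormal.ne_zero j, h.spin_e j, ?_⟩ ?_
  · rw [isOpen_iff_mem_nhds]
    rintro k₀ ⟨hk₀, z₀, hz₀, x₀, hx₀, hs, hm⟩
    obtain ⟨η, hη, hη0, hev⟩ := h.exists_local_branch hj (mem_ball_zero_iff.1 hk₀) hz₀ hx₀ hs hm
    have h1 : ∀ᶠ k in 𝓝 k₀, ‖η k‖ < r :=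
      (hη.continuousAt.norm).eventually_lt_const (by simpa only [hη0])
    filter_upwards [hev, h1, Metric.isOpen_ball.mem_nhds hk₀] with k h2 h3 h4
    exact ⟨h4, η k, h3, h2⟩
  · rw [modeOp_apply, h.spanProj_e, h.S_e]; simp
  -- a limit of eigenvalues is an eigenvalue, and it stays below `|k|`
  · rintro k ⟨hkcl, hkb⟩
    refine ⟨hkb, ?_⟩
    obtain ⟨s, hs, hsk⟩ := mem_closure_iff_seq_limit.1 hkcl
    choose hsb z hz x hx hsx hmx using hs
    have hzle : ∀ n, ‖z n‖ ≤ ‖s n‖ := fun n => h.norm_le_of_modeOp (hz n) (hmx n) (hx n)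
    have hzmem : ∀ n, z n ∈ Metric.closedBall (0 : ℂ) r := fun n => by
      simpa using (hz n).le
    obtain ⟨z', -, ψ, hψ, hlim⟩ := (isCompact_closedBall (0 : ℂ) r).tendsto_subseq hzmem
    have hslim : Tendsto (fun n => s (ψ n)) atTop (𝓝 k) := hsk.comp hψ.tendsto_atTop
    have hz'k : ‖z'‖ ≤ ‖k‖ := le_of_tendsto_of_tendsto' hlim.norm hslim.norm fun n => hzle _
    have hkr : ‖k‖ < r := by simpa using hkb
    have hz'r : ‖z'‖ < r := hz'k.trans_lt hkr
    obtain ⟨X, hX⟩ : ∃ X : ℂ × ℂ → H, X = fun p => Ring.inverse (schurOp V S e p) (e j) :=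
      ⟨_, rfl⟩
    have hNX : ∀ p, IsUnit (schurOp V S e p) → schurOp V S e p (X p) = e j := fun p hp => by
      rw [hX, ← mul_apply_eq_comp, Ring.mul_inverse_cancel _ hp, one_apply_eq_self]
    have hu : IsUnit (schurOp V S e (k, z')) := h.isUnit_schurOp hkr hz'r
    have hXs : ∀ p, IsUnit (schurOp V S e p) → IsSpin U (spin j) (X p) := fun p hp => by
      refine IsSpin.of_map (A := schurOp V S e p) ?_ (injective_of_isUnit hp) (h.comm_schurOp _)
      rw [hNX p hp]; exact h.spin_e j
    have hXc : ContinuousAt X (k, z') := by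
      rw [hX]
      exact (contDiffAt_inverse_apply (contDiff_schurOp V S e) hu (e j)).continuousAt
    -- the approximating eigenvectors are multiples of `X`
    have hzero : ∀ n, modeOp V S e (s n) (z n) (X (s n, z n)) = 0 := fun n => by
      have hun : IsUnit (schurOp V S e (s n, z n)) :=
        h.isUnit_schurOp (mem_ball_zero_iff.1 (hsb n)) (hz n)
      have h1 : schurOp V S e (s n, z n) (x n) = ⟪e j, x n⟫_ℂ • e j := by
        rw [schurOp_apply, hmx n, h.spanProj_of_isSpin hj (hsx n)]; simp
      have h2 : x n = ⟪e j, x n⟫_ℂ • X (s n, z n) := injective_of_isUnit hun (by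
        rw [h1, map_smul, hNX _ hun])
      have hc : ⟪e j, x n⟫_ℂ ≠ 0 := fun hc => hx n (by rw [h2, hc, zero_smul])
      have h3 := hmx n
      rw [h2, map_smul] at h3
      exact (smul_eq_zero.1 h3).resolve_left hc
    have hpair : Tendsto (fun n => (s (ψ n), z (ψ n))) atTop (𝓝 (k, z')) :=
      hslim.prodMk_nhds hlim
    have hop : ContinuousAt (fun p : ℂ × ℂ => modeOp V S e p.1 p.2 (X p)) (k, z') :=
      ContinuousAt.clm_apply (contDiff_modeOp V S e).continuous.continuousAt hXc
    have hlimit := Tendsto.comp hop hpair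
    refine ⟨z', hz'r, X (k, z'), ?_, hXs _ hu, ?_⟩
    · intro h0
      have := hNX _ hu
      rw [h0, map_zero] at this
      exact h.orthonormal.ne_zero j this.symm
    · exact tendsto_nhds_unique hlimit (tendsto_const_nhds.congr fun n => (hzero (ψ n)).symm)

/-- The eigenvalue of a spin sector that meets the kernel in a line is analytic on the disc of
radius `1 / (2 τ)`. -/
theorem exists_analytic_eigenvalue (h : IsModeProblem U V S e spin τ) {j : ι}
    (hj : ∀ i, spin i = spin j → i = j) :
    ∃ ζ : ℂ → ℂ, AnalyticOnNhd ℂ ζ (Metric.ball 0 (1 / (2 * τ))) ∧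
      (∀ k ∈ Metric.ball (0 : ℂ) (1 / (2 * τ)),
        ∃ x, x ≠ 0 ∧ IsSpin U (spin j) x ∧ modeOp V S e k (ζ k) x = 0) ∧
      ∀ k ∈ Metric.ball (0 : ℂ) (1 / (2 * τ)), ∀ z : ℂ, ‖z‖ < 1 / (2 * τ) →
        ∀ x, x ≠ 0 → IsSpin U (spin j) x → modeOp V S e k z x = 0 → z = ζ k := by
  have hex : ∀ k : ℂ, ∃ z : ℂ, ‖k‖ < 1 / (2 * τ) → ‖z‖ < 1 / (2 * τ) ∧
      ∃ x, x ≠ 0 ∧ IsSpin U (spin j) x ∧ modeOp V S e k z x = 0 := fun k => by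
    by_cases hk : ‖k‖ < 1 / (2 * τ)
    · obtain ⟨z, hz⟩ := h.exists_eigenvalue hj hk
      exact ⟨z, fun _ => hz⟩
    · exact ⟨0, fun hk' => absurd hk' hk⟩
  choose ζ hζ using hex
  have huniq : ∀ k ∈ Metric.ball (0 : ℂ) (1 / (2 * τ)), ∀ z : ℂ, ‖z‖ < 1 / (2 * τ) →
        ∀ x, x ≠ 0 → IsSpin U (spin j) x → modeOp V S e k z x = 0 → z = ζ k := by
    intro k hk z hz x hx hs hm
    have hk' : ‖k‖ < 1 / (2 * τ) := by simpa using hk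
    obtain ⟨hz', x', hx', hs', hm'⟩ := hζ k hk'
    exact h.eigenvalue_unique hj hk' hz hz' hx hx' hs hs' hm hm'
  refine ⟨ζ, fun k₀ hk₀ => ?_, fun k hk => (hζ k (by simpa using hk)).2, huniq⟩
  have hk₀' : ‖k₀‖ < 1 / (2 * τ) := by simpa using hk₀
  obtain ⟨hz', x', hx', hs', hm'⟩ := hζ k₀ hk₀'
  obtain ⟨η, hη, hη0, hev⟩ := h.exists_local_branch hj hk₀' hz' hx' hs' hm'
  have h1 : ∀ᶠ k in 𝓝 k₀, ‖η k‖ < 1 / (2 * τ) :=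
    (hη.continuousAt.norm).eventually_lt_const (by simpa only [hη0])
  refine hη.congr ?_
  filter_upwards [hev, h1, Metric.isOpen_ball.mem_nhds hk₀] with k ⟨x, hx, hs, hm⟩ h3 h4
  exact huniq k h4 _ h3 x hx hs hm

end IsModeProblem
end Branches

section SmallWavenumber

open scoped InnerProductSpace ContDiff

variable {H : Type*} [NormedAddCommGroup H] [InnerProductSpace ℂ H] {ι : Type*} [Fintype ι]

/-! ### Branches through zero -/

/-- The pencil in the unknown `l = ω / k`, with its block on the kernel divided by `i k`. It stays
nondegenerate at `k = 0`. -/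
def slowOp (V S : H →L[ℂ] H) (e : ι → H) (k l : ℂ) : H →L[ℂ] H :=
  (1 - spanProj e) + ((Complex.I * k) • (1 - spanProj e) + spanProj e) * (V - l • 1) *
    (spanProj e + S)

theorem contDiff_slowOp (V S : H →L[ℂ] H) (e : ι → H) :
    ContDiff ℂ ω (fun p : ℂ × ℂ => slowOp V S e p.1 p.2) := by
  unfold slowOp
  fun_prop

theorem hasDerivAt_slowOp (V S : H →L[ℂ] H) (e : ι → H) (k l : ℂ) :
    HasDerivAt (fun l => slowOp V S e k l)
      (-(((Complex.I * k) • (1 - spanProj e) + spanProj e) * (spanProj e + S))) l := by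
  unfold slowOp
  have h1 : HasDerivAt (fun l : ℂ => l • (1 : H →L[ℂ] H)) ((1 : ℂ) • (1 : H →L[ℂ] H)) l :=
    (hasDerivAt_id l).smul_const (1 : H →L[ℂ] H)
  have h2 := (((h1.const_sub V).const_mul
    ((Complex.I * k) • (1 - spanProj e) + spanProj e)).mul_const (spanProj e + S)).const_add
    (1 - spanProj e)
  simpa only [one_smul, mul_neg, neg_mul, mul_one] using h2

namespace IsModeProblem

variable {U : ℝ → H →ₗᵢ[ℂ] H} {V S : H →L[ℂ] H} {e : ι → H} {spin : ι → ℤ} {τ : ℝ}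

theorem modeOp_eq_slowOp (h : IsModeProblem U V S e spin τ) (k l : ℂ) :
    modeOp V S e k (Complex.I * k * l) =
      ((1 - spanProj e) + (Complex.I * k) • spanProj e) * slowOp V S e k l := by
  have hPP := h.spanProj_mul_self
  set P := spanProj e with hP
  have hPQ : P * (1 - P) = 0 := by rw [mul_sub, hPP, mul_one, sub_self]
  have hQP : (1 - P) * P = 0 := by rw [sub_mul, hPP, one_mul, sub_self]
  have hQQ : (1 - P) * (1 - P) = 1 - P := by rw [mul_sub, hQP, mul_one, sub_zero]
  have h1 : ((1 - P) + (Complex.I * k) • P) * ((Complex.I * k) • (1 - P) + P) =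
      (Complex.I * k) • 1 := by
    rw [add_mul, mul_add, mul_add, hQP, mul_smul_comm, hQQ, smul_mul_assoc, smul_mul_assoc,
      mul_smul_comm, hPQ, hPP]
    module
  have h2 : ((1 - P) + (Complex.I * k) • P) * (1 - P) = 1 - P := by
    rw [add_mul, hQQ, smul_mul_assoc, hPQ, smul_zero, add_zero]
  rw [slowOp, ← hP, mul_add, h2, mul_assoc _ (V - l • 1), ← mul_assoc, h1, modeOp, ← hP,
    smul_mul_assoc, one_mul, ← smul_mul_assoc, smul_sub, smul_smul]

open scoped Classical in
/-- At zero wavenumber the bordered slow pencil is block triangular, with invertible diagonal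
blocks. -/
theorem isUnit_slowOp_add (h : IsModeProblem U V S e spin τ) {lam : ι → ℂ}
    (hV : ∀ i, spanProj e (V (e i)) = lam i • e i) (j : ι) :
    IsUnit (slowOp V S e 0 (lam j) + diagOp e fun i => if lam i = lam j then 1 else 0) := by
  have hPP := h.spanProj_mul_self
  have hPS := h.spanProj_mul_S
  have hPVP : spanProj e * V * spanProj e = diagOp e lam := by
    ext x
    simp only [mul_apply_eq_comp]
    rw [spanProj_apply e x, map_sum, map_sum, diagOp_apply]
    refine Finset.sum_congr rfl fun i _ => ?_
    rw [map_smul, map_smul, hV, smul_smul, mul_comm]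
  set μ : ι → ℂ := fun i => (lam i - lam j) + if lam i = lam j then 1 else 0 with hμ
  have hμ0 : ∀ i, μ i ≠ 0 := fun i => by
    simp only [hμ]
    split_ifs with hi
    · rw [hi]; simp
    · rw [add_zero]; exact sub_ne_zero.2 hi
  set P := spanProj e with hP
  set X := P * V * S with hX
  set W := diagOp e μ with hW
  set W' := diagOp e (fun i => (μ i)⁻¹) with hW'
  have hWW' : W * W' = P := by
    rw [hW, hW', h.diagOp_mul, hP, spanProj]
    congr 1; ext i; simp [hμ0 i]
  have hW'W : W' * W = P := by
    rw [hW, hW', h.diagOp_mul, hP, spanProj]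
    congr 1; ext i; simp [hμ0 i]
  have hWP : W * P = W := by rw [hP, spanProj, hW, h.diagOp_mul, mul_one]
  have hPW : P * W = W := by rw [hP, spanProj, hW, h.diagOp_mul, one_mul]
  have hW'P : W' * P = W' := by rw [hP, spanProj, hW', h.diagOp_mul, mul_one]
  have hPW' : P * W' = W' := by rw [hP, spanProj, hW', h.diagOp_mul, one_mul]
  have hSW : S * W = 0 := h.S_mul_diagOp _
  have hSW' : S * W' = 0 := h.S_mul_diagOp _
  have hSP : S * P = 0 := h.S_mul_diagOp _
  have hXW : X * W = 0 := by rw [hX, mul_assoc, hSW, mul_zero]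
  have hXW' : X * W' = 0 := by rw [hX, mul_assoc, hSW', mul_zero]
  have hXP : X * P = 0 := by rw [hX, mul_assoc, hSP, mul_zero]
  have hPX : P * X = X := by rw [hX, ← mul_assoc, ← mul_assoc, hPP]
  have hXX : X * X = 0 := by rw [← hPX, ← mul_assoc (P * X), hPX, hXP, zero_mul]
  have hsum : slowOp V S e 0 (lam j) + diagOp e (fun i => if lam i = lam j then 1 else 0) =
      (1 - P) + X + W := by
    have e1 : W = diagOp e lam - lam j • P +
        diagOp e (fun i => if lam i = lam j then 1 else 0) := by
      ext x
      simp only [hW, hP, add_apply, sub_apply, smul_apply, spanProj_apply,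
        diagOp_apply, Finset.smul_sum, ← Finset.sum_add_distrib, ← Finset.sum_sub_distrib, hμ]
      refine Finset.sum_congr rfl fun i _ => ?_
      module
    have e2 : P * (V - lam j • 1) * (P + S) = diagOp e lam - lam j • P + X := by
      rw [← hPVP, hX, mul_sub, mul_smul_comm, mul_one, sub_mul, mul_add, smul_mul_assoc, mul_add,
        hPP, hPS, add_zero]
      abel
    rw [slowOp, ← hP, mul_zero, zero_smul, zero_add, e2, e1]
    abel
  rw [hsum]
  refine ⟨⟨(1 - P) + X + W, (1 - P) + W' - W' * X, ?_, ?_⟩, rfl⟩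
  · simp only [add_mul, sub_mul, mul_add, mul_sub, one_mul, mul_one, hPP, hXP, hWP, hPW', hXW',
      hWW', ← mul_assoc, hPX]
    abel_nf
    simp
  · simp only [add_mul, sub_mul, mul_add, mul_sub, one_mul, mul_one, hPP, hPX, hPW, hW'P,
      hW'W, mul_assoc, hXP, hXX, hXW, mul_zero]
    abel

theorem comm_slowOp (h : IsModeProblem U V S e spin τ) (k l : ℂ) (θ : ℝ) (x : H) :
    U θ (slowOp V S e k l x) = slowOp V S e k l (U θ x) := by
  simp only [slowOp, add_apply, sub_apply, smul_apply, mul_apply_eq_comp,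
    one_apply_eq_self, map_add, map_sub, map_smul, h.comm_V, h.comm_S, h.comm_spanProj]

variable [CompleteSpace H]

/-- Each common eigenvector of the first-order problem and of the rotations continues to a branch
of modes with `ω = k l(k)`, provided that no other such vector has the same velocity and spin. -/
theorem exists_branch_at_zero (h : IsModeProblem U V S e spin τ) {lam : ι → ℂ}
    (hV : ∀ i, spanProj e (V (e i)) = lam i • e i)
    (hinj : ∀ i j, lam i = lam j → spin i = spin j → i = j) (j : ι) :
    ∃ l : ℂ → ℂ, ∃ x : ℂ → H, AnalyticAt ℂ l 0 ∧ ContinuousAt x 0 ∧ x 0 = e j ∧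
      ∀ᶠ k in 𝓝 (0 : ℂ), IsSpin U (spin j) (x k) ∧
        modeOp V S e k (Complex.I * k * l k) (x k) = 0 := by
  classical
  set χ : ι → ℂ := fun i => if lam i = lam j then 1 else 0 with hχ
  set T : ℂ × ℂ → H →L[ℂ] H := fun p => slowOp V S e p.1 p.2 with hT
  set N : ℂ × ℂ → H →L[ℂ] H := fun p => slowOp V S e p.1 p.2 + diagOp e χ with hN
  have hTc : ContDiff ℂ ω T := contDiff_slowOp V S e
  have hNc : ContDiff ℂ ω N := hTc.add contDiff_const
  have hu : IsUnit (N (0, lam j)) := h.isUnit_slowOp_add hV j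
  have hTe : T (0, lam j) (e j) = 0 := by
    simp [hT, slowOp, h.spanProj_e, h.S_e, hV]
  have hχe : diagOp e χ (e j) = e j := by
    rw [h.diagOp_of_isSpin (j := j) (fun i hi hs => hinj i j ?_ hs) (h.spin_e j)]
    · simp [hχ, h.orthonormal.1 j]
    · by_contra hne
      exact hi (by simp [hχ, hne])
  have hNe : N (0, lam j) (e j) = e j := by
    change T (0, lam j) (e j) + diagOp e χ (e j) = e j
    rw [hTe, hχe, zero_add]
  have hT' : HasDerivAt (fun l => T (0, l)) _ (lam j) := hasDerivAt_slowOp V S e 0 (lam j)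
  have hN' : HasDerivAt (fun l => N (0, l)) _ (lam j) := hT'.add_const (diagOp e χ)
  obtain ⟨l, x, hl, -, hx, hx0, hev⟩ := exists_analytic_branch hTc hNc hu hNe
    (by rw [hTe, inner_zero_right]) hT' hN' (u := -e j)
    (by rw [map_neg, hNe]; simp [h.spanProj_e, h.S_e])
    (by rw [map_neg, hTe]; simp [h.spanProj_e, h.S_e, h.orthonormal.1 j])
  refine ⟨l, x, hl, hx, hx0, ?_⟩
  filter_upwards [hev] with k ⟨hk1, hk2, hk3⟩
  have hspin : IsSpin U (spin j) (x k) := by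
    refine IsSpin.of_map (A := N (k, l k)) ?_ (injective_of_isUnit hk1) fun θ y => ?_
    · rw [hk2]; exact h.spin_e j
    · simp only [hN, add_apply, map_add, h.comm_slowOp, h.comm_diagOp]
  refine ⟨hspin, ?_⟩
  have hχx : diagOp e χ (x k) = ⟪e j, x k⟫_ℂ • e j := by
    rw [h.diagOp_of_isSpin (j := j) (fun i hi hs => hinj i j ?_ hs) hspin]
    · simp [hχ]
    · by_contra hne
      exact hi (by simp [hχ, hne])
  have hTx : T (k, l k) (x k) = (1 - ⟪e j, x k⟫_ℂ) • e j := by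
    have : T (k, l k) (x k) + diagOp e χ (x k) = e j := hk2
    rw [sub_smul, one_smul, ← hχx, ← this]; abel
  have hTx0 : slowOp V S e k (l k) (x k) = 0 := by
    have h1 := hk3
    rw [hTx, inner_smul_right, inner_self_eq_norm_sq_to_K, h.orthonormal.1 j] at h1
    have h2 : (1 - ⟪e j, x k⟫_ℂ) = 0 := by simpa using h1
    have h3 : T (k, l k) (x k) = 0 := by rw [hTx, h2, zero_smul]
    exact h3
  rw [h.modeOp_eq_slowOp, mul_apply_eq_comp, hTx0, map_zero]

omit [CompleteSpace H] [Fintype ι] in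
theorem norm_inner_e_le (h : IsModeProblem U V S e spin τ) (i : ι) (v : H) :
    ‖⟪e i, v⟫_ℂ‖ ≤ ‖v‖ := by
  simpa [h.orthonormal.1 i] using norm_inner_le_norm (𝕜 := ℂ) (e i) v

omit [CompleteSpace H] in
/-- A quantitative form of the independence of a perturbed orthonormal family. -/
theorem sum_norm_le (h : IsModeProblem U V S e spin τ) {x : ι → H} {ε : ℝ}
    (hx : ∀ i, ‖x i - e i‖ ≤ ε) (hε : 2 * (Fintype.card ι : ℝ) * ε ≤ 1) (d : ι → ℂ) :
    ∑ i, ‖d i‖ ≤ 2 * Fintype.card ι * ‖spanProj e (∑ i, d i • x i)‖ := by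
  set n : ℝ := (Fintype.card ι : ℝ) with hn
  set D := ∑ i, ‖d i‖ with hD
  have h1 : ∀ i, ‖d i‖ ≤ ‖spanProj e (∑ i, d i • x i)‖ + ε * D := fun i => by
    have e1 : d i = ⟪e i, spanProj e (∑ i, d i • x i)⟫_ℂ - ⟪e i, ∑ i, d i • (x i - e i)⟫_ℂ := by
      have : ∑ i, d i • (x i - e i) = ∑ i, d i • x i - ∑ i, d i • e i := by
        simp [smul_sub]
      rw [h.inner_spanProj, this, inner_sub_right, h.orthonormal.inner_right_fintype]
      ring
    have e2 : ‖⟪e i, spanProj e (∑ i, d i • x i)⟫_ℂ‖ ≤ ‖spanProj e (∑ i, d i • x i)‖ :=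
      h.norm_inner_e_le i _
    have e3 : ‖⟪e i, ∑ i, d i • (x i - e i)⟫_ℂ‖ ≤ ‖∑ i, d i • (x i - e i)‖ :=
      h.norm_inner_e_le i _
    have e4 : ‖∑ i, d i • (x i - e i)‖ ≤ ε * D := by
      refine (norm_sum_le _ _).trans ?_
      rw [hD, Finset.mul_sum]
      refine Finset.sum_le_sum fun i _ => ?_
      rw [norm_smul, mul_comm]
      exact mul_le_mul_of_nonneg_right (hx i) (norm_nonneg _)
    rw [e1]
    refine (norm_sub_le _ _).trans ?_
    linarith
  have h2 : D ≤ n * (‖spanProj e (∑ i, d i • x i)‖ + ε * D) := by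
    have := Finset.sum_le_sum fun i (_ : i ∈ Finset.univ) => h1 i
    rwa [Finset.sum_const, Finset.card_univ, nsmul_eq_mul, ← hD, ← hn] at this
  have hD0 : 0 ≤ D := Finset.sum_nonneg fun i _ => norm_nonneg _
  nlinarith

omit [CompleteSpace H] in
/-- Perturbed kernel vectors that solve the mode problem exhaust, for small `k`, all solutions of
low frequency. -/
theorem eq_sum_of_modeOp (h : IsModeProblem U V S e spin τ) {k : ℂ} {x : ι → H} {z : ι → ℂ}
    {ε : ℝ} (hx : ∀ i, ‖x i - e i‖ ≤ ε)
    (hε : 4 * (Fintype.card ι : ℝ) * (1 + τ) * ε ≤ 1) (hε0 : 0 ≤ ε)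
    (hm : ∀ i, modeOp V S e k (z i) (x i) = 0) (hk : 4 * τ * ‖k‖ ≤ 1) {w : ℂ}
    (hw : 4 * τ * ‖w‖ ≤ 1) {y : H} (hy : modeOp V S e k w y = 0) :
    ∃ c : ι → ℂ, y = ∑ i, c i • x i ∧ ∀ i, c i * (w - z i) = 0 := by
  have hτ := h.tau_pos
  set n : ℝ := (Fintype.card ι : ℝ) with hn
  have hn0 : 0 ≤ n := by positivity
  have hε' : 2 * n * ε ≤ 1 := by
    have : 0 ≤ n * ε := by positivity
    nlinarith [mul_nonneg this hτ.le]
  have hlow := h.sum_norm_le hx hε'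
  -- match the components of `y` in the kernel
  obtain ⟨c, hc⟩ : ∃ c : ι → ℂ, ∀ i, ⟪e i, ∑ i, c i • x i⟫_ℂ = ⟪e i, y⟫_ℂ := by
    let L : (ι → ℂ) →ₗ[ℂ] (ι → ℂ) :=
      { toFun := fun c i => ⟪e i, ∑ i, c i • x i⟫_ℂ
        map_add' := fun c d => by
          ext i
          simp [add_smul, Finset.sum_add_distrib]
        map_smul' := fun a c => by
          ext i
          simp only [Pi.smul_apply, smul_eq_mul, mul_smul, ← Finset.smul_sum, inner_smul_right,
            RingHom.id_apply] }
    have hL : Function.Injective L := by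
      rw [← LinearMap.ker_eq_bot, LinearMap.ker_eq_bot']
      intro d hd
      have h0 : spanProj e (∑ i, d i • x i) = 0 :=
        h.spanProj_eq_zero.2 fun i => congrFun hd i
      have h1 := hlow d
      rw [h0, norm_zero, mul_zero] at h1
      ext i
      have h2 := (Finset.sum_eq_zero_iff_of_nonneg fun i _ => norm_nonneg (d i)).1
        (le_antisymm h1 (Finset.sum_nonneg fun i _ => norm_nonneg (d i))) i (Finset.mem_univ i)
      simpa using h2
    obtain ⟨c, hc⟩ := LinearMap.surjective_of_injective hL fun i => ⟪e i, y⟫_ℂ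
    exact ⟨c, fun i => congrFun hc i⟩
  set s := y - ∑ i, c i • x i with hs
  have hPs : spanProj e s = 0 := h.spanProj_eq_zero.2 fun i => by
    rw [hs, inner_sub_right, hc, sub_self]
  set d : ι → ℂ := fun i => c i * (w - z i) with hd
  set D := ∑ i, ‖d i‖ with hD
  have hD0 : 0 ≤ D := Finset.sum_nonneg fun i _ => norm_nonneg _
  -- the remainder solves the mode problem with a source
  have hsrc : modeOp V S e k w s = ∑ i, d i • (spanProj e (x i) + S (x i)) := by
    have h1 : ∀ i, modeOp V S e k w (x i) = -((w - z i) • (spanProj e (x i) + S (x i))) :=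
      fun i => by
        have : modeOp V S e k w (x i) = modeOp V S e k (z i) (x i) -
            (w - z i) • (spanProj e (x i) + S (x i)) := by
          rw [modeOp_apply, modeOp_apply]; module
        rw [this, hm i, zero_sub]
    rw [hs, map_sub, hy, map_sum, zero_sub, ← Finset.sum_neg_distrib]
    refine Finset.sum_congr rfl fun i _ => ?_
    rw [map_smul, h1 i, hd, smul_neg, neg_neg, smul_smul]
  have hsrcP : (Complex.I * k) • spanProj e (V (S s)) = spanProj e (∑ i, d i • x i) := by
    have h1 := congrArg (spanProj e) hsrc
    rw [modeOp_apply, hPs] at h1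
    simp only [map_sum, map_smul, map_add, map_sub, h.spanProj_spanProj, h.spanProj_S,
      hPs, add_zero, zero_add, sub_zero, smul_zero] at h1
    rw [map_sum]
    simpa only [map_smul] using h1
  have hsrcQ : ‖s‖ ≤ 1 / 2 * ‖s‖ + D * (τ * ε) := by
    have h1 : s = -(((Complex.I * k) • V (S s) - w • S s) -
        spanProj e ((Complex.I * k) • V (S s) - w • S s)) + ∑ i, d i • S (x i) := by
      have h2 := congrArg (fun v => v - spanProj e v) hsrc
      simp only [modeOp_apply, hPs] at h2
      simp only [map_sum, map_smul, map_add, map_sub, h.spanProj_spanProj, h.spanProj_S,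
        hPs, zero_add, sub_zero, smul_zero, smul_add, Finset.sum_add_distrib,
        Finset.sum_const_zero, add_zero] at h2 ⊢
      rw [add_sub_cancel_left] at h2
      rw [← h2]
      abel
    have h3 : ‖(Complex.I * k) • V (S s) - w • S s‖ ≤ 1 / 2 * ‖s‖ := by
      refine (norm_sub_le _ _).trans ?_
      rw [norm_smul, norm_smul, norm_mul, Complex.norm_I, one_mul]
      have e1 := h.norm_S_le s
      have e2 := (h.norm_V (S s)).trans e1
      have e3 := mul_le_mul_of_nonneg_left e2 (norm_nonneg k)
      have e4 := mul_le_mul_of_nonneg_left e1 (norm_nonneg w)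
      nlinarith [norm_nonneg s]
    have h4 : ‖∑ i, d i • S (x i)‖ ≤ D * (τ * ε) := by
      refine (norm_sum_le _ _).trans ?_
      rw [hD, Finset.sum_mul]
      refine Finset.sum_le_sum fun i _ => ?_
      rw [norm_smul]
      refine mul_le_mul_of_nonneg_left ?_ (norm_nonneg _)
      have : S (x i) = S (x i - e i) := by rw [map_sub, h.S_e, sub_zero]
      rw [this]
      exact (h.norm_S_le _).trans (mul_le_mul_of_nonneg_left (hx i) hτ.le)
    calc ‖s‖ ≤ ‖((Complex.I * k) • V (S s) - w • S s) -
            spanProj e ((Complex.I * k) • V (S s) - w • S s)‖ + ‖∑ i, d i • S (x i)‖ := by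
          conv_lhs => rw [h1]
          refine (norm_add_le _ _).trans ?_
          rw [norm_neg]
      _ ≤ 1 / 2 * ‖s‖ + D * (τ * ε) :=
          add_le_add ((h.norm_sub_spanProj_le _).trans h3) h4
  have hDle : D ≤ 2 * n * (1 / 4 * ‖s‖) := by
    refine (hlow d).trans (mul_le_mul_of_nonneg_left ?_ (by positivity))
    rw [← hsrcP, norm_smul, norm_mul, Complex.norm_I, one_mul]
    have e1 := (h.norm_spanProj_le (V (S s))).trans ((h.norm_V (S s)).trans (h.norm_S_le s))
    have e3 := mul_le_mul_of_nonneg_left e1 (norm_nonneg k)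
    nlinarith [norm_nonneg s]
  have hDz : D = 0 := by
    have h1 : ‖s‖ ≤ 2 * (D * (τ * ε)) := by linarith
    have h2 : D ≤ n * τ * ε * D := by nlinarith
    have h3 : n * τ * ε ≤ 1 / 4 := by
      have : 0 ≤ n * ε := by positivity
      nlinarith
    nlinarith
  have hs0 : s = 0 := by
    rw [hDz, zero_mul, add_zero] at hsrcQ
    exact norm_eq_zero.1 (by nlinarith [norm_nonneg s])
  refine ⟨c, sub_eq_zero.1 hs0, fun i => ?_⟩
  have := (Finset.sum_eq_zero_iff_of_nonneg fun i _ => norm_nonneg (d i)).1 hDz i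
    (Finset.mem_univ i)
  exact norm_eq_zero.1 this

/-- For small wavenumber the modes of low frequency are spanned by analytic branches, one for each
vector of the basis of the kernel. -/
theorem exists_hydro_branches (h : IsModeProblem U V S e spin τ) {lam : ι → ℂ}
    (hV : ∀ i, spanProj e (V (e i)) = lam i • e i)
    (hinj : ∀ i j, lam i = lam j → spin i = spin j → i = j) :
    ∃ ζ : ι → ℂ → ℂ, ∃ x : ι → ℂ → H, (∀ i, AnalyticAt ℂ (ζ i) 0) ∧ (∀ i, ζ i 0 = 0) ∧
      ∃ ε > 0, ∀ᶠ k in 𝓝 (0 : ℂ),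
        (∀ i, IsSpin U (spin i) (x i k) ∧ modeOp V S e k (ζ i k) (x i k) = 0) ∧
        LinearIndependent ℂ (fun i => spanProj e (x i k) + S (x i k)) ∧
        ∀ w : ℂ, ‖w‖ < ε → ∀ y, modeOp V S e k w y = 0 →
          ∃ c : ι → ℂ, y = ∑ i, c i • x i k ∧ ∀ i, c i * (w - ζ i k) = 0 := by
  have hτ := h.tau_pos
  choose l x hl hxc hx0 hev using h.exists_branch_at_zero hV hinj
  set n : ℝ := (Fintype.card ι : ℝ) with hn
  have hn0 : 0 ≤ n := by positivity
  set δ : ℝ := 1 / (4 * (n + 1) * (1 + τ)) with hδ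
  have hδ0 : 0 < δ := by positivity
  have hδ1 : 4 * n * (1 + τ) * δ ≤ 1 := by
    have : 4 * (n + 1) * (1 + τ) * δ = 1 := by rw [hδ]; field_simp
    nlinarith [mul_pos (by linarith : 0 < 1 + τ) hδ0]
  have hδ2 : 2 * n * δ ≤ 1 := by
    have : 0 ≤ n * δ := by positivity
    nlinarith [mul_nonneg this hτ.le]
  have hclose : ∀ᶠ k in 𝓝 (0 : ℂ), ∀ i, ‖x i k - e i‖ ≤ δ := eventually_all.2 fun i => by
    have : ContinuousAt (fun k => ‖x i k - e i‖) 0 := ((hxc i).sub continuousAt_const).norm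
    exact (this.eventually_lt_const (by simpa [hx0] using hδ0)).mono fun k hk => hk.le
  have hsmall : ∀ᶠ k in 𝓝 (0 : ℂ), 4 * τ * ‖k‖ ≤ 1 := by
    have : ContinuousAt (fun k : ℂ => 4 * τ * ‖k‖) 0 := by fun_prop
    exact (this.eventually_lt_const (by simp)).mono fun k hk => hk.le
  refine ⟨fun i k => Complex.I * k * l i k, x, fun i => ?_, fun i => by simp,
    1 / (4 * τ), by positivity, ?_⟩
  · exact (analyticAt_const.mul analyticAt_id).mul (hl i)
  filter_upwards [hclose, hsmall, eventually_all.2 hev] with k hk1 hk2 hk3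
  refine ⟨hk3, ?_, fun w hw y hy => ?_⟩
  · rw [Fintype.linearIndependent_iff]
    intro d hd i
    have h1 : spanProj e (∑ i, d i • x i k) = 0 := by
      have := congrArg (spanProj e) hd
      simpa [map_sum, h.spanProj_spanProj, h.spanProj_S] using this
    have h2 := h.sum_norm_le hk1 hδ2 d
    rw [h1, norm_zero, mul_zero] at h2
    have h3 := (Finset.sum_eq_zero_iff_of_nonneg fun i _ => norm_nonneg (d i)).1
      (le_antisymm h2 (Finset.sum_nonneg fun i _ => norm_nonneg (d i))) i (Finset.mem_univ i)
    exact norm_eq_zero.1 h3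
  · refine h.eq_sum_of_modeOp hk1 hδ1 hδ0.le (fun i => (hk3 i).2) hk2 ?_ hy
    rw [lt_div_iff₀ (by positivity)] at hw
    linarith

end IsModeProblem
end SmallWavenumber

section Friedrichs

open scoped InnerProductSpace

variable {H : Type*} [NormedAddCommGroup H] [InnerProductSpace ℂ H]

/-! ### The Friedrichs extension -/

section Form

variable {A : H →ₗ.[ℂ] H}

/-- Cauchy–Schwarz for the quadratic form of a nonnegative symmetric operator. -/
theorem norm_form_sq_le (hA : ∀ x : A.domain, 0 ≤ (inner ℂ (x : H) (A x)).re)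
    (hs : ∀ x y : A.domain, ⟪A x, (y : H)⟫_ℂ = ⟪(x : H), A y⟫_ℂ) (x y : A.domain) :
    ‖⟪(x : H), A y⟫_ℂ‖ ^ 2 ≤ (⟪(x : H), A x⟫_ℂ).re * (⟪(y : H), A y⟫_ℂ).re := by
  let core : PreInnerProductSpace.Core ℂ A.domain :=
    { inner := fun x y => ⟪(x : H), A y⟫_ℂ
      conj_inner_symm := fun x y => by rw [inner_conj_symm, hs]
      re_inner_nonneg := hA
      add_left := fun x y z => by rw [Submodule.coe_add, inner_add_left]
      smul_left := fun x y r => by rw [Submodule.coe_smul, inner_smul_left] }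
  have h := @InnerProductSpace.Core.inner_mul_inner_self_le ℂ A.domain _ _ _ core x y
  have h2 : ‖⟪(y : H), A x⟫_ℂ‖ = ‖⟪(x : H), A y⟫_ℂ‖ := by
    rw [← hs, ← inner_conj_symm, RCLike.norm_conj]
  calc ‖⟪(x : H), A y⟫_ℂ‖ ^ 2 = ‖⟪(x : H), A y⟫_ℂ‖ * ‖⟪(y : H), A x⟫_ℂ‖ := by rw [h2, sq]
    _ ≤ _ := h

theorem form_add_le (hA : ∀ x : A.domain, 0 ≤ (inner ℂ (x : H) (A x)).re) (a b : A.domain) :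
    (⟪((a + b : A.domain) : H), A (a + b)⟫_ℂ).re ≤
      2 * (⟪(a : H), A a⟫_ℂ).re + 2 * (⟪(b : H), A b⟫_ℂ).re := by
  have h := hA (a - b)
  simp only [LinearPMap.map_sub, LinearPMap.map_add, Submodule.coe_sub, Submodule.coe_add,
    inner_sub_left, inner_sub_right, inner_add_left, inner_add_right, Complex.sub_re,
    Complex.add_re] at h ⊢
  linarith

/-- The sequences that approximate elements of the form domain are eventually bounded in form. -/
theorem exists_form_bound (hA : ∀ x : A.domain, 0 ≤ (inner ℂ (x : H) (A x)).re) {u : ℕ → A.domain}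
    (hu : Tendsto (fun i : ℕ × ℕ =>
      (inner ℂ ((u i.1 - u i.2 : A.domain) : H) (A (u i.1 - u i.2))).re) atTop (𝓝 0)) :
    ∃ B : ℝ, 0 < B ∧ ∀ᶠ n in atTop, (⟪(u n : H), A (u n)⟫_ℂ).re ≤ B := by
  have h1 := hu.eventually_lt_const one_pos
  rw [eventually_atTop] at h1
  obtain ⟨⟨N, M⟩, h1⟩ := h1
  refine ⟨2 + 2 * (⟪(u M : H), A (u M)⟫_ℂ).re, by linarith [hA (u M)], ?_⟩
  filter_upwards [eventually_ge_atTop N] with n hn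
  have h2 := h1 (n, M) ⟨hn, le_rfl⟩
  have h3 := form_add_le hA (u n - u M) (u M)
  rw [sub_add_cancel] at h3
  simp only at h2
  linarith

theorem tendsto_form_sub (hA : ∀ x : A.domain, 0 ≤ (inner ℂ (x : H) (A x)).re)
    (hs : ∀ x y : A.domain, ⟪A x, (y : H)⟫_ℂ = ⟪(x : H), A y⟫_ℂ) {φ : H} {u w : ℕ → A.domain}
    (hφ : Tendsto (fun n => (u n : H)) atTop (𝓝 φ))
    (hu : Tendsto (fun i : ℕ × ℕ =>
      (inner ℂ ((u i.1 - u i.2 : A.domain) : H) (A (u i.1 - u i.2))).re) atTop (𝓝 0))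
    (hw : Tendsto (fun i : ℕ × ℕ =>
      (inner ℂ ((w i.1 - w i.2 : A.domain) : H) (A (w i.1 - w i.2))).re) atTop (𝓝 0)) :
    Tendsto (fun n => ⟪φ - u n, A (w n)⟫_ℂ) atTop (𝓝 0) := by
  obtain ⟨B, hB, hwB⟩ := exists_form_bound hA hw
  rw [Metric.tendsto_atTop']
  intro ε hε
  have h1 := hu.eventually_lt_const (show 0 < ε ^ 2 / 4 / B by positivity)
  rw [eventually_atTop] at h1
  obtain ⟨⟨N, M⟩, h1⟩ := h1
  rw [eventually_atTop] at hwB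
  obtain ⟨L, hL⟩ := hwB
  refine ⟨max M L, fun n hn => ?_⟩
  have hnM : M ≤ n := (le_max_left _ _).trans hn.le
  have hnL : L ≤ n := (le_max_right _ _).trans hn.le
  have hlim : Tendsto (fun m => ‖⟪(u m : H) - u n, A (w n)⟫_ℂ‖ ^ 2) atTop
      (𝓝 (‖⟪φ - u n, A (w n)⟫_ℂ‖ ^ 2)) :=
    (((hφ.sub_const _).inner tendsto_const_nhds).norm).pow 2
  have hle : ‖⟪φ - u n, A (w n)⟫_ℂ‖ ^ 2 ≤ ε ^ 2 / 4 := by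
    refine le_of_tendsto hlim ?_
    filter_upwards [eventually_ge_atTop N] with m hm
    have h2 := norm_form_sq_le hA hs (u m - u n) (w n)
    rw [Submodule.coe_sub] at h2
    have h3 := h1 (m, n) ⟨hm, hnM⟩
    simp only [Submodule.coe_sub] at h3
    have h4 := hL n hnL
    refine h2.trans ?_
    calc _ ≤ ε ^ 2 / 4 / B * B :=
          mul_le_mul h3.le h4 (hA _) (by positivity)
      _ = ε ^ 2 / 4 := by field_simp
  rw [dist_zero_right]
  have h5 : ‖⟪φ - u n, A (w n)⟫_ℂ‖ ≤ ε / 2 :=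
    (pow_le_pow_iff_left₀ (norm_nonneg _) (by positivity) two_ne_zero).1
      (hle.trans_eq (by ring))
  linarith

end Form

variable [CompleteSpace H] {A : H →ₗ.[ℂ] H}
  {hA : ∀ x : A.domain, 0 ≤ (inner ℂ (x : H) (A x)).re}

theorem friedrichs_inner (hd : Dense (A.domain : Set H)) (φ : (friedrichs A hA).domain)
    (a : A.domain) : ⟪friedrichs A hA φ, (a : H)⟫_ℂ = ⟪(φ : H), A a⟫_ℂ := by
  have h1 : friedrichs A hA φ = A.adjoint ⟨φ, φ.2.2⟩ := LinearPMap.domRestrict_apply rfl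
  rw [h1]
  exact LinearPMap.adjoint_isFormalAdjoint hd ⟨φ, φ.2.2⟩ a

theorem friedrichs_of_inner (hd : Dense (A.domain : Set H)) {φ y : H} (hφ : φ ∈ formDomain A hA)
    (hy : ∀ a : A.domain, ⟪y, (a : H)⟫_ℂ = ⟪φ, A a⟫_ℂ) :
    ∃ h : φ ∈ (friedrichs A hA).domain, friedrichs A hA ⟨φ, h⟩ = y := by
  have h1 : φ ∈ A.adjoint.domain := LinearPMap.mem_adjoint_domain_of_exists φ ⟨y, hy⟩
  refine ⟨⟨hφ, h1⟩, ?_⟩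
  have h2 : friedrichs A hA ⟨φ, ⟨hφ, h1⟩⟩ = A.adjoint ⟨φ, h1⟩ := LinearPMap.domRestrict_apply rfl
  rw [h2]
  exact LinearPMap.adjoint_apply_eq hd _ hy

theorem friedrichs_extends (hd : Dense (A.domain : Set H))
    (hs : ∀ x y : A.domain, ⟪A x, (y : H)⟫_ℂ = ⟪(x : H), A y⟫_ℂ) (a : A.domain) :
    ∃ h : (a : H) ∈ (friedrichs A hA).domain, friedrichs A hA ⟨a, h⟩ = A a :=
  friedrichs_of_inner hd ⟨fun _ => a, tendsto_const_nhds, by simp⟩ fun b => hs a b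

theorem friedrichs_symmetric (hd : Dense (A.domain : Set H))
    (hs : ∀ x y : A.domain, ⟪A x, (y : H)⟫_ℂ = ⟪(x : H), A y⟫_ℂ)
    (φ ψ : (friedrichs A hA).domain) :
    ⟪friedrichs A hA φ, (ψ : H)⟫_ℂ = ⟪(φ : H), friedrichs A hA ψ⟫_ℂ := by
  obtain ⟨u, hu, hu'⟩ := φ.2.1
  obtain ⟨w, hw, hw'⟩ := ψ.2.1
  -- both sides are the limit of `⟪u n, A (w n)⟫`
  have h1 : Tendsto (fun n => ⟪(φ : H), A (w n)⟫_ℂ) atTop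
      (𝓝 ⟪friedrichs A hA φ, (ψ : H)⟫_ℂ) := by
    simp only [← friedrichs_inner hd]
    exact tendsto_const_nhds.inner hw
  have h2 : Tendsto (fun n => ⟪A (u n), (ψ : H)⟫_ℂ) atTop
      (𝓝 ⟪(φ : H), friedrichs A hA ψ⟫_ℂ) := by
    have : ∀ n, ⟪A (u n), (ψ : H)⟫_ℂ = ⟪(u n : H), friedrichs A hA ψ⟫_ℂ := fun n => by
      rw [← inner_conj_symm, ← friedrichs_inner hd, inner_conj_symm]
    simp only [this]
    exact hu.inner tendsto_const_nhds
  have h3 := h1.sub (tendsto_form_sub hA hs hu hu' hw')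
  have h4 := h2.sub ((Complex.continuous_conj.tendsto 0).comp
    (tendsto_form_sub hA hs hw hw' hu'))
  rw [map_zero, sub_zero] at h4
  rw [sub_zero] at h3
  refine tendsto_nhds_unique h3 (h4.congr fun n => ?_)
  simp only [Function.comp_apply]
  rw [inner_conj_symm, inner_sub_right, inner_sub_left, hs]
  ring

/-- The Friedrichs extension inherits unitary symmetries. -/
theorem friedrichs_covariant (hd : Dense (A.domain : Set H)) {U U' : H →ₗᵢ[ℂ] H}
    (hUU' : ∀ x, U (U' x) = x)
    (hU : ∀ a : A.domain, ∃ b : A.domain, (b : H) = U a ∧ A b = U (A a))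
    (hU' : ∀ a : A.domain, ∃ b : A.domain, (b : H) = U' a ∧ A b = U' (A a))
    (φ : (friedrichs A hA).domain) :
    ∃ h : U φ ∈ (friedrichs A hA).domain,
      friedrichs A hA ⟨U φ, h⟩ = U (friedrichs A hA φ) := by
  refine friedrichs_of_inner hd ?_ fun a => ?_
  · obtain ⟨u, hu, hu'⟩ := φ.2.1
    choose f hf hAf using hU
    refine ⟨fun n => f (u n), ?_, ?_⟩
    · simp only [hf]
      exact (U.continuous.tendsto _).comp hu
    · refine hu'.congr fun i => ?_
      rw [LinearPMap.map_sub, LinearPMap.map_sub, hAf, hAf, Submodule.coe_sub, Submodule.coe_sub,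
        hf, hf, ← map_sub, ← map_sub, U.inner_map_map]
  · obtain ⟨b, hb, hAb⟩ := hU' a
    rw [← hUU' (a : H), U.inner_map_map, ← hb, friedrichs_inner hd, hAb, ← U.inner_map_map, hUU']

end Friedrichs

section ReducedResolvent

open scoped InnerProductSpace

variable {H : Type*} [NormedAddCommGroup H] [InnerProductSpace ℂ H] [CompleteSpace H]

/-! ### The reduced resolvent -/

/-- A self-adjoint operator with spectrum in `[0, τ]` satisfies `S² ≤ τ S`. -/
theorem norm_sq_le_of_spectrum {S : H →L[ℂ] H} (hS : IsSelfAdjoint S) {τ : ℝ}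
    (hspec : ∀ y ∈ spectrum ℝ S, 0 ≤ y ∧ y ≤ τ) (x : H) :
    ‖S x‖ ^ 2 ≤ τ * (⟪S x, x⟫_ℂ).re := by
  have h1 : 0 ≤ cfc (fun y : ℝ => τ * y - y ^ 2) S := cfc_nonneg fun y hy => by
    obtain ⟨h0, h1⟩ := hspec y hy
    nlinarith
  have h2 : cfc (fun y : ℝ => τ * y - y ^ 2) S = τ • S - S ^ 2 := by
    rw [cfc_sub (fun y : ℝ => τ * y) (fun y => y ^ 2) S, cfc_const_mul_id τ S, cfc_pow_id S 2]
  rw [h2, ContinuousLinearMap.nonneg_iff_isPositive] at h1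
  have h3 := h1.re_inner_nonneg_left x
  have h4 : ⟪S (S x), x⟫_ℂ = ⟪S x, S x⟫_ℂ :=
    (ContinuousLinearMap.isSelfAdjoint_iff_isSymmetric.1 hS) (S x) x
  have h5 : ⟪(τ • S - S ^ 2) x, x⟫_ℂ = τ * ⟪S x, x⟫_ℂ - ((‖S x‖ ^ 2 : ℝ) : ℂ) := by
    rw [sub_apply, smul_apply, sq S, mul_apply_eq_comp, inner_sub_left, h4,
      ← Complex.coe_smul, inner_smul_left, Complex.conj_ofReal, inner_self_eq_norm_sq_to_K]
    push_cast; rfl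
  rw [h5] at h3
  simp only [RCLike.re_to_complex, Complex.sub_re, Complex.re_ofReal_mul, Complex.ofReal_re] at h3
  linarith

/-- The inverse of a symmetric operator on the orthogonal complement of its kernel, extended by
zero. Its size is the inverse of the gap. -/
theorem exists_reducedResolvent {F : H →ₗ.[ℂ] H} {K : Submodule ℂ H} [K.HasOrthogonalProjection]
    (hsymm : ∀ φ ψ : F.domain, ⟪F φ, (ψ : H)⟫_ℂ = ⟪(φ : H), F ψ⟫_ℂ)
    (hK : ∀ a ∈ K, ∃ h : a ∈ F.domain, F ⟨a, h⟩ = 0) {τ : ℝ} (hτ : 0 < τ)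
    (hgap : IsGLB {x : ℝ | (x : ℂ) ∈ spectrumOn F Kᗮ} (1 / τ)) :
    ∃ S : H →L[ℂ] H, (∀ x ∈ K, S x = 0) ∧ (∀ x, S x ∈ Kᗮ) ∧
      (∀ x, ‖S x‖ ^ 2 ≤ τ * (⟪S x, x⟫_ℂ).re) ∧
      ∀ φ y, (∃ h : φ ∈ F.domain, F ⟨φ, h⟩ = y) ↔ y ∈ Kᗮ ∧ ∃ a ∈ K, φ = a + S y := by
  have hres : ∀ x : ℝ, x < 1 / τ → ∃ C : ℝ,
      (∀ φ : F.domain, (φ : H) ∈ Kᗮ → ‖(φ : H)‖ ≤ C * ‖F φ - (x : ℂ) • (φ : H)‖) ∧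
      ∀ y ∈ Kᗮ, ∃ φ : F.domain, (φ : H) ∈ Kᗮ ∧ F φ - (x : ℂ) • (φ : H) = y := fun x hx => by
    by_contra hcon
    exact absurd (hgap.1 (show x ∈ {x : ℝ | (x : ℂ) ∈ spectrumOn F Kᗮ} from hcon)) (not_le.2 hx)
  have hrange : ∀ φ : F.domain, F φ ∈ Kᗮ := fun φ => by
    rw [Submodule.mem_orthogonal]
    intro a ha
    obtain ⟨h, h0⟩ := hK a ha
    rw [← hsymm ⟨a, h⟩ φ, h0, inner_zero_left]
  obtain ⟨C, hC, hsurj⟩ := hres 0 (by positivity)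
  simp only [Complex.ofReal_zero, zero_smul, sub_zero] at hC hsurj
  have hsurj' : ∀ x : H, ∃ φ : F.domain, (φ : H) ∈ Kᗮ ∧ F φ = x - K.starProjection x := fun x =>
    hsurj _ (K.sub_starProjection_mem_orthogonal x)
  choose g hgK hFg using hsurj'
  have huniq : ∀ φ ψ : F.domain, (φ : H) ∈ Kᗮ → (ψ : H) ∈ Kᗮ → F φ = F ψ → (φ : H) = ψ :=
    fun φ ψ hφ hψ h => by
      have h1 := hC (φ - ψ) (by rw [Submodule.coe_sub]; exact sub_mem hφ hψ)
      rw [LinearPMap.map_sub, h, sub_self, norm_zero, mul_zero, Submodule.coe_sub] at h1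
      exact sub_eq_zero.1 (norm_le_zero_iff.1 h1)
  let S₀ : H →ₗ[ℂ] H :=
    { toFun := fun x => g x
      map_add' := fun x y => by
        rw [← Submodule.coe_add]
        refine huniq _ _ (hgK _) (by rw [Submodule.coe_add]; exact add_mem (hgK x) (hgK y)) ?_
        rw [LinearPMap.map_add, hFg, hFg, hFg, map_add]; abel
      map_smul' := fun c x => by
        rw [RingHom.id_apply, ← Submodule.coe_smul]
        refine huniq _ _ (hgK _) (by rw [Submodule.coe_smul]; exact Submodule.smul_mem _ c (hgK x)) ?_
        rw [LinearPMap.map_smul, hFg, hFg, map_smul, smul_sub] }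
  have hS₀ : ∀ x, ‖S₀ x‖ ≤ |C| * ‖x‖ := fun x => by
    refine (hC (g x) (hgK x)).trans ?_
    refine (mul_le_mul_of_nonneg_right (le_abs_self C) (norm_nonneg _)).trans ?_
    refine mul_le_mul_of_nonneg_left ?_ (abs_nonneg C)
    have h1 : Kᗮ.starProjection x = x - K.starProjection x := by
      rw [Submodule.starProjection_orthogonal]; rfl
    rw [hFg, ← h1]
    exact Submodule.norm_starProjection_apply_le _ _
  set S : H →L[ℂ] H := S₀.mkContinuous |C| hS₀ with hSdef
  have hSg : ∀ x, S x = g x := fun x => rfl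
  have hSK : ∀ x ∈ K, S x = 0 := fun x hx => by
    have h0 : F (g x) = F 0 := by
      rw [hFg, Submodule.starProjection_eq_self_iff.2 hx, sub_self, LinearPMap.map_zero]
    exact huniq _ 0 (hgK x) (zero_mem _) h0
  have hproj : ∀ y ∈ Kᗮ, K.starProjection y = 0 := fun y hy =>
    (Submodule.starProjection_apply_eq_zero_iff _).2 hy
  have hSF : ∀ φ : F.domain, (φ : H) ∈ Kᗮ → S (F φ) = φ := fun φ hφ => by
    rw [hSg]
    refine huniq _ _ (hgK _) hφ ?_
    rw [hFg, hproj _ (hrange φ), sub_zero]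
  have hSsymm : ∀ x y, ⟪S x, y⟫_ℂ = ⟪x, S y⟫_ℂ := fun x y => by
    have h1 : ⟪S x, y⟫_ℂ = ⟪S x, F (g y)⟫_ℂ := by
      rw [hFg, inner_sub_right, Submodule.inner_left_of_mem_orthogonal
        (K.starProjection_apply_mem y) (show S x ∈ Kᗮ from hgK x), sub_zero]
    have h2 : ⟪x, S y⟫_ℂ = ⟪F (g x), S y⟫_ℂ := by
      rw [hFg, inner_sub_left, Submodule.inner_right_of_mem_orthogonal
        (K.starProjection_apply_mem x) (show S y ∈ Kᗮ from hgK y), sub_zero]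
    rw [h1, h2, hSg, hSg, hsymm]
  have hSsa : IsSelfAdjoint S :=
    ContinuousLinearMap.isSelfAdjoint_iff_isSymmetric.2 fun x y => hSsymm x y
  refine ⟨S, hSK, hgK, norm_sq_le_of_spectrum hSsa fun y hy => ?_, fun φ y => ⟨?_, ?_⟩⟩
  · by_contra hcon
    have hy0 : y ≠ 0 := by
      rintro rfl
      exact hcon ⟨le_rfl, hτ.le⟩
    have hyC : (y : ℂ) ≠ 0 := by exact_mod_cast hy0
    have hlt : y⁻¹ < 1 / τ := by
      rcases lt_or_gt_of_ne hy0 with h | h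
      · exact (inv_lt_zero.2 h).trans (by positivity)
      · have : τ < y := by
          by_contra hle
          exact hcon ⟨h.le, not_lt.1 hle⟩
        rw [one_div]
        exact inv_strictAnti₀ hτ this
    obtain ⟨C', hC', hsurj'⟩ := hres _ hlt
    apply hy
    rw [spectrum.mem_resolventSet_iff, ContinuousLinearMap.isUnit_iff_bijective]
    have happ : ∀ d, (algebraMap ℝ (H →L[ℂ] H) y - S) d = (y : ℂ) • d - S d := fun d => by
      rw [Algebra.algebraMap_eq_smul_one, sub_apply, smul_apply, one_apply_eq_self,
        Complex.coe_smul]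
    constructor
    · rw [injective_iff_map_eq_zero]
      intro d hd
      rw [happ, sub_eq_zero] at hd
      have hd' : d = ((y⁻¹ : ℝ) : ℂ) • S d := by
        rw [← hd, smul_smul, Complex.ofReal_inv, inv_mul_cancel₀ hyC, one_smul]
      have hdK : d ∈ Kᗮ := by rw [hd']; exact Submodule.smul_mem _ _ (hgK d)
      have hFd : F (g d) = d := by rw [hFg, hproj d hdK, sub_zero]
      have h1 := hC' (g d) (hgK d)
      rw [hFd, ← hSg, ← hd', sub_self, norm_zero, mul_zero] at h1
      rw [hd', norm_le_zero_iff.1 h1, smul_zero]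
    · intro c
      obtain ⟨b, hb, hFb⟩ := hsurj' (((y⁻¹ : ℝ) : ℂ) • (c - K.starProjection c))
        (Submodule.smul_mem _ _ (K.sub_starProjection_mem_orthogonal c))
      refine ⟨F b + ((y⁻¹ : ℝ) : ℂ) • K.starProjection c, ?_⟩
      have h1 : F b = ((y⁻¹ : ℝ) : ℂ) • (b : H) +
          ((y⁻¹ : ℝ) : ℂ) • (c - K.starProjection c) := by rw [← hFb]; abel
      rw [happ, map_add, map_smul, hSK _ (K.starProjection_apply_mem c), hSF b hb, h1]
      simp only [smul_add, smul_smul, Complex.ofReal_inv, mul_inv_cancel₀ hyC, one_smul, smul_zero]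
      abel
  · rintro ⟨h, rfl⟩
    refine ⟨hrange _, K.starProjection φ, K.starProjection_apply_mem φ, ?_⟩
    obtain ⟨h', h0⟩ := hK _ (K.starProjection_apply_mem φ)
    have h1 : F ⟨φ, h⟩ = F (⟨φ, h⟩ - ⟨K.starProjection φ, h'⟩) := by
      rw [LinearPMap.map_sub, h0, sub_zero]
    rw [h1, hSF _ (K.sub_starProjection_mem_orthogonal φ), Submodule.coe_sub]
    abel
  · rintro ⟨hy, a, ha, rfl⟩
    obtain ⟨h', h0⟩ := hK a ha
    refine ⟨add_mem h' (g y).2, ?_⟩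
    have h1 : F (⟨a, h'⟩ + g y) = y := by
      rw [LinearPMap.map_add, h0, hFg, hproj y hy, sub_zero, zero_add]
    exact h1

end ReducedResolvent

section MomentumSpace

open scoped InnerProductSpace

/-! ### The equilibrium measure -/

theorem continuous_energy (m : ℝ) : Continuous (energy m) := by
  unfold energy; fun_prop

theorem continuous_equilibrium (m T μ : ℝ) : Continuous (equilibrium m T μ) := by
  have := continuous_energy m
  unfold equilibrium; fun_prop

theorem energy_nonneg (m : ℝ) (p : Momentum) : 0 ≤ energy m p := Real.sqrt_nonneg _

theorem norm_le_energy (m : ℝ) (p : Momentum) : ‖p‖ ≤ energy m p :=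
  Real.le_sqrt_of_sq_le (by nlinarith [sq_nonneg m])

theorem energy_le (m : ℝ) (p : Momentum) : energy m p ≤ |m| + ‖p‖ := by
  refine Real.sqrt_le_iff.2 ⟨by positivity, ?_⟩
  nlinarith [sq_abs m, mul_nonneg (abs_nonneg m) (norm_nonneg p)]

theorem abs_coord_le (p : Momentum) (j : Fin 3) : |p j| ≤ ‖p‖ := by
  simpa using PiLp.norm_apply_le p j

/-- Also valid at `p = 0` for massless particles, where the velocity has the junk value `0`. -/
theorem velocity_mul_energy (m : ℝ) (p : Momentum) : velocity m p * energy m p = p 0 := by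
  rcases eq_or_ne (energy m p) 0 with h | h
  · have h1 : ‖p‖ ≤ 0 := h ▸ norm_le_energy m p
    have h2 : p = 0 := norm_le_zero_iff.1 h1
    rw [h, mul_zero, h2]; rfl
  · exact div_mul_cancel₀ _ h

theorem abs_velocity_le (m : ℝ) (p : Momentum) : |velocity m p| ≤ 1 := by
  rw [velocity, abs_div, abs_of_nonneg (energy_nonneg m p)]
  exact div_le_one_of_le₀ ((abs_coord_le p 0).trans (norm_le_energy m p)) (energy_nonneg m p)

theorem measurable_velocity (m : ℝ) : Measurable (velocity m) := by
  have h1 : Continuous fun p : Momentum => p 0 := by fun_prop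
  exact h1.measurable.div (continuous_energy m).measurable

theorem measurable_density (m T μ : ℝ) :
    Measurable fun p => ENNReal.ofReal (equilibrium m T μ p / (2 * Real.pi) ^ 3) :=
  ((continuous_equilibrium m T μ).measurable.div_const _).ennreal_ofReal

theorem volume_absolutelyContinuous (m T μ : ℝ) :
    (volume : Measure Momentum) ≪ eqMeasure m T μ := by
  refine withDensity_absolutelyContinuous' (measurable_density m T μ).aemeasurable
    (ae_of_all _ fun p => ?_)
  have : 0 < equilibrium m T μ p / (2 * Real.pi) ^ 3 := by
    unfold equilibrium; positivity
  simpa using this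

/-- Continuous functions that agree almost everywhere in equilibrium are equal. -/
theorem eq_of_ae_eq_eqMeasure {m T μ : ℝ} {f g : Momentum → ℂ} (hf : Continuous f)
    (hg : Continuous g) (h : f =ᵐ[eqMeasure m T μ] g) : f = g :=
  Continuous.ae_eq_iff_eq (volume : Measure Momentum) hf hg |>.1
    ((volume_absolutelyContinuous m T μ).ae_le h)

theorem measurePreserving_isometry (m T μ : ℝ) (L : Momentum ≃ₗᵢ[ℝ] Momentum) :
    MeasurePreserving L (eqMeasure m T μ) (eqMeasure m T μ) := by
  have hL : MeasurePreserving L volume volume := L.measurePreserving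
  refine ⟨hL.measurable, ?_⟩
  ext s hs
  rw [Measure.map_apply hL.measurable hs, eqMeasure, withDensity_apply _ hs,
    withDensity_apply _ (hL.measurable hs)]
  rw [← hL.setLIntegral_comp_preimage hs (measurable_density m T μ)]
  simp only [equilibrium, energy, LinearIsometryEquiv.norm_map]

/-- Functions of at most linear growth are square integrable in equilibrium. -/
theorem memLp_of_linear_growth (m : ℝ) {T : ℝ} (hT : 0 < T) (μ : ℝ) {f : Momentum → ℂ}
    (hf : Continuous f) {C : ℝ} (hC : ∀ p, ‖f p‖ ≤ C * (1 + ‖p‖)) :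
    MemLp f 2 (eqMeasure m T μ) := by
  rw [memLp_two_iff_integrable_sq_norm hf.aestronglyMeasurable, eqMeasure,
    integrable_withDensity_iff (measurable_density m T μ) (ae_of_all _ fun _ => ENNReal.ofReal_lt_top)]
  set B : ℝ := C ^ 2 * (Real.exp (μ / T) * (Real.exp (1 / T) * (T ^ 6 * 720))) with hB
  have hint : Integrable (fun p : Momentum => B * (1 + ‖p‖) ^ (-(4 : ℝ))) volume := by
    refine (integrable_one_add_norm ?_).const_mul B
    simp; norm_num
  refine hint.mono' ?_ (ae_of_all _ fun p => ?_)
  · exact ((hf.norm.pow 2).measurable.mul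
      (measurable_density m T μ).ennreal_toReal).aestronglyMeasurable
  have hx : 0 < 1 + ‖p‖ := by positivity
  have hpi : (1 : ℝ) ≤ (2 * Real.pi) ^ 3 := one_le_pow₀ (by linarith [Real.pi_gt_three])
  have he0 : 0 < equilibrium m T μ p := Real.exp_pos _
  have hpos : 0 ≤ equilibrium m T μ p / (2 * Real.pi) ^ 3 := by positivity
  rw [ENNReal.toReal_ofReal hpos, Real.norm_of_nonneg (by positivity)]
  -- the exponential beats any power
  have hexp : Real.exp (-‖p‖ / T) ≤ Real.exp (1 / T) * (T ^ 6 * 720) / (1 + ‖p‖) ^ 6 := by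
    have h1 := Real.pow_div_factorial_le_exp (x := (1 + ‖p‖) / T) (by positivity) 6
    have h2 : Real.exp (-‖p‖ / T) * Real.exp ((1 + ‖p‖) / T) = Real.exp (1 / T) := by
      rw [← Real.exp_add]; congr 1; field_simp; ring
    rw [le_div_iff₀ (by positivity), ← h2]
    have h3 : (1 + ‖p‖) ^ 6 ≤ Real.exp ((1 + ‖p‖) / T) * (T ^ 6 * 720) := by
      rw [div_pow, div_div, div_le_iff₀ (by positivity)] at h1
      simpa [Nat.factorial] using h1
    calc _ ≤ Real.exp (-‖p‖ / T) * (Real.exp ((1 + ‖p‖) / T) * (T ^ 6 * 720)) := by gcongr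
      _ = _ := by ring
  have heq : equilibrium m T μ p ≤ Real.exp (μ / T) * Real.exp (-‖p‖ / T) := by
    rw [equilibrium, ← Real.exp_add, Real.exp_le_exp, ← add_div]
    gcongr
    linarith [norm_le_energy m p]
  have hf2 : ‖f p‖ ^ 2 ≤ C ^ 2 * (1 + ‖p‖) ^ 2 := by
    rw [← mul_pow]; exact pow_le_pow_left₀ (norm_nonneg _) (hC p) 2
  have hrpow : (1 + ‖p‖) ^ (-(4 : ℝ)) = ((1 + ‖p‖) ^ 4)⁻¹ := by
    rw [Real.rpow_neg hx.le]; norm_cast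
  calc ‖f p‖ ^ 2 * (equilibrium m T μ p / (2 * Real.pi) ^ 3)
      ≤ (C ^ 2 * (1 + ‖p‖) ^ 2) * (Real.exp (μ / T) *
          (Real.exp (1 / T) * (T ^ 6 * 720) / (1 + ‖p‖) ^ 6)) := by
        refine mul_le_mul hf2 ?_ hpos (by positivity)
        exact (div_le_self he0.le hpi).trans (heq.trans (by gcongr))
    _ = B * (1 + ‖p‖) ^ (-(4 : ℝ)) := by
        rw [hrpow, hB]; field_simp

/-! ### Operators on the state space -/

/-- The rotation around the first axis as a linear isometry. -/
def rotationIso (θ : ℝ) : Momentum ≃ₗᵢ[ℝ] Momentum where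
  toFun := rotation θ
  invFun := rotation (-θ)
  map_add' p q := by
    ext i; fin_cases i <;> simp [rotation] <;> ring
  map_smul' c p := by
    ext i; fin_cases i <;> simp [rotation] <;> ring
  left_inv p := by
    have h := Real.sin_sq_add_cos_sq θ
    ext i
    fin_cases i
    · simp [rotation]
    · simp [rotation]; linear_combination p 1 * h
    · simp [rotation]; linear_combination p 2 * h
  right_inv p := by
    have h := Real.sin_sq_add_cos_sq θ
    ext i
    fin_cases i
    · simp [rotation]
    · simp [rotation]; linear_combination p 1 * h
    · simp [rotation]; linear_combination p 2 * h
  norm_map' p := by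
    have h := Real.sin_sq_add_cos_sq θ
    rw [← sq_eq_sq₀ (norm_nonneg _) (norm_nonneg _), EuclideanSpace.norm_sq_eq,
      EuclideanSpace.norm_sq_eq]
    simp [Fin.sum_univ_three, rotation]
    linear_combination (p 1 ^ 2 + p 2 ^ 2) * h

variable {m T μ : ℝ}

/-- Composition with an isometry of momentum space. -/
def compIso (L : Momentum ≃ₗᵢ[ℝ] Momentum) : StateSpace m T μ →ₗᵢ[ℂ] StateSpace m T μ :=
  Lp.compMeasurePreservingₗᵢ ℂ L (measurePreserving_isometry m T μ L)

theorem compIso_ae (L : Momentum ≃ₗᵢ[ℝ] Momentum) (φ : StateSpace m T μ) :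
    compIso L φ =ᵐ[eqMeasure m T μ] fun p => φ (L p) :=
  Lp.coeFn_compMeasurePreserving φ (measurePreserving_isometry m T μ L)

theorem compIso_eq_of_ae {L : Momentum ≃ₗᵢ[ℝ] Momentum} {φ : StateSpace m T μ}
    {f : Momentum → ℂ} (hφ : φ =ᵐ[eqMeasure m T μ] f) :
    compIso L φ =ᵐ[eqMeasure m T μ] fun p => f (L p) :=
  (compIso_ae L φ).trans
    ((measurePreserving_isometry m T μ L).quasiMeasurePreserving.ae_eq_comp hφ)

/-- The action of the rotations around the first axis. -/
def rotOp (m T μ : ℝ) (θ : ℝ) : StateSpace m T μ →ₗᵢ[ℂ] StateSpace m T μ :=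
  compIso (rotationIso θ)

theorem rotOp_rotOp_neg (θ : ℝ) (φ : StateSpace m T μ) :
    rotOp m T μ θ (rotOp m T μ (-θ) φ) = φ := by
  refine Lp.ext ?_
  refine (compIso_eq_of_ae (L := rotationIso θ) (compIso_ae (rotationIso (-θ)) φ)).trans
    (Eventually.of_forall fun p => ?_)
  have : rotationIso (-θ) (rotationIso θ p) = p := (rotationIso θ).left_inv p
  simp only [this]

theorem hasSpin_iff {σ : ℤ} {φ : StateSpace m T μ} :
    HasSpin σ φ ↔ IsSpin (rotOp m T μ) σ φ := by
  refine forall_congr' fun θ => ?_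
  have h1 := compIso_ae (rotationIso θ) φ
  have h2 := Lp.coeFn_smul (Complex.exp (Complex.I * (σ : ℂ) * (θ : ℂ))) φ
  constructor
  · intro h
    exact Lp.ext (h1.trans (h.trans h2.symm))
  · intro h
    refine h1.symm.trans ?_
    have h3 : compIso (rotationIso θ) φ = Complex.exp (Complex.I * (σ : ℂ) * (θ : ℂ)) • φ := h
    rw [h3]
    exact h2

theorem memLp_velocity_mul (φ : StateSpace m T μ) :
    MemLp (fun p => ((velocity m p : ℝ) : ℂ) * φ p) 2 (eqMeasure m T μ) := by
  refine (Lp.memLp φ).of_le ?_ (ae_of_all _ fun p => ?_)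
  · exact (Complex.measurable_ofReal.comp (measurable_velocity m)).aestronglyMeasurable.mul
      (Lp.aestronglyMeasurable φ)
  · rw [norm_mul, Complex.norm_real, Real.norm_eq_abs]
    exact mul_le_of_le_one_left (norm_nonneg _) (abs_velocity_le m p)

/-- Multiplication by the velocity. -/
def velocityOp (m T μ : ℝ) : StateSpace m T μ →L[ℂ] StateSpace m T μ :=
  LinearMap.mkContinuous
    { toFun := fun φ => (memLp_velocity_mul φ).toLp _
      map_add' := fun φ ψ => by
        refine Lp.ext ?_
        filter_upwards [(memLp_velocity_mul (φ + ψ)).coeFn_toLp, (memLp_velocity_mul φ).coeFn_toLp,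
          (memLp_velocity_mul ψ).coeFn_toLp, Lp.coeFn_add φ ψ,
          Lp.coeFn_add ((memLp_velocity_mul φ).toLp _) ((memLp_velocity_mul ψ).toLp _)]
          with p h1 h2 h3 h4 h5
        rw [h1, h5, Pi.add_apply, h2, h3, h4, Pi.add_apply, mul_add]
      map_smul' := fun c φ => by
        refine Lp.ext ?_
        filter_upwards [(memLp_velocity_mul (c • φ)).coeFn_toLp,
          (memLp_velocity_mul φ).coeFn_toLp, Lp.coeFn_smul c φ,
          Lp.coeFn_smul c ((memLp_velocity_mul φ).toLp _)] with p h1 h2 h3 h4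
        rw [h1, RingHom.id_apply, h4, Pi.smul_apply, h2, h3, Pi.smul_apply, smul_eq_mul,
          smul_eq_mul, mul_left_comm] } 1 fun φ => by
    rw [one_mul]
    refine Lp.norm_le_norm_of_ae_le ?_
    filter_upwards [(memLp_velocity_mul φ).coeFn_toLp] with p hp
    change ‖(memLp_velocity_mul φ).toLp _ p‖ ≤ ‖φ p‖
    rw [hp, norm_mul, Complex.norm_real, Real.norm_eq_abs]
    exact mul_le_of_le_one_left (norm_nonneg _) (abs_velocity_le m p)

theorem velocityOp_ae (φ : StateSpace m T μ) :
    velocityOp m T μ φ =ᵐ[eqMeasure m T μ] fun p => ((velocity m p : ℝ) : ℂ) * φ p :=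
  (memLp_velocity_mul φ).coeFn_toLp

theorem norm_velocityOp_le (φ : StateSpace m T μ) : ‖velocityOp m T μ φ‖ ≤ ‖φ‖ := by
  refine Lp.norm_le_norm_of_ae_le ?_
  filter_upwards [velocityOp_ae φ] with p hp
  rw [hp, norm_mul, Complex.norm_real, Real.norm_eq_abs]
  exact mul_le_of_le_one_left (norm_nonneg _) (abs_velocity_le m p)

theorem velocityOp_symm (φ ψ : StateSpace m T μ) :
    ⟪velocityOp m T μ φ, ψ⟫_ℂ = ⟪φ, velocityOp m T μ ψ⟫_ℂ := by
  rw [L2.inner_def, L2.inner_def]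
  refine integral_congr_ae ?_
  filter_upwards [velocityOp_ae φ, velocityOp_ae ψ] with p h1 h2
  rw [h1, h2]
  simp only [RCLike.inner_apply, map_mul, Complex.conj_ofReal]
  ring

theorem compIso_velocityOp {L : Momentum ≃ₗᵢ[ℝ] Momentum} {s : ℝ}
    (hL : ∀ p, L p 0 = s * p 0) (φ : StateSpace m T μ) :
    compIso L (velocityOp m T μ φ) = (s : ℂ) • velocityOp m T μ (compIso L φ) := by
  refine Lp.ext ?_
  filter_upwards [compIso_eq_of_ae (L := L) (velocityOp_ae φ), velocityOp_ae (compIso L φ),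
    compIso_ae L φ, Lp.coeFn_smul (s : ℂ) (velocityOp m T μ (compIso L φ))] with p h1 h2 h3 h4
  have hv : velocity m (L p) = s * velocity m p := by
    simp only [velocity, energy, LinearIsometryEquiv.norm_map, hL]
    ring
  rw [h1, h4, Pi.smul_apply, h2, h3, hv, smul_eq_mul]
  push_cast
  ring

theorem rotOp_velocityOp (θ : ℝ) (φ : StateSpace m T μ) :
    rotOp m T μ θ (velocityOp m T μ φ) = velocityOp m T μ (rotOp m T μ θ φ) := by
  have h := compIso_velocityOp (m := m) (T := T) (μ := μ) (L := rotationIso θ) (s := 1)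
    (fun p => by rw [one_mul]; simp [rotationIso, rotation]) φ
  simpa [rotOp] using h

end MomentumSpace

section Basis

open scoped InnerProductSpace

variable {H : Type*} [NormedAddCommGroup H] [InnerProductSpace ℂ H]

/-! ### Diagonalization of the velocity on the kernel -/

/-- Vectors of opposite parity are orthogonal. -/
theorem inner_eq_zero_of_parity {R : H →ₗᵢ[ℂ] H} {x y : H} (hx : R x = x) (hy : R y = -y) :
    ⟪x, y⟫_ℂ = 0 := by
  have h := R.inner_map_map x y
  rw [hx, hy, inner_neg_right] at h
  linear_combination -(1 / 2 : ℂ) * h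

theorem norm_inv_smul_self {x : H} (hx : x ≠ 0) : ‖((‖x‖ : ℂ)⁻¹) • x‖ = 1 := by
  rw [norm_smul, norm_inv, Complex.norm_real, norm_norm, inv_mul_cancel₀ (norm_ne_zero_iff.2 hx)]

/-- The five conserved quantities have a basis of fixed spins that diagonalizes the compression of
the velocity. In the sector of spin zero the velocity exchanges the even functions `1`, `p⁰` and
the odd function `p¹`, which yields two sound waves with velocities `±c` and one mode at rest. -/
theorem exists_hydro_basis {U : ℝ → H →ₗᵢ[ℂ] H} {V : H →L[ℂ] H} {R : H →ₗᵢ[ℂ] H}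
    {one en p₁ q r : H} (hVsymm : ∀ x y, ⟪V x, y⟫_ℂ = ⟪x, V y⟫_ℂ)
    (hUV : ∀ θ x, U θ (V x) = V (U θ x)) (hRV : ∀ x, R (V x) = -V (R x))
    (hVen : V en = p₁) (hRone : R one = one) (hRen : R en = en) (hRp : R p₁ = -p₁)
    (hRq : R q = -q) (hRr : R r = -r) (hUone : IsSpin U 0 one) (hUen : IsSpin U 0 en)
    (hUp : IsSpin U 0 p₁) (hUq : IsSpin U 1 q) (hUr : IsSpin U (-1) r) (hp : p₁ ≠ 0)
    (hq : q ≠ 0) (hr : r ≠ 0) (hind : ∀ a b : ℂ, a • one + b • en = 0 → a = 0) :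
    ∃ (e : Fin 5 → H) (lam : Fin 5 → ℂ), Orthonormal ℂ e ∧
      (∀ i, IsSpin U ((![0, 0, 0, 1, -1] : Fin 5 → ℤ) i) (e i)) ∧
      (∀ i, spanProj e (V (e i)) = lam i • e i) ∧
      (∀ i j, lam i = lam j → (![0, 0, 0, 1, -1] : Fin 5 → ℤ) i =
        (![0, 0, 0, 1, -1] : Fin 5 → ℤ) j → i = j) ∧
      Submodule.span ℂ (Set.range e) = Submodule.span ℂ (Set.range ![one, en, p₁, q, r]) := by
  have hspinV : ∀ {σ : ℤ} {x : H}, IsSpin U σ x → IsSpin U σ (V x) := fun hx => hx.map hUV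
  -- the projection `w` of `V p₁` onto the even sector
  set E : Submodule ℂ H := Submodule.span ℂ {one, en} with hE
  have hEfin : FiniteDimensional ℂ E := FiniteDimensional.span_of_finite ℂ (by simp)
  set w : H := E.starProjection (V p₁) with hw
  have hwE : w ∈ E := E.starProjection_apply_mem _
  obtain ⟨a, b, hab⟩ := Submodule.mem_span_pair.1 hwE
  have hRE : ∀ a b : ℂ, R (a • one + b • en) = a • one + b • en := fun a b => by
    rw [map_add, map_smul, map_smul, hRone, hRen]
  have hUE : ∀ a b : ℂ, IsSpin U 0 (a • one + b • en) := fun a b =>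
    (hUone.smul a).add (hUen.smul b)
  have hRw : R w = w := by rw [← hab, hRE]
  have hUw : IsSpin U 0 w := hab ▸ hUE a b
  have hperp : ∀ x ∈ E, ⟪x, V p₁ - w⟫_ℂ = 0 := fun x hx =>
    Submodule.inner_right_of_mem_orthogonal hx (E.sub_starProjection_mem_orthogonal _)
  have hone : one ∈ E := Submodule.subset_span (by simp)
  have hen : en ∈ E := Submodule.subset_span (by simp)
  have henw : ⟪en, w⟫_ℂ = ((‖p₁‖ ^ 2 : ℝ) : ℂ) := by
    have h1 := hperp en hen
    rw [inner_sub_right, ← hVsymm, hVen, inner_self_eq_norm_sq_to_K, sub_eq_zero] at h1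
    rw [← h1]; push_cast; rfl
  have hp0 : ‖p₁‖ ≠ 0 := norm_ne_zero_iff.2 hp
  have hpC : (‖p₁‖ : ℂ) ≠ 0 := by exact_mod_cast hp0
  have henw0 : ⟪en, w⟫_ℂ ≠ 0 := by rw [henw]; exact_mod_cast pow_ne_zero 2 hp0
  have hw0 : w ≠ 0 := fun h => henw0 (by rw [h, inner_zero_right])
  have hwn0 : ‖w‖ ≠ 0 := norm_ne_zero_iff.2 hw0
  have hwC : (‖w‖ : ℂ) ≠ 0 := by exact_mod_cast hwn0
  -- the even vector orthogonal to `w`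
  set n : H := ⟪w, en⟫_ℂ • one + (-⟪w, one⟫_ℂ) • en with hn
  have hnE : n ∈ E := add_mem (E.smul_mem _ hone) (E.smul_mem _ hen)
  have hRn : R n = n := hRE _ _
  have hUn : IsSpin U 0 n := hUE _ _
  have hwn : ⟪w, n⟫_ℂ = 0 := by
    rw [hn, inner_add_right, inner_smul_right, inner_smul_right]; ring
  have hn0 : n ≠ 0 := fun h => henw0 (by
    rw [← inner_conj_symm, hind _ _ h, map_zero])
  -- membership in the orthogonal complement of the kernel, tested on the five spanning vectors
  set K := Submodule.span ℂ (Set.range ![one, en, p₁, q, r]) with hK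
  have hKone : one ∈ K := Submodule.subset_span ⟨0, rfl⟩
  have hKen : en ∈ K := Submodule.subset_span ⟨1, rfl⟩
  have hKp : p₁ ∈ K := Submodule.subset_span ⟨2, rfl⟩
  have hKq : q ∈ K := Submodule.subset_span ⟨3, rfl⟩
  have hKr : r ∈ K := Submodule.subset_span ⟨4, rfl⟩
  have hEK : E ≤ K := Submodule.span_le.2 (by
    rintro x (rfl | rfl)
    exacts [hKone, hKen])
  have hKperp : ∀ v : H, ⟪one, v⟫_ℂ = 0 → ⟪en, v⟫_ℂ = 0 → ⟪p₁, v⟫_ℂ = 0 → ⟪q, v⟫_ℂ = 0 →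
      ⟪r, v⟫_ℂ = 0 → v ∈ Kᗮ := fun v h1 h2 h3 h4 h5 => by
    rw [hK, Submodule.mem_orthogonal]
    intro u hu
    induction hu using Submodule.span_induction with
    | mem x hx =>
      obtain ⟨i, rfl⟩ := hx
      fin_cases i
      exacts [h1, h2, h3, h4, h5]
    | zero => exact inner_zero_left _
    | add x y _ _ hx hy => rw [inner_add_left, hx, hy, add_zero]
    | smul c x _ hx => rw [inner_smul_left, hx, mul_zero]
  have hodd : ∀ {x y : H}, R x = -x → R y = y → ⟪x, y⟫_ℂ = 0 := fun hx hy =>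
    inner_eq_zero_symm.1 (inner_eq_zero_of_parity hy hx)
  have hRVp : R (V p₁) = V p₁ := by rw [hRV, hRp, map_neg, neg_neg]
  have hRVw : R (V w) = -V w := by rw [hRV, hRw]
  have hRVn : R (V n) = -V n := by rw [hRV, hRn]
  have hRVq : R (V q) = V q := by rw [hRV, hRq, map_neg, neg_neg]
  have hRVr : R (V r) = V r := by rw [hRV, hRr, map_neg, neg_neg]
  set α : ℂ := (‖p₁‖ : ℂ) with hα
  set β : ℂ := (‖w‖ : ℂ) with hβ
  have z₁ : V p₁ - w ∈ Kᗮ := by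
    have h : R (V p₁ - w) = V p₁ - w := by rw [map_sub, hRVp, hRw]
    exact hKperp _ (hperp _ hone) (hperp _ hen) (hodd hRp h) (hodd hRq h) (hodd hRr h)
  have z₂ : V w - (β ^ 2 / α ^ 2) • p₁ ∈ Kᗮ := by
    have h : R (V w - (β ^ 2 / α ^ 2) • p₁) = -(V w - (β ^ 2 / α ^ 2) • p₁) := by
      rw [map_sub, hRVw, map_smul, hRp]; module
    have hs : IsSpin U 0 (V w - (β ^ 2 / α ^ 2) • p₁) := (hspinV hUw).sub (hUp.smul _)
    refine hKperp _ (inner_eq_zero_of_parity hRone h) (inner_eq_zero_of_parity hRen h) ?_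
      (hUq.inner_eq_zero hs (by decide)) (hUr.inner_eq_zero hs (by decide))
    have h1 : ⟪V p₁, w⟫_ℂ = ⟪w, w⟫_ℂ := by
      have := inner_eq_zero_symm.1 (hperp w hwE)
      rwa [inner_sub_left, sub_eq_zero] at this
    rw [inner_sub_right, ← hVsymm, h1, inner_smul_right, inner_self_eq_norm_sq_to_K,
      inner_self_eq_norm_sq_to_K]
    change β ^ 2 - β ^ 2 / α ^ 2 * α ^ 2 = 0
    field_simp
    ring
  have z₃ : V n ∈ Kᗮ := by
    refine hKperp _ (inner_eq_zero_of_parity hRone hRVn) (inner_eq_zero_of_parity hRen hRVn) ?_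
      (hUq.inner_eq_zero (hspinV hUn) (by decide)) (hUr.inner_eq_zero (hspinV hUn) (by decide))
    have := inner_eq_zero_symm.1 (hperp n hnE)
    rw [inner_sub_left, hwn, sub_zero] at this
    rw [← hVsymm, this]
  have z₄ : V q ∈ Kᗮ := hKperp _ (hUone.inner_eq_zero (hspinV hUq) (by decide))
    (hUen.inner_eq_zero (hspinV hUq) (by decide)) (hodd hRp hRVq) (hodd hRq hRVq) (hodd hRr hRVq)
  have z₅ : V r ∈ Kᗮ := hKperp _ (hUone.inner_eq_zero (hspinV hUr) (by decide))
    (hUen.inner_eq_zero (hspinV hUr) (by decide)) (hodd hRp hRVr) (hodd hRq hRVr) (hodd hRr hRVr)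
  -- the normalized vectors
  set f : H := α⁻¹ • p₁ with hf
  set g : H := β⁻¹ • w with hg
  set s : ℂ := ((Real.sqrt 2 : ℝ) : ℂ)⁻¹ with hs
  have hss : s * s * 2 = 1 := by
    have : ((Real.sqrt 2 : ℝ) : ℂ) * ((Real.sqrt 2 : ℝ) : ℂ) = 2 := by
      rw [← Complex.ofReal_mul, Real.mul_self_sqrt (by norm_num)]; norm_num
    rw [hs, ← mul_inv, this]; norm_num
  have hsconj : starRingEnd ℂ s = s := by rw [hs, map_inv₀, Complex.conj_ofReal]
  have hself : ∀ x : H, ‖x‖ = 1 → ⟪x, x⟫_ℂ = 1 := fun x hx => by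
    rw [inner_self_eq_norm_sq_to_K, hx]; simp
  have hff : ⟪f, f⟫_ℂ = 1 := hself _ (norm_inv_smul_self hp)
  have hgg : ⟪g, g⟫_ℂ = 1 := hself _ (norm_inv_smul_self hw0)
  have hRf : R f = -f := by rw [hf, map_smul, hRp, smul_neg]
  have hRg : R g = g := by rw [hg, map_smul, hRw]
  have hfg : ⟪f, g⟫_ℂ = 0 := hodd hRf hRg
  have hgf : ⟪g, f⟫_ℂ = 0 := inner_eq_zero_of_parity hRg hRf
  set h₁ : H := s • (f + g) with hh₁
  set h₂ : H := s • (f - g) with hh₂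
  set h₃ : H := ((‖n‖ : ℂ)⁻¹) • n with hh₃
  set h₄ : H := ((‖q‖ : ℂ)⁻¹) • q with hh₄
  set h₅ : H := ((‖r‖ : ℂ)⁻¹) • r with hh₅
  have sf : IsSpin U 0 f := hUp.smul _
  have sg : IsSpin U 0 g := hUw.smul _
  have s₁ : IsSpin U 0 h₁ := (sf.add sg).smul _
  have s₂ : IsSpin U 0 h₂ := (sf.sub sg).smul _
  have s₃ : IsSpin U 0 h₃ := hUn.smul _
  have s₄ : IsSpin U 1 h₄ := hUq.smul _
  have s₅ : IsSpin U (-1) h₅ := hUr.smul _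
  have hR₃ : R h₃ = h₃ := by rw [hh₃, map_smul, hRn]
  have hf₃ : ⟪f, h₃⟫_ℂ = 0 := hodd hRf hR₃
  have hg₃ : ⟪g, h₃⟫_ℂ = 0 := by
    rw [hg, hh₃, inner_smul_left, inner_smul_right, hwn, mul_zero, mul_zero]
  have o₁₁ : ⟪h₁, h₁⟫_ℂ = 1 := by
    simp only [hh₁, inner_smul_left, inner_smul_right, inner_add_left, inner_add_right, hff, hgg,
      hfg, hgf, hsconj]
    linear_combination hss
  have o₂₂ : ⟪h₂, h₂⟫_ℂ = 1 := by
    simp only [hh₂, inner_smul_left, inner_smul_right, inner_sub_left, inner_sub_right, hff, hgg,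
      hfg, hgf, hsconj]
    linear_combination hss
  have o₁₂ : ⟪h₁, h₂⟫_ℂ = 0 := by
    simp only [hh₁, hh₂, inner_smul_left, inner_smul_right, inner_add_left, inner_sub_right, hff,
      hgg, hfg, hgf, hsconj]
    ring
  have o₁₃ : ⟪h₁, h₃⟫_ℂ = 0 := by
    rw [hh₁, inner_smul_left, inner_add_left, hf₃, hg₃, add_zero, mul_zero]
  have o₂₃ : ⟪h₂, h₃⟫_ℂ = 0 := by
    rw [hh₂, inner_smul_left, inner_sub_left, hf₃, hg₃, sub_zero, mul_zero]
  have o₃₃ : ⟪h₃, h₃⟫_ℂ = 1 := hself _ (norm_inv_smul_self hn0)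
  have o₄₄ : ⟪h₄, h₄⟫_ℂ = 1 := hself _ (norm_inv_smul_self hq)
  have o₅₅ : ⟪h₅, h₅⟫_ℂ = 1 := hself _ (norm_inv_smul_self hr)
  set e : Fin 5 → H := ![h₁, h₂, h₃, h₄, h₅] with he
  have horth : Orthonormal ℂ e := by
    rw [orthonormal_iff_ite]
    intro i j
    fin_cases i <;> fin_cases j
    exacts [o₁₁, o₁₂, o₁₃, s₁.inner_eq_zero s₄ (by decide), s₁.inner_eq_zero s₅ (by decide),
      inner_eq_zero_symm.1 o₁₂, o₂₂, o₂₃, s₂.inner_eq_zero s₄ (by decide),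
      s₂.inner_eq_zero s₅ (by decide), inner_eq_zero_symm.1 o₁₃, inner_eq_zero_symm.1 o₂₃, o₃₃,
      s₃.inner_eq_zero s₄ (by decide), s₃.inner_eq_zero s₅ (by decide),
      s₄.inner_eq_zero s₁ (by decide), s₄.inner_eq_zero s₂ (by decide),
      s₄.inner_eq_zero s₃ (by decide), o₄₄, s₄.inner_eq_zero s₅ (by decide),
      s₅.inner_eq_zero s₁ (by decide), s₅.inner_eq_zero s₂ (by decide),
      s₅.inner_eq_zero s₃ (by decide), s₅.inner_eq_zero s₄ (by decide), o₅₅]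
  have heK : ∀ i, e i ∈ K := by
    have kf : f ∈ K := K.smul_mem _ hKp
    have kg : g ∈ K := K.smul_mem _ (hEK hwE)
    intro i
    fin_cases i
    exacts [K.smul_mem _ (add_mem kf kg), K.smul_mem _ (sub_mem kf kg),
      K.smul_mem _ (hEK hnE), K.smul_mem _ hKq, K.smul_mem _ hKr]
  have hspan : Submodule.span ℂ (Set.range e) = K := by
    have hKfin : FiniteDimensional ℂ K := FiniteDimensional.span_of_finite ℂ (Set.finite_range _)
    refine Submodule.eq_of_le_of_finrank_le ?_ ?_
    · rw [Submodule.span_le]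
      rintro _ ⟨i, rfl⟩
      exact heK i
    · rw [finrank_span_eq_card horth.linearIndependent]
      exact finrank_range_le_card _
  -- a vector `v` with `V (e i) - v` orthogonal to the kernel is the compression of `V` at `e i`
  have hcomp : ∀ i (c : ℂ), V (e i) - c • e i ∈ Kᗮ → spanProj e (V (e i)) = c • e i := by
    intro i c hz
    have h1 : ∀ j, ⟪e j, V (e i)⟫_ℂ = c * ⟪e j, e i⟫_ℂ := fun j => by
      have h2 := Submodule.inner_right_of_mem_orthogonal (heK j) hz
      rwa [inner_sub_right, inner_smul_right, sub_eq_zero] at h2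
    rw [spanProj_apply]
    simp only [h1, orthonormal_iff_ite.1 horth]
    simp
  have hcne : β / α ≠ 0 := div_ne_zero hwC hpC
  have y₁ : V f - (β / α) • g ∈ Kᗮ := by
    have : V f - (β / α) • g = α⁻¹ • (V p₁ - w) := by
      rw [hf, hg, map_smul, smul_smul, smul_sub]
      congr 2
      field_simp
    rw [this]
    exact Submodule.smul_mem _ _ z₁
  have y₂ : V g - (β / α) • f ∈ Kᗮ := by
    have : V g - (β / α) • f = β⁻¹ • (V w - (β ^ 2 / α ^ 2) • p₁) := by
      rw [hf, hg, map_smul, smul_smul, smul_sub, smul_smul]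
      congr 2
      field_simp
    rw [this]
    exact Submodule.smul_mem _ _ z₂
  refine ⟨e, ![β / α, -(β / α), 0, 0, 0], horth, ?_, ?_, ?_, hspan⟩
  · intro i
    fin_cases i
    exacts [s₁, s₂, s₃, s₄, s₅]
  · intro i
    refine hcomp i _ ?_
    fin_cases i
    · change V h₁ - (β / α) • h₁ ∈ Kᗮ
      have : V h₁ - (β / α) • h₁ = s • ((V f - (β / α) • g) + (V g - (β / α) • f)) := by
        rw [hh₁, map_smul, map_add]; module
      rw [this]
      exact Submodule.smul_mem _ _ (add_mem y₁ y₂)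
    · change V h₂ - (-(β / α)) • h₂ ∈ Kᗮ
      have : V h₂ - (-(β / α)) • h₂ = s • ((V f - (β / α) • g) - (V g - (β / α) • f)) := by
        rw [hh₂, map_smul, map_sub]; module
      rw [this]
      exact Submodule.smul_mem _ _ (sub_mem y₁ y₂)
    · change V h₃ - (0 : ℂ) • h₃ ∈ Kᗮ
      rw [zero_smul, sub_zero, hh₃, map_smul]
      exact Submodule.smul_mem _ _ z₃
    · change V h₄ - (0 : ℂ) • h₄ ∈ Kᗮ
      rw [zero_smul, sub_zero, hh₄, map_smul]
      exact Submodule.smul_mem _ _ z₄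
    · change V h₅ - (0 : ℂ) • h₅ ∈ Kᗮ
      rw [zero_smul, sub_zero, hh₅, map_smul]
      exact Submodule.smul_mem _ _ z₅
  · have hne : β / α ≠ -(β / α) := fun h => hcne (by linear_combination (1 / 2 : ℂ) * h)
    intro i j hl hs
    fin_cases i <;> fin_cases j <;>
      first
      | rfl
      | exact absurd hs (by decide)
      | exact absurd hl hne
      | exact absurd hl hne.symm
      | exact absurd hl hcne
      | exact absurd hl hcne.symm
      | exact absurd hl (neg_ne_zero.2 hcne)
      | exact absurd hl (neg_ne_zero.2 hcne).symm

end Basis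

section Abstract

open scoped InnerProductSpace

/-! ### Modes of a symmetric operator -/

/-- The reduced resolvent inherits the symmetries of the operator. -/
theorem comm_reducedResolvent {H : Type*} [NormedAddCommGroup H] [InnerProductSpace ℂ H]
    {F : H →ₗ.[ℂ] H} {K : Submodule ℂ H} [K.HasOrthogonalProjection] {S : H →L[ℂ] H}
    (hSK : ∀ x ∈ K, S x = 0) (hS : ∀ x, S x ∈ Kᗮ)
    (hgraph : ∀ φ y, (∃ h : φ ∈ F.domain, F ⟨φ, h⟩ = y) ↔ y ∈ Kᗮ ∧ ∃ a ∈ K, φ = a + S y)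
    {U : H →ₗᵢ[ℂ] H} (hUK : ∀ a ∈ K, U a ∈ K) (hUK' : ∀ y ∈ Kᗮ, U y ∈ Kᗮ)
    (hUF : ∀ φ : F.domain, ∃ h : U φ ∈ F.domain, F ⟨U φ, h⟩ = U (F φ)) (x : H) :
    U (S x) = S (U x) := by
  have key : ∀ y ∈ Kᗮ, U (S y) = S (U y) := fun y hy => by
    obtain ⟨h, hF⟩ := (hgraph (S y) y).2 ⟨hy, 0, zero_mem _, (zero_add _).symm⟩
    obtain ⟨h', hF'⟩ := hUF ⟨S y, h⟩
    rw [hF] at hF'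
    obtain ⟨-, a, ha, hUS⟩ := (hgraph _ _).1 ⟨h', hF'⟩
    have ha' : a ∈ Kᗮ := by
      have : a = U (S y) - S (U y) := by rw [hUS]; abel
      rw [this]
      exact sub_mem (hUK' _ (hS y)) (hS _)
    have h0 : a = 0 := inner_self_eq_zero.1 (Submodule.inner_right_of_mem_orthogonal ha ha')
    rw [hUS, h0, zero_add]
  have hsplit : x = K.starProjection x + (x - K.starProjection x) := by abel
  have h1 := key _ (K.sub_starProjection_mem_orthogonal x)
  have hP := K.starProjection_apply_mem x
  rw [hsplit, map_add S, hSK _ hP, zero_add, h1, map_add U, map_add S, hSK _ (hUK _ hP), zero_add]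

/-- The equation of motion recovers `x = P φ + (z - i k V) φ` from the mode `φ = (P + S) x`, so the
spin of a mode is that of the solution of the pencil. -/
theorem IsModeProblem.isSpin_of_mode {H : Type*} [NormedAddCommGroup H] [InnerProductSpace ℂ H]
    {ι : Type*} [Fintype ι] {U : ℝ → H →ₗᵢ[ℂ] H} {V S : H →L[ℂ] H} {e : ι → H} {spin : ι → ℤ}
    {τ : ℝ} (h : IsModeProblem U V S e spin τ) {σ : ℤ} {k z : ℂ} {x : H}
    (hx : modeOp V S e k z x = 0) (hs : IsSpin U σ (spanProj e x + S x)) : IsSpin U σ x := by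
  set φ := spanProj e x + S x with hφ
  have h1 : spanProj e φ = spanProj e x := by
    rw [hφ, map_add, h.spanProj_spanProj, h.spanProj_S, add_zero]
  have h2 : x = spanProj e φ + (z • φ - (Complex.I * k) • V φ) := by
    rw [modeOp_apply, ← hφ] at hx
    rw [h1, ← sub_eq_zero, ← hx]
    abel
  rw [h2]
  exact (hs.map h.comm_spanProj).add ((hs.smul z).sub ((hs.map h.comm_V).smul _))

theorem IsModeProblem.isSpin_mode {H : Type*} [NormedAddCommGroup H] [InnerProductSpace ℂ H]
    {ι : Type*} [Fintype ι] {U : ℝ → H →ₗᵢ[ℂ] H} {V S : H →L[ℂ] H} {e : ι → H} {spin : ι → ℤ}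
    {τ : ℝ} (h : IsModeProblem U V S e spin τ) {σ : ℤ} {x : H} (hs : IsSpin U σ x) :
    IsSpin U σ (spanProj e x + S x) :=
  (hs.map h.comm_spanProj).add (hs.map h.comm_S)

theorem mem_orthogonal_span_range_iff {H : Type*} [NormedAddCommGroup H] [InnerProductSpace ℂ H]
    {ι : Type*} {e : ι → H} {y : H} :
    y ∈ (Submodule.span ℂ (Set.range e))ᗮ ↔ ∀ i, ⟪e i, y⟫_ℂ = 0 := by
  refine ⟨fun hy i => Submodule.inner_right_of_mem_orthogonal
      (Submodule.subset_span (Set.mem_range_self i)) hy,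
    fun hy => ?_⟩
  rw [Submodule.mem_orthogonal]
  intro u hu
  induction hu using Submodule.span_induction with
  | mem x hx => obtain ⟨i, rfl⟩ := hx; exact hy i
  | zero => exact inner_zero_left _
  | add x y _ _ hx hy => rw [inner_add_left, hx, hy, add_zero]
  | smul c x _ hx => rw [inner_smul_left, hx, mul_zero]

theorem spanProj_of_mem_span {H : Type*} [NormedAddCommGroup H] [InnerProductSpace ℂ H]
    {ι : Type*} [Fintype ι] {e : ι → H} (he : Orthonormal ℂ e) {a : H}
    (ha : a ∈ Submodule.span ℂ (Set.range e)) : spanProj e a = a := by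
  obtain ⟨c, rfl⟩ := (Submodule.mem_span_range_iff_exists_fun ℂ).1 ha
  rw [spanProj_apply]
  simp only [he.inner_right_fintype]

/-- A symmetric operator with a spectral gap above its finite-dimensional kernel defines a mode
problem, and the modes are the kernel vectors of the pencil. -/
theorem exists_isModeProblem_of_symmetric {H : Type*} [NormedAddCommGroup H]
    [InnerProductSpace ℂ H] [CompleteSpace H] {ι : Type*} [Fintype ι] {F : H →ₗ.[ℂ] H}
    {U : ℝ → H →ₗᵢ[ℂ] H} {V : H →L[ℂ] H} {e : ι → H} {spin : ι → ℤ} {τ : ℝ} (hτ : 0 < τ)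
    (he : Orthonormal ℂ e) (hspin : ∀ i, IsSpin U (spin i) (e i))
    (hUV : ∀ θ x, U θ (V x) = V (U θ x)) (hV : ∀ x, ‖V x‖ ≤ ‖x‖)
    (hsymm : ∀ φ ψ : F.domain, ⟪F φ, (ψ : H)⟫_ℂ = ⟪(φ : H), F ψ⟫_ℂ)
    (hker : ∀ a ∈ Submodule.span ℂ (Set.range e), ∃ h : a ∈ F.domain, F ⟨a, h⟩ = 0)
    (hUF : ∀ θ (φ : F.domain), ∃ h : U θ φ ∈ F.domain, F ⟨U θ φ, h⟩ = U θ (F φ))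
    (hgap : IsGLB {x : ℝ | (x : ℂ) ∈ spectrumOn F (Submodule.span ℂ (Set.range e))ᗮ} (1 / τ)) :
    ∃ S : H →L[ℂ] H, IsModeProblem U V S e spin τ ∧
      ∀ k z φ, (∃ h : φ ∈ F.domain, F ⟨φ, h⟩ + (Complex.I * k) • V φ = z • φ) ↔
        ∃ x, φ = spanProj e x + S x ∧ modeOp V S e k z x = 0 := by
  have hfin : FiniteDimensional ℂ (Submodule.span ℂ (Set.range e)) :=
    FiniteDimensional.span_of_finite ℂ (Set.finite_range _)
  set K := Submodule.span ℂ (Set.range e) with hK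
  have heK : ∀ i, e i ∈ K := fun i => Submodule.subset_span ⟨i, rfl⟩
  obtain ⟨S, hSK, hS, hSb, hgraph⟩ := exists_reducedResolvent hsymm hker hτ hgap
  have hUK : ∀ θ, ∀ a ∈ K, U θ a ∈ K := fun θ a ha => by
    obtain ⟨c, rfl⟩ := (Submodule.mem_span_range_iff_exists_fun ℂ).1 ha
    rw [map_sum]
    refine sum_mem fun i _ => ?_
    rw [map_smul, hspin i θ]
    exact K.smul_mem _ (K.smul_mem _ (heK i))
  have hUK' : ∀ θ, ∀ y ∈ Kᗮ, U θ y ∈ Kᗮ := fun θ y hy => by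
    rw [hK, mem_orthogonal_span_range_iff] at hy ⊢
    intro i
    have h1 := (U θ).inner_map_map (e i) y
    rw [hspin i θ, inner_smul_left, hy i] at h1
    exact (mul_eq_zero.1 h1).resolve_left ((map_ne_zero _).2 (Complex.exp_ne_zero _))
  have hprob : IsModeProblem U V S e spin τ :=
    { tau_pos := hτ
      orthonormal := he
      spin_e := hspin
      comm_V := hUV
      comm_S := fun θ => comm_reducedResolvent hSK hS hgraph (hUK θ) (hUK' θ) (hUF θ)
      norm_V := hV
      S_e := fun i => hSK _ (heK i)
      inner_S := fun i x => mem_orthogonal_span_range_iff.1 (hS x) i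
      S_bound := hSb }
  refine ⟨S, hprob, fun k z φ => ⟨?_, ?_⟩⟩
  · rintro ⟨h, hφ⟩
    obtain ⟨hy, a, ha, hφa⟩ := (hgraph φ (F ⟨φ, h⟩)).1 ⟨h, rfl⟩
    generalize F ⟨φ, h⟩ = y at hφ hy hφa
    have hPy : spanProj e y = 0 := hprob.spanProj_eq_zero.2 (mem_orthogonal_span_range_iff.1 hy)
    have hP : spanProj e (a + y) = a := by
      rw [map_add, spanProj_of_mem_span he ha, hPy, add_zero]
    have hSx : S (a + y) = S y := by rw [map_add, hSK a ha, zero_add]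
    refine ⟨a + y, by rw [hP, hSx, ← hφa], ?_⟩
    rw [modeOp_apply, hP, hSx, ← hφa, add_sub_cancel_left, ← add_sub_assoc, hφ, sub_self]
  · rintro ⟨x, rfl, hx⟩
    have hy : x - spanProj e x ∈ Kᗮ := mem_orthogonal_span_range_iff.2 (hprob.inner_e_sub x)
    have hSy : S (x - spanProj e x) = S x := by
      rw [map_sub, hprob.S_spanProj, sub_zero]
    have hPK : spanProj e x ∈ K := by
      rw [spanProj_apply]
      exact sum_mem fun i _ => K.smul_mem _ (heK i)
    obtain ⟨h, hFx⟩ := (hgraph (spanProj e x + S x) (x - spanProj e x)).2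
      ⟨hy, spanProj e x, hPK, by rw [hSy]⟩
    refine ⟨h, ?_⟩
    rw [hFx]
    rw [modeOp_apply, ← add_sub_assoc] at hx
    exact sub_eq_zero.1 hx

end Abstract

section Concrete

open scoped InnerProductSpace

variable {m T μ : ℝ}

/-! ### The conserved quantities -/

theorem exists_state (m : ℝ) {T : ℝ} (hT : 0 < T) (μ : ℝ) {f : Momentum → ℂ} (hf : Continuous f)
    {C : ℝ} (hC : ∀ p, ‖f p‖ ≤ C * (1 + ‖p‖)) :
    ∃ φ : StateSpace m T μ, φ =ᵐ[eqMeasure m T μ] f :=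
  ⟨(memLp_of_linear_growth m hT μ hf hC).toLp f, MemLp.coeFn_toLp _⟩

/-- The basis of `exists_hydro_basis` for the span of `1, p⁰, p¹, p², p³`. -/
theorem exists_basis_hydro (m : ℝ) {T : ℝ} (hT : 0 < T) (μ : ℝ) :
    ∃ (e : Fin 5 → StateSpace m T μ) (lam : Fin 5 → ℂ), Orthonormal ℂ e ∧
      (∀ i, IsSpin (rotOp m T μ) ((![0, 0, 0, 1, -1] : Fin 5 → ℤ) i) (e i)) ∧
      (∀ i, spanProj e (velocityOp m T μ (e i)) = lam i • e i) ∧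
      (∀ i j, lam i = lam j → (![0, 0, 0, 1, -1] : Fin 5 → ℤ) i =
        (![0, 0, 0, 1, -1] : Fin 5 → ℤ) j → i = j) ∧
      Submodule.span ℂ (Set.range e) = hydro m T μ := by
  have hcoord : ∀ j : Fin 3, Continuous fun p : Momentum => ((p j : ℝ) : ℂ) := fun j => by fun_prop
  have henergy : Continuous fun p : Momentum => ((energy m p : ℝ) : ℂ) :=
    Complex.continuous_ofReal.comp (continuous_energy m)
  obtain ⟨one, hone⟩ := exists_state m hT μ (f := fun _ => (1 : ℂ)) continuous_const (C := 1)
    fun p => by simp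
  obtain ⟨en, hen⟩ := exists_state m hT μ henergy (C := 1 + |m|) fun p => by
    rw [Complex.norm_real, Real.norm_of_nonneg (energy_nonneg m p)]
    nlinarith [energy_le m p, norm_nonneg p, abs_nonneg m,
      mul_nonneg (abs_nonneg m) (norm_nonneg p)]
  have hmom : ∀ j : Fin 3, ∃ φ : StateSpace m T μ,
      φ =ᵐ[eqMeasure m T μ] fun p => ((p j : ℝ) : ℂ) := fun j =>
    exists_state m hT μ (hcoord j) (C := 1) fun p => by
      rw [Complex.norm_real, Real.norm_eq_abs]
      linarith [abs_coord_le p j]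
  choose mom hmom using hmom
  -- parity and rotations of the conserved quantities
  set R : StateSpace m T μ →ₗᵢ[ℂ] StateSpace m T μ := compIso (LinearIsometryEquiv.neg ℝ) with hR
  have hRone : R one = one := Lp.ext ((compIso_eq_of_ae hone).trans hone.symm)
  have hRen : R en = en := by
    refine Lp.ext ?_
    filter_upwards [compIso_eq_of_ae (L := LinearIsometryEquiv.neg ℝ) hen, hen] with p h1 h2
    rw [hR, h1, h2]
    simp only [energy, LinearIsometryEquiv.norm_map]
  have hRmom : ∀ j, R (mom j) = -mom j := fun j => by
    refine Lp.ext ?_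
    filter_upwards [compIso_eq_of_ae (L := LinearIsometryEquiv.neg ℝ) (hmom j), hmom j,
      Lp.coeFn_neg (mom j)] with p h1 h2 h3
    rw [hR, h1, h3, Pi.neg_apply, h2]
    simp
  have hUone : IsSpin (rotOp m T μ) 0 one := fun θ => by
    rw [Int.cast_zero, mul_zero, zero_mul, Complex.exp_zero, one_smul]
    exact Lp.ext ((compIso_eq_of_ae hone).trans hone.symm)
  have hUen : IsSpin (rotOp m T μ) 0 en := fun θ => by
    rw [Int.cast_zero, mul_zero, zero_mul, Complex.exp_zero, one_smul]
    refine Lp.ext ?_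
    filter_upwards [compIso_eq_of_ae (L := rotationIso θ) hen, hen] with p h1 h2
    rw [rotOp, h1, h2]
    simp only [energy, LinearIsometryEquiv.norm_map]
  have hUmom₀ : IsSpin (rotOp m T μ) 0 (mom 0) := fun θ => by
    rw [Int.cast_zero, mul_zero, zero_mul, Complex.exp_zero, one_smul]
    refine Lp.ext ?_
    filter_upwards [compIso_eq_of_ae (L := rotationIso θ) (hmom 0), hmom 0] with p h1 h2
    rw [rotOp, h1, h2]
    simp [rotationIso, rotation]
  have hUmom₁ : ∀ θ : ℝ, rotOp m T μ θ (mom 1) =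
      (Real.cos θ : ℂ) • mom 1 - (Real.sin θ : ℂ) • mom 2 := fun θ => by
    refine Lp.ext ?_
    filter_upwards [compIso_eq_of_ae (L := rotationIso θ) (hmom 1), hmom 1, hmom 2,
      Lp.coeFn_sub ((Real.cos θ : ℂ) • mom 1) ((Real.sin θ : ℂ) • mom 2),
      Lp.coeFn_smul (Real.cos θ : ℂ) (mom 1), Lp.coeFn_smul (Real.sin θ : ℂ) (mom 2)]
      with p h1 h2 h3 h4 h5 h6
    rw [rotOp, h1, h4, Pi.sub_apply, h5, h6, Pi.smul_apply, Pi.smul_apply, h2, h3]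
    simp [rotationIso, rotation]
  have hUmom₂ : ∀ θ : ℝ, rotOp m T μ θ (mom 2) =
      (Real.sin θ : ℂ) • mom 1 + (Real.cos θ : ℂ) • mom 2 := fun θ => by
    refine Lp.ext ?_
    filter_upwards [compIso_eq_of_ae (L := rotationIso θ) (hmom 2), hmom 1, hmom 2,
      Lp.coeFn_add ((Real.sin θ : ℂ) • mom 1) ((Real.cos θ : ℂ) • mom 2),
      Lp.coeFn_smul (Real.sin θ : ℂ) (mom 1), Lp.coeFn_smul (Real.cos θ : ℂ) (mom 2)]
      with p h1 h2 h3 h4 h5 h6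
    rw [rotOp, h1, h4, Pi.add_apply, h5, h6, Pi.smul_apply, Pi.smul_apply, h2, h3]
    simp [rotationIso, rotation]
  have hexp : ∀ θ : ℝ, Complex.exp (Complex.I * (θ : ℂ)) =
      (Real.cos θ : ℂ) + (Real.sin θ : ℂ) * Complex.I := fun θ => by
    rw [mul_comm, Complex.exp_mul_I, Complex.ofReal_cos, Complex.ofReal_sin]
  have hexp' : ∀ θ : ℝ, Complex.exp (Complex.I * -1 * (θ : ℂ)) =
      (Real.cos θ : ℂ) - (Real.sin θ : ℂ) * Complex.I := fun θ => by
    have : Complex.I * -1 * (θ : ℂ) = -(θ : ℂ) * Complex.I := by ring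
    rw [this, Complex.exp_mul_I, Complex.cos_neg, Complex.sin_neg, Complex.ofReal_cos,
      Complex.ofReal_sin]
    ring
  set q : StateSpace m T μ := mom 1 + Complex.I • mom 2 with hq
  set r : StateSpace m T μ := mom 1 - Complex.I • mom 2 with hr
  have hUq : IsSpin (rotOp m T μ) 1 q := fun θ => by
    rw [Int.cast_one, mul_one, hexp, hq, map_add, map_smul, hUmom₁, hUmom₂]
    have h1 : ((Real.cos θ : ℂ) + (Real.sin θ : ℂ) * Complex.I) * Complex.I =
        (Real.cos θ : ℂ) * Complex.I - (Real.sin θ : ℂ) := by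
      linear_combination (Real.sin θ : ℂ) * Complex.I_mul_I
    rw [smul_add _ (mom 1), smul_smul _ Complex.I, h1]
    module
  have hUr : IsSpin (rotOp m T μ) (-1) r := fun θ => by
    rw [Int.cast_neg, Int.cast_one, hexp', hr, map_sub, map_smul, hUmom₁, hUmom₂]
    have h1 : ((Real.cos θ : ℂ) - (Real.sin θ : ℂ) * Complex.I) * Complex.I =
        (Real.cos θ : ℂ) * Complex.I + (Real.sin θ : ℂ) := by
      linear_combination -(Real.sin θ : ℂ) * Complex.I_mul_I
    rw [smul_sub _ (mom 1), smul_smul _ Complex.I, h1]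
    module
  have hq_ae : q =ᵐ[eqMeasure m T μ] fun p => ((p 1 : ℝ) : ℂ) + Complex.I * ((p 2 : ℝ) : ℂ) := by
    filter_upwards [hmom 1, hmom 2, Lp.coeFn_add (mom 1) (Complex.I • mom 2),
      Lp.coeFn_smul Complex.I (mom 2)] with p h1 h2 h3 h4
    rw [hq, h3, Pi.add_apply, h4, Pi.smul_apply, h1, h2, smul_eq_mul]
  have hr_ae : r =ᵐ[eqMeasure m T μ] fun p => ((p 1 : ℝ) : ℂ) - Complex.I * ((p 2 : ℝ) : ℂ) := by
    filter_upwards [hmom 1, hmom 2, Lp.coeFn_sub (mom 1) (Complex.I • mom 2),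
      Lp.coeFn_smul Complex.I (mom 2)] with p h1 h2 h3 h4
    rw [hr, h3, Pi.sub_apply, h4, Pi.smul_apply, h1, h2, smul_eq_mul]
  have hne : ∀ {φ : StateSpace m T μ} {f : Momentum → ℂ}, Continuous f →
      φ =ᵐ[eqMeasure m T μ] f → ∀ p, f p ≠ 0 → φ ≠ 0 := by
    intro φ f hf hφ p hp h0
    have h1 : f =ᵐ[eqMeasure m T μ] fun _ => (0 : ℂ) :=
      hφ.symm.trans (h0 ▸ Lp.coeFn_zero ℂ 2 (eqMeasure m T μ))
    exact hp (congrFun (eq_of_ae_eq_eqMeasure hf continuous_const h1) p)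
  have hVen : velocityOp m T μ en = mom 0 := by
    refine Lp.ext ?_
    filter_upwards [velocityOp_ae en, hen, hmom 0] with p h1 h2 h3
    rw [h1, h2, h3, ← Complex.ofReal_mul, velocity_mul_energy]
  have hind : ∀ a b : ℂ, a • one + b • en = 0 → a = 0 := by
    intro a b hab
    have h1 : (fun p : Momentum => a * 1 + b * ((energy m p : ℝ) : ℂ)) =ᵐ[eqMeasure m T μ]
        fun _ => (0 : ℂ) := by
      filter_upwards [hone, hen, Lp.coeFn_add (a • one) (b • en), Lp.coeFn_smul a one,
        Lp.coeFn_smul b en, Lp.coeFn_zero ℂ 2 (eqMeasure m T μ)] with p h1 h2 h3 h4 h5 h6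
      rw [hab, Pi.add_apply, h4, h5, Pi.smul_apply, Pi.smul_apply, h1, h2] at h3
      rw [h6] at h3
      exact h3.symm
    have h2 := eq_of_ae_eq_eqMeasure (by fun_prop) continuous_const h1
    -- compare two momenta of different energies
    have h3 := congrFun h2 0
    have h4 := congrFun h2 (EuclideanSpace.single 0 (|m| + 1))
    have h5 : energy m 0 = |m| := by simp [energy, Real.sqrt_sq_eq_abs]
    have h6 : |m| < energy m (EuclideanSpace.single 0 (|m| + 1)) := by
      refine lt_of_lt_of_le ?_ (norm_le_energy m _)
      rw [PiLp.norm_single, Real.norm_of_nonneg (by positivity)]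
      linarith
    have h7 : b * ((energy m (EuclideanSpace.single 0 (|m| + 1)) - |m| : ℝ) : ℂ) = 0 := by
      rw [h5] at h3
      push_cast
      linear_combination h4 - h3
    have h8 : b = 0 := (mul_eq_zero.1 h7).resolve_right (by
      exact_mod_cast (sub_pos.2 h6).ne')
    rw [h8] at h3
    simpa using h3
  obtain ⟨e, lam, he, hs, hV, hinj, hspan⟩ := exists_hydro_basis (U := rotOp m T μ)
    (V := velocityOp m T μ) (R := R) (one := one) (en := en) (p₁ := mom 0) (q := q) (r := r)
    velocityOp_symm rotOp_velocityOp
    (fun x => by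
      have := compIso_velocityOp (L := LinearIsometryEquiv.neg ℝ) (s := -1) (fun p => by simp) x
      simpa using this)
    hVen hRone hRen (hRmom 0) (by rw [hq, map_add, map_smul, hRmom, hRmom]; module)
    (by rw [hr, map_sub, map_smul, hRmom, hRmom]; module) hUone hUen hUmom₀ hUq hUr
    (hne (hcoord 0) (hmom 0) (EuclideanSpace.single 0 1) (by simp))
    (hne (by fun_prop) hq_ae (EuclideanSpace.single 1 1) (by simp))
    (hne (by fun_prop) hr_ae (EuclideanSpace.single 1 1) (by simp)) hind
  refine ⟨e, lam, he, hs, hV, hinj, hspan.trans (le_antisymm ?_ ?_)⟩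
  · have k1 : one ∈ hydro m T μ := Submodule.subset_span (Or.inl hone)
    have k2 : en ∈ hydro m T μ := Submodule.subset_span (Or.inr (Or.inl hen))
    have k3 : ∀ j, mom j ∈ hydro m T μ := fun j =>
      Submodule.subset_span (Or.inr (Or.inr ⟨j, hmom j⟩))
    rw [Submodule.span_le]
    rintro _ ⟨i, rfl⟩
    fin_cases i
    exacts [k1, k2, k3 0, add_mem (k3 1) (Submodule.smul_mem _ _ (k3 2)),
      sub_mem (k3 1) (Submodule.smul_mem _ _ (k3 2))]
  · set K := Submodule.span ℂ (Set.range ![one, en, mom 0, q, r]) with hK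
    have kq : q ∈ K := Submodule.subset_span ⟨3, rfl⟩
    have kr : r ∈ K := Submodule.subset_span ⟨4, rfl⟩
    rw [hydro, Submodule.span_le]
    rintro φ (hφ | hφ | ⟨j, hφ⟩)
    · rw [Lp.ext (hφ.trans hone.symm)]
      exact Submodule.subset_span ⟨0, rfl⟩
    · rw [Lp.ext (hφ.trans hen.symm)]
      exact Submodule.subset_span ⟨1, rfl⟩
    · rw [Lp.ext (hφ.trans (hmom j).symm)]
      fin_cases j
      · exact Submodule.subset_span ⟨2, rfl⟩
      · have : mom 1 = (1 / 2 : ℂ) • (q + r) := by rw [hq, hr]; module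
        change mom 1 ∈ K
        rw [this]
        exact K.smul_mem _ (add_mem kq kr)
      · have : mom 2 = (-(Complex.I / 2)) • (q - r) := by
          have e1 : q - r = (2 * Complex.I) • mom 2 := by rw [hq, hr]; module
          rw [e1, smul_smul]
          have e2 : -(Complex.I / 2) * (2 * Complex.I) = 1 := by
            linear_combination -Complex.I_mul_I
          rw [e2, one_smul]
        change mom 2 ∈ K
        rw [this]
        exact K.smul_mem _ (sub_mem kq kr)

/-! ### The linearised collision operator -/

theorem rotOp_ae (θ : ℝ) (φ : StateSpace m T μ) :
    rotOp m T μ θ φ =ᵐ[eqMeasure m T μ] fun p => φ (rotation θ p) :=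
  compIso_ae (rotationIso θ) φ

theorem eq_rotOp_of_ae {θ : ℝ} {φ ψ : StateSpace m T μ}
    (h : ψ =ᵐ[eqMeasure m T μ] fun p => φ (rotation θ p)) : ψ = rotOp m T μ θ φ :=
  Lp.ext (h.trans (rotOp_ae θ φ).symm)

theorem IsCollisionOperator.rotOp_covariant {I₀ : StateSpace m T μ →ₗ.[ℂ] StateSpace m T μ}
    (hI₀ : IsCollisionOperator I₀) (θ : ℝ) (a : I₀.domain) : ∃ b : I₀.domain,
      (b : StateSpace m T μ) = rotOp m T μ θ a ∧ I₀ b = rotOp m T μ θ (I₀ a) := by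
  obtain ⟨b, h1, h2⟩ := hI₀.covariant θ a
  exact ⟨b, eq_rotOp_of_ae h1, eq_rotOp_of_ae h2⟩

theorem IsCollisionOperator.inner_symm {I₀ : StateSpace m T μ →ₗ.[ℂ] StateSpace m T μ}
    (hI₀ : IsCollisionOperator I₀) (x y : I₀.domain) :
    ⟪I₀ x, (y : StateSpace m T μ)⟫_ℂ = ⟪(x : StateSpace m T μ), I₀ y⟫_ℂ := by
  rw [← inner_conj_symm]
  exact hI₀.symmetric y x

theorem IsCollisionOperator.friedrichs_kernel {I₀ : StateSpace m T μ →ₗ.[ℂ] StateSpace m T μ}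
    (hI₀ : IsCollisionOperator I₀) {a : StateSpace m T μ} (ha : a ∈ hydro m T μ) :
    ∃ h : a ∈ (friedrichs I₀ hI₀.nonneg).domain, friedrichs I₀ hI₀.nonneg ⟨a, h⟩ = 0 := by
  obtain ⟨h, h0⟩ := (hI₀.kernel a).2 ha
  obtain ⟨h', h1⟩ := friedrichs_extends (hA := hI₀.nonneg) hI₀.dense hI₀.inner_symm ⟨a, h⟩
  exact ⟨h', h1.trans h0⟩

/-- The equation of motion as an equation in the Hilbert space. -/
theorem isMode_iff {I : StateSpace m T μ →ₗ.[ℂ] StateSpace m T μ} {k w : ℂ}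
    {φ : StateSpace m T μ} : IsMode I k w φ ↔ ∃ h : φ ∈ I.domain,
      I ⟨φ, h⟩ + (Complex.I * k) • velocityOp m T μ φ = (Complex.I * w) • φ := by
  refine exists_congr fun h => ?_
  generalize I ⟨φ, h⟩ = y
  have h1 : ∀ᵐ p ∂(eqMeasure m T μ),
      (y + (Complex.I * k) • velocityOp m T μ φ : StateSpace m T μ) p =
        y p + Complex.I * k * ((velocity m p : ℝ) : ℂ) * φ p := by
    filter_upwards [Lp.coeFn_add y ((Complex.I * k) • velocityOp m T μ φ),
      Lp.coeFn_smul (Complex.I * k) (velocityOp m T μ φ), velocityOp_ae φ] with p h1 h2 h3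
    rw [h1, Pi.add_apply, h2, Pi.smul_apply, h3, smul_eq_mul]
    ring
  have h2 := Lp.coeFn_smul (Complex.I * w) φ
  constructor
  · intro h3
    refine Lp.ext ?_
    filter_upwards [h1, h2, h3] with p e1 e2 e3
    rw [e1, e2, e3, Pi.smul_apply, smul_eq_mul]
  · intro h3
    rw [h3] at h1
    filter_upwards [h1, h2] with p e1 e2
    rw [← e1, e2, Pi.smul_apply, smul_eq_mul]

/-- The linearised kinetic equation is a mode problem. -/
theorem exists_isModeProblem {τ : ℝ} (hT : 0 < T)
    {I₀ I : StateSpace m T μ →ₗ.[ℂ] StateSpace m T μ} (hI₀ : IsCollisionOperator I₀)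
    (hI : I = friedrichs I₀ hI₀.nonneg) (hgap : HasGap I τ) :
    ∃ (e : Fin 5 → StateSpace m T μ) (lam : Fin 5 → ℂ)
      (S : StateSpace m T μ →L[ℂ] StateSpace m T μ),
      IsModeProblem (rotOp m T μ) (velocityOp m T μ) S e ![0, 0, 0, 1, -1] τ ∧
      (∀ i, spanProj e (velocityOp m T μ (e i)) = lam i • e i) ∧
      (∀ i j, lam i = lam j → (![0, 0, 0, 1, -1] : Fin 5 → ℤ) i =
        (![0, 0, 0, 1, -1] : Fin 5 → ℤ) j → i = j) ∧
      ∀ k w φ, IsMode I k w φ ↔ ∃ x, φ = spanProj e x + S x ∧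
        modeOp (velocityOp m T μ) S e k (Complex.I * w) x = 0 := by
  subst hI
  obtain ⟨e, lam, he, hspin, hV, hinj, hspan⟩ := exists_basis_hydro m hT μ
  have hgap' := hgap.2
  rw [nonHydro, ← hspan] at hgap'
  obtain ⟨S, hprob, hmode⟩ := exists_isModeProblem_of_symmetric
    (F := friedrichs I₀ hI₀.nonneg) hgap.1 he hspin rotOp_velocityOp norm_velocityOp_le
    (friedrichs_symmetric hI₀.dense hI₀.inner_symm)
    (fun a ha => hI₀.friedrichs_kernel (hspan ▸ ha))
    (fun θ => friedrichs_covariant hI₀.dense (rotOp_rotOp_neg θ) (hI₀.rotOp_covariant θ)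
      (hI₀.rotOp_covariant (-θ))) hgap'
  exact ⟨e, lam, S, hprob, hV, hinj, fun k w φ => isMode_iff.trans (hmode k _ φ)⟩

end Concrete

/-! ### Dispersion relations -/

section Dispersion

variable {H : Type*} [NormedAddCommGroup H] [InnerProductSpace ℂ H] {ι : Type*} [Fintype ι]
  {U : ℝ → H →ₗᵢ[ℂ] H} {V S : H →L[ℂ] H} {e : ι → H} {spin : ι → ℤ} {τ : ℝ}

/-- A small eigenvalue with a nonzero eigenvector is the value of one of the branches. -/
theorem exists_eq_branch {ζ : ι → ℂ} {x : ι → H} {w : ℂ} {y : H} (hy : y ≠ 0)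
    (h : ∃ c : ι → ℂ, y = ∑ i, c i • x i ∧ ∀ i, c i * (w - ζ i) = 0) : ∃ i, w = ζ i := by
  obtain ⟨c, rfl, hc⟩ := h
  by_contra! hw
  refine hy (Finset.sum_eq_zero fun i _ => ?_)
  rw [(mul_eq_zero.1 (hc i)).resolve_right (sub_ne_zero.2 (hw i)), zero_smul]

/-- Passing from the pencil to the modes is linear. -/
theorem mode_mem_span {x : ι → H} {y : H} (h : ∃ c : ι → ℂ, y = ∑ i, c i • x i) :
    spanProj e y + S y ∈ Submodule.span ℂ (Set.range fun i => spanProj e (x i) + S (x i)) := by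
  obtain ⟨c, rfl⟩ := h
  have h1 : spanProj e (∑ i, c i • x i) + S (∑ i, c i • x i) =
      ∑ i, c i • (spanProj e (x i) + S (x i)) := by
    simp only [map_sum, map_smul, smul_add, Finset.sum_add_distrib]
  rw [h1]
  exact sum_mem fun i _ => Submodule.smul_mem _ _ (Submodule.subset_span ⟨i, rfl⟩)

theorem IsModeProblem.modeOp_zero_e (h : IsModeProblem U V S e spin τ) (i : ι) :
    modeOp V S e 0 0 (e i) = 0 := by
  rw [modeOp_apply, h.spanProj_e]
  simp

end Dispersion

theorem I_mul_neg_I_mul (z : ℂ) : Complex.I * (-Complex.I * z) = z := by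
  linear_combination -z * Complex.I_mul_I

theorem eq_neg_I_mul_iff {w z : ℂ} : w = -Complex.I * z ↔ Complex.I * w = z := by
  refine ⟨fun h => by rw [h, I_mul_neg_I_mul], fun h => ?_⟩
  rw [← h]
  linear_combination w * Complex.I_mul_I

/-- The spin sectors of the two shear waves each contain a single conserved quantity. -/
theorem exists_shear_index {σ : ℤ} (hσ : σ = 1 ∨ σ = -1) :
    ∃ j : Fin 5, (![0, 0, 0, 1, -1] : Fin 5 → ℤ) j = σ ∧
      ∀ i, (![0, 0, 0, 1, -1] : Fin 5 → ℤ) i = (![0, 0, 0, 1, -1] : Fin 5 → ℤ) j → i = j := by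
  rcases hσ with rfl | rfl
  · exact ⟨3, rfl, by decide⟩
  · exact ⟨4, rfl, by decide⟩

end KineticTheory
end

theorem theorem1 (m T μ τ : ℝ) (hm : 0 ≤ m) (hT : 0 < T)
    (I₀ I : KineticTheory.StateSpace m T μ →ₗ.[ℂ] KineticTheory.StateSpace m T μ)
    (hI₀ : KineticTheory.IsCollisionOperator I₀)
    (hI : I = KineticTheory.friedrichs I₀ hI₀.nonneg)
    (hgap : KineticTheory.HasGap I τ) :
    -- every hydrodynamic dispersion relation is given by a convergent Taylor series
    (∀ ω : ℂ → ℂ, KineticTheory.IsHydroDispersion I ω →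
      AnalyticAt ℂ ω 0 ∧ 0 < KineticTheory.taylorRadius ω) ∧
    -- there are exactly five hydrodynamic modes, of spins 0, 0, 0, 1, -1
    (∃ ω : Fin 5 → ℂ → ℂ,
      (∀ s, KineticTheory.IsSpinDispersion I ((![0, 0, 0, 1, -1] : Fin 5 → ℤ) s) (ω s)) ∧
      ∃ δ > (0 : ℝ), ∃ ε > (0 : ℝ), ∀ k : ℂ, ‖k‖ < δ →
        ∃ φ : Fin 5 → KineticTheory.StateSpace m T μ, LinearIndependent ℂ φ ∧
          (∀ s, KineticTheory.HasSpin ((![0, 0, 0, 1, -1] : Fin 5 → ℤ) s) (φ s) ∧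
            KineticTheory.IsMode I k (ω s k) (φ s)) ∧
          ∀ (w : ℂ) (ψ : KineticTheory.StateSpace m T μ), ‖w‖ < ε →
            KineticTheory.IsMode I k w ψ → ψ ∈ Submodule.span ℂ (Set.range φ)) ∧
    -- shear waves: existence on the disc of radius 1 / (2 τ), and the bound on the radius
    (∀ σ : ℤ, σ = 1 ∨ σ = -1 →
      (∃ ω : ℂ → ℂ, KineticTheory.IsSpinDispersion I σ ω ∧
        AnalyticOnNhd ℂ ω (Metric.ball 0 (1 / (2 * τ))) ∧
        ∀ k ∈ Metric.ball (0 : ℂ) (1 / (2 * τ)), ∃ φ : KineticTheory.StateSpace m T μ,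
          φ ≠ 0 ∧ KineticTheory.HasSpin σ φ ∧ KineticTheory.IsMode I k (ω k) φ) ∧
      ∀ ω : ℂ → ℂ, KineticTheory.IsSpinDispersion I σ ω →
        ENNReal.ofReal (1 / (2 * τ)) ≤ KineticTheory.taylorRadius ω) := by
  obtain ⟨e, lam, S, hprob, hV, hinj, hmode⟩ :=
    KineticTheory.exists_isModeProblem hT hI₀ hI hgap
  have hne : ∀ {k z : ℂ} {x : KineticTheory.StateSpace m T μ}, x ≠ 0 →
      KineticTheory.modeOp (KineticTheory.velocityOp m T μ) S e k z x = 0 →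
      KineticTheory.spanProj e x + S x ≠ 0 := fun hx h1 h0 => hx (hprob.eq_zero_of_modeOp h1 h0)
  have hne' : ∀ {x : KineticTheory.StateSpace m T μ}, KineticTheory.spanProj e x + S x ≠ 0 →
      x ≠ 0 := by
    rintro x hx rfl
    exact hx (by rw [map_zero, map_zero, add_zero])
  have hsmall : ∀ {ω : ℂ → ℂ} {r : ℝ}, 0 < r → ω 0 = 0 →
      (∀ᶠ k in 𝓝 (0 : ℂ), ContinuousAt ω k) → ∀ᶠ k in 𝓝 (0 : ℂ), ‖Complex.I * ω k‖ < r := by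
    intro ω r hr h0 hc
    have h1 : ContinuousAt (fun k => ‖Complex.I * ω k‖) 0 :=
      (continuousAt_const.mul hc.self_of_nhds).norm
    refine h1.eventually_lt_const ?_
    simpa [h0] using hr
  obtain ⟨ζ, x, hζan, hζ0, ε, hε, hev⟩ := hprob.exists_hydro_branches hV hinj
  refine ⟨fun ω hω => ?_, ?_, fun σ hσ => ?_⟩
  -- a hydrodynamic dispersion relation is a continuous selection from the five branches
  · have hsel : ∀ᶠ k in 𝓝 (0 : ℂ), ContinuousAt ω k ∧ ∃ i, ω k = -Complex.I * ζ i k := by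
      filter_upwards [hω.2, hev, hsmall hε hω.1 (hω.2.mono fun k h => h.1)] with k h1 h2 h3
      obtain ⟨hc, φ, hφ, hm⟩ := h1
      obtain ⟨y, rfl, hy⟩ := (hmode k _ φ).1 hm
      obtain ⟨i, hi⟩ := KineticTheory.exists_eq_branch (hne' hφ) (h2.2.2 _ h3 y hy)
      exact ⟨hc, i, KineticTheory.eq_neg_I_mul_iff.2 hi⟩
    have han : ∀ i, AnalyticAt ℂ (fun k => -Complex.I * ζ i k) 0 := fun i =>
      analyticAt_const.mul (hζan i)
    obtain ⟨i, hi⟩ := KineticTheory.exists_eventuallyEq_of_selection han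
      (fun i => by simp [hζ0 i]) hω.1 hsel
    have hωan : AnalyticAt ℂ ω 0 := (han i).congr hi.symm
    exact ⟨hωan, KineticTheory.taylorRadius_pos hωan⟩
  · have hcont : ∀ᶠ k in 𝓝 (0 : ℂ), ∀ i, ContinuousAt (fun k => -Complex.I * ζ i k) k :=
      eventually_all.2 fun i => (analyticAt_const.mul (hζan i)).eventually_continuousAt
    refine ⟨fun i k => -Complex.I * ζ i k, fun i => ⟨by simp [hζ0 i], ?_⟩, ?_⟩
    · filter_upwards [hev, hcont] with k h1 h2
      refine ⟨h2 i, _, h1.2.1.ne_zero i,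
        KineticTheory.hasSpin_iff.2 (hprob.isSpin_mode (h1.1 i).1), (hmode k _ _).2 ⟨x i k, rfl, ?_⟩⟩
      rw [KineticTheory.I_mul_neg_I_mul]
      exact (h1.1 i).2
    · obtain ⟨δ, hδ, hball⟩ := Metric.eventually_nhds_iff_ball.1 hev
      refine ⟨δ, hδ, ε, hε, fun k hk => ?_⟩
      obtain ⟨h1, h2, h3⟩ := hball k (mem_ball_zero_iff.2 hk)
      refine ⟨fun i => KineticTheory.spanProj e (x i k) + S (x i k), h2, fun i => ⟨?_, ?_⟩, ?_⟩
      · exact KineticTheory.hasSpin_iff.2 (hprob.isSpin_mode (h1 i).1)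
      · refine (hmode k _ _).2 ⟨x i k, rfl, ?_⟩
        rw [KineticTheory.I_mul_neg_I_mul]
        exact (h1 i).2
      · intro w ψ hw hψ
        obtain ⟨y, rfl, hy⟩ := (hmode k _ ψ).1 hψ
        obtain ⟨c, hc, -⟩ := h3 (Complex.I * w) (by simpa using hw) y hy
        exact KineticTheory.mode_mem_span ⟨c, hc⟩
  · obtain ⟨j, rfl, hj⟩ := KineticTheory.exists_shear_index hσ
    obtain ⟨ξ, hξan, hξex, hξuniq⟩ := hprob.exists_analytic_eigenvalue hj
    have hr : 0 < 1 / (2 * τ) := one_div_pos.2 (mul_pos two_pos hprob.tau_pos)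
    have hball := Metric.ball_mem_nhds (0 : ℂ) hr
    -- the conserved quantity `e j` is a mode of frequency zero at `k = 0`
    have hξ0 : ξ 0 = 0 := (hξuniq 0 (Metric.mem_ball_self hr) 0 (by simpa using hr) (e j)
      (hprob.orthonormal.ne_zero j) (hprob.spin_e j) (hprob.modeOp_zero_e j)).symm
    have han : AnalyticOnNhd ℂ (fun k => -Complex.I * ξ k) (Metric.ball 0 (1 / (2 * τ))) :=
      fun k hk => analyticAt_const.mul (hξan k hk)
    have hmodes : ∀ k ∈ Metric.ball (0 : ℂ) (1 / (2 * τ)),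
        ∃ φ : KineticTheory.StateSpace m T μ, φ ≠ 0 ∧
          KineticTheory.HasSpin ((![0, 0, 0, 1, -1] : Fin 5 → ℤ) j) φ ∧
          KineticTheory.IsMode I k (-Complex.I * ξ k) φ := by
      intro k hk
      obtain ⟨y, hy, hs, hm⟩ := hξex k hk
      refine ⟨_, hne hy hm, KineticTheory.hasSpin_iff.2 (hprob.isSpin_mode hs),
        (hmode k _ _).2 ⟨y, rfl, ?_⟩⟩
      rw [KineticTheory.I_mul_neg_I_mul]
      exact hm
    refine ⟨⟨_, ⟨by simp [hξ0], ?_⟩, han, hmodes⟩, fun ω hω => ?_⟩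
    · filter_upwards [hball] with k hk
      exact ⟨(han k hk).continuousAt, hmodes k hk⟩
    · refine KineticTheory.le_taylorRadius hr han ?_
      filter_upwards [hω.2, hball, hsmall hr hω.1 (hω.2.mono fun k h => h.1)] with k h1 hk h2
      obtain ⟨-, φ, hφ, hs, hm⟩ := h1
      obtain ⟨y, rfl, hy⟩ := (hmode k _ φ).1 hm
      exact KineticTheory.eq_neg_I_mul_iff.2 (hξuniq k hk _ h2 y (hne' hφ)
        (hprob.isSpin_of_mode hy (KineticTheory.hasSpin_iff.1 hs)) hy)
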